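/- Let $d\ge 1$, $\mathbb R^d_+=(0,\infty)^d$, and let $$E=-\sum_{j=1}^d\Big(\frac{\partial}{\partial x_j}\Big(x_j\frac{\partial}{\partial x_j}\Big)-\frac{x_j}{4}+\frac12\Big)$$ be the Laguerre operator. For $n\in\mathbb N_0^d$ let $|n|=n_1+\dots+n_d$ and let $l_n(x)=\prod_{j=1}^d L_{n_j}(x_j)e^{-x_j/2}$ be the Laguerre functions, where $L_m(t)=\sum_{k=0}^m\binom mk\frac{(-1)^k}{k!}t^k$. For $\alpha>0$ let $\mathcal G_\alpha=\mathcal G_\alpha(\mathbb R^d_+)$ be the space of all complex-valued $f\in C^\infty(\mathbb R^d_+)$ such that for some $C,h>0$ $$\sup_{x\in\mathbb R^d_+}|E^Nf(x)|\le C\,h^N N!^{\alpha}\qquad\text{for all } N\in\mathbb N_0 .$$ It is the union over $h>0$ of the normed spaces with norms $\sup_{N\ge 0}\sup_x |E^Nf(x)|/(h^NN!^\alpha)$, and carries their locally convex inductive limit topology. Let $\mathcal G'_\alpha$ be its strong dual. The Laguerre coefficients are $a_n(f)=\int_{\mathbb R^d_+}f(x)l_n(x)\,dx$ for $f\in\mathcal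 G_\alpha$, and $a_n(F)=\langle F,l_n\rangle$ for $F\in\mathcal G'_\alpha$. In both spaces an element is determined by its Laguerre coefficients, and is identified with the formal Laguerre series $\sum_n a_n l_n$. For $z\in\mathbb C$ the propagator $e^{zE}$ acts on formal Laguerre series by $$e^{zE}\Big(\sum_{n\in\mathbb N_0^d}a_nl_n\Big)=\sum_{n\in\mathbb N_0^d}e^{z|n|}a_nl_n .$$ **Theorem 1.1.** (i) If $z\ne0$ and $0<\alpha<1$, then $e^{zE}$ restricts to a topological isomorphism of $\mathcal G_\alpha$ onto itself and of $\mathcal G'_\alpha$ onto itself. (ii) If $\operatorname{Re}z=0$, then the same holds for every $\alpha>0$. (iii) If $\alpha>1$ and $\operatorname{Re}z<0$, then $e^{zE}$ restricts to a continuous linear map of $\mathcal G_\alpha$ into itself, and of $\mathcal G'_\alpha$ into itself; each of these two maps is injective but not surjective. (iv) If $\alpha>1$ and $\operatorname{Re}z>0$, then $e^{zE}$ is not continuous on $\mathcal G_\alpha$: it does not restrict to a continuous map $\mathcal G_\alpha\to\mathcal G_\alpha$, and even on $\{f\in\mathcal G_\alpha: e^{zE}f\in\mathcal G_\alpha\}$,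 with the topology of $\mathcal G_\alpha$, it is not continuous as a map into $\mathcal G_\alpha$. -/

import Mathlib

open scoped ContDiff

noncomputable section

namespace Laguerre

/-! ### Smooth functions on the open orthant and the Laguerre operator -/

/-- The open orthant `(0, ∞)^d`. -/
def orthant (d : ℕ) : Set (Fin d → ℝ) := {x | ∀ j, 0 < x j}

theorem isOpen_orthant (d : ℕ) : IsOpen (orthant d) := by
  have h : orthant d = ⋂ j, {x : Fin d → ℝ | 0 < x j} := by
    ext x
    simp [orthant]
  rw [h]
  exact isOpen_iInter_of_finite fun j => isOpen_lt continuous_const (continuous_apply j)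

/-- `C^∞((0, ∞)^d)`, complex valued. A function on the orthant is represented by its
extension by zero to `ℝ^d`; no regularity is asked at the boundary of the orthant. -/
def SmoothFun (d : ℕ) : Submodule ℂ ((Fin d → ℝ) → ℂ) where
  carrier := {f | ContDiffOn ℝ ∞ f (orthant d) ∧ ∀ x, x ∉ orthant d → f x = 0}
  add_mem' := by
    rintro f g ⟨hf, hf'⟩ ⟨hg, hg'⟩
    exact ⟨hf.add hg, fun x hx => by simp [hf' x hx, hg' x hx]⟩
  zero_mem' := ⟨contDiffOn_const, fun _ _ => rfl⟩
  smul_mem' := by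
    rintro c f ⟨hf, hf'⟩
    exact ⟨contDiffOn_const.smul hf, fun x hx => by simp [hf' x hx]⟩

/-- The element of `C^∞((0, ∞)^d)` given by a formula `g`; values off the orthant are discarded. -/
def SmoothFun.mk {d : ℕ} (g : (Fin d → ℝ) → ℂ) (hg : ContDiffOn ℝ ∞ g (orthant d)) :
    SmoothFun d :=
  ⟨(orthant d).indicator g,
    hg.congr fun _ hx => Set.indicator_of_mem hx g, fun _ hx => Set.indicator_of_notMem hx g⟩

theorem SmoothFun.mk_apply {d : ℕ} (g : (Fin d → ℝ) → ℂ) (hg : ContDiffOn ℝ ∞ g (orthant d))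
    {x : Fin d → ℝ} (hx : x ∈ orthant d) : (SmoothFun.mk g hg).1 x = g x :=
  Set.indicator_of_mem hx g

theorem SmoothFun.ext_orthant {d : ℕ} {f g : SmoothFun d}
    (h : ∀ x ∈ orthant d, f.1 x = g.1 x) : f = g := by
  apply Subtype.ext
  funext x
  by_cases hx : x ∈ orthant d
  · exact h x hx
  · rw [f.2.2 x hx, g.2.2 x hx]

theorem SmoothFun.contDiffOn {d : ℕ} (f : SmoothFun d) : ContDiffOn ℝ ∞ f.1 (orthant d) := f.2.1

theorem SmoothFun.diffAt {d : ℕ} (f : SmoothFun d) {x : Fin d → ℝ}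
    (hx : x ∈ orthant d) : DifferentiableAt ℝ f.1 x :=
  ((SmoothFun.contDiffOn f).differentiableOn (by simp)).differentiableAt ((isOpen_orthant d).mem_nhds hx)

/-- The partial derivative `∂/∂x_j` on `C^∞((0, ∞)^d)`. -/
def partialDeriv {d : ℕ} (j : Fin d) : SmoothFun d →ₗ[ℂ] SmoothFun d where
  toFun f := SmoothFun.mk (fun x => fderiv ℝ f.1 x (Pi.single j 1))
    (((SmoothFun.contDiffOn f).fderiv_of_isOpen (isOpen_orthant d) (by simp)).clm_apply contDiffOn_const)
  map_add' f g := SmoothFun.ext_orthant fun x hx => by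
    have h : fderiv ℝ (f + g).1 x = fderiv ℝ f.1 x + fderiv ℝ g.1 x :=
      fderiv_add (SmoothFun.diffAt f hx) (SmoothFun.diffAt g hx)
    refine (SmoothFun.mk_apply _ _ hx).trans ?_
    rw [h, Submodule.coe_add, Pi.add_apply, SmoothFun.mk_apply _ _ hx, SmoothFun.mk_apply _ _ hx]
    rfl
  map_smul' c f := SmoothFun.ext_orthant fun x hx => by
    have h : fderiv ℝ (c • f).1 x = c • fderiv ℝ f.1 x :=
      fderiv_const_smul (SmoothFun.diffAt f hx) c
    refine (SmoothFun.mk_apply _ _ hx).trans ?_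
    rw [h, Submodule.coe_smul, Pi.smul_apply, SmoothFun.mk_apply _ _ hx]
    rfl

theorem SmoothFun.contDiffOn_coord_mul {d : ℕ} (j : Fin d) (f : SmoothFun d) :
    ContDiffOn ℝ ∞ (fun x => (x j : ℂ) * f.1 x) (orthant d) :=
  (Complex.ofRealCLM.contDiff.comp (contDiff_apply ℝ ℝ j)).contDiffOn.mul
    (SmoothFun.contDiffOn f)

/-- Multiplication by the coordinate `x_j` on `C^∞((0, ∞)^d)`. -/
def mulCoord {d : ℕ} (j : Fin d) : SmoothFun d →ₗ[ℂ] SmoothFun d where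
  toFun f := SmoothFun.mk (fun x => (x j : ℂ) * f.1 x)
    (SmoothFun.contDiffOn_coord_mul j f)
  map_add' f g := SmoothFun.ext_orthant fun x hx => by
    refine (SmoothFun.mk_apply _ _ hx).trans ?_
    rw [Submodule.coe_add, Submodule.coe_add, Pi.add_apply, Pi.add_apply,
      SmoothFun.mk_apply _ _ hx, SmoothFun.mk_apply _ _ hx]
    ring
  map_smul' c f := SmoothFun.ext_orthant fun x hx => by
    refine (SmoothFun.mk_apply _ _ hx).trans ?_
    rw [Submodule.coe_smul, Submodule.coe_smul, Pi.smul_apply, Pi.smul_apply,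
      SmoothFun.mk_apply _ _ hx, smul_eq_mul, smul_eq_mul, RingHom.id_apply]
    ring

theorem partialDeriv_apply {d : ℕ} (j : Fin d) (f : SmoothFun d) {x : Fin d → ℝ}
    (hx : x ∈ orthant d) : (partialDeriv j f).1 x = fderiv ℝ f.1 x (Pi.single j 1) :=
  Set.indicator_of_mem hx fun x => fderiv ℝ f.1 x (Pi.single j 1)

theorem mulCoord_apply {d : ℕ} (j : Fin d) (f : SmoothFun d) {x : Fin d → ℝ}
    (hx : x ∈ orthant d) : (mulCoord j f).1 x = (x j : ℂ) * f.1 x :=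
  Set.indicator_of_mem hx fun x => (x j : ℂ) * f.1 x

/-- The Laguerre operator `E = -∑_j (∂_j (x_j ∂_j) - x_j / 4 + 1 / 2)`. -/
def laguerreOp (d : ℕ) : Module.End ℂ (SmoothFun d) :=
  -∑ j : Fin d, (partialDeriv j ∘ₗ mulCoord j ∘ₗ partialDeriv j
    - (1 / 4 : ℂ) • mulCoord j + (1 / 2 : ℂ) • LinearMap.id)

/-! ### The space `𝒢_α` and its inductive limit topology -/

/-- The bound `sup_x |E^N f (x)| ≤ M h^N N!^α` for all `N = 0, 1, 2, …`. For fixed `h > 0`, the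
functions for which it holds for some `M` form the space `𝒢_{α,h}`, and the least such `M` is the
norm of `f` in it. -/
def StepBound {d : ℕ} (α h M : ℝ) (f : SmoothFun d) : Prop :=
  ∀ N : ℕ, ∀ x ∈ orthant d,
    ‖((laguerreOp d ^ N) f).1 x‖ ≤ M * h ^ N * (N.factorial : ℝ) ^ α

theorem StepBound.mono {d : ℕ} {α h h' M M' : ℝ} {f : SmoothFun d} (hf : StepBound α h M f)
    (hM : 0 ≤ M) (h0 : 0 ≤ h) (hh : h ≤ h') (hMM : M ≤ M') : StepBound α h' M' f := by
  intro N x hx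
  refine (hf N x hx).trans ?_
  gcongr
  exact hM.trans hMM

/-- The underlying vector space of `𝒢_α((0, ∞)^d)`. -/
def gSubmodule (d : ℕ) (α : ℝ) : Submodule ℂ (SmoothFun d) where
  carrier := {f | ∃ C h : ℝ, 0 < C ∧ 0 < h ∧ StepBound α h C f}
  add_mem' := by
    rintro f g ⟨C, h, hC, hh, hf⟩ ⟨C', h', hC', hh', hg⟩
    refine ⟨C + C', max h h', by positivity, lt_max_of_lt_left hh, fun N x hx => ?_⟩
    have h1 := hf.mono hC.le hh.le (le_max_left h h') le_rfl N x hx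
    have h2 := hg.mono hC'.le hh'.le (le_max_right h h') le_rfl N x hx
    rw [map_add, Submodule.coe_add, Pi.add_apply]
    calc _ ≤ _ := norm_add_le _ _
      _ ≤ _ := add_le_add h1 h2
      _ = _ := by ring
  zero_mem' := ⟨1, 1, one_pos, one_pos, fun N x hx => by
    rw [map_zero]
    simp only [Submodule.coe_zero, Pi.zero_apply, norm_zero]
    positivity⟩
  smul_mem' := by
    rintro c f ⟨C, h, hC, hh, hf⟩
    refine ⟨(‖c‖ + 1) * C, h, by positivity, hh, fun N x hx => ?_⟩
    rw [map_smul, Submodule.coe_smul, Pi.smul_apply, norm_smul]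
    calc _ ≤ (‖c‖ + 1) * (C * h ^ N * (N.factorial : ℝ) ^ α) :=
          mul_le_mul (by linarith) (hf N x hx) (norm_nonneg _) (by positivity)
      _ = _ := by ring

/-- The space `𝒢_α((0, ∞)^d)`: all `f ∈ C^∞((0, ∞)^d)` such that, for some `C, h > 0`,
`sup_x |E^N f (x)| ≤ C h^N N!^α` for all `N`. -/
def G (d : ℕ) (α : ℝ) : Type := ↥(gSubmodule d α)

instance (d : ℕ) (α : ℝ) : AddCommGroup (G d α) :=
  inferInstanceAs (AddCommGroup ↥(gSubmodule d α))

instance (d : ℕ) (α : ℝ) : Module ℂ (G d α) :=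
  inferInstanceAs (Module ℂ ↥(gSubmodule d α))

/-- The smooth function underlying an element of `𝒢_α`. -/
def G.toSmooth {d : ℕ} {α : ℝ} (f : G d α) : SmoothFun d := f.1

/-- A seminorm on `𝒢_α` whose restriction to each of the normed spaces `𝒢_{α,h}`, `h > 0`,
is continuous. -/
def IsAdmissible {d : ℕ} {α : ℝ} (p : Seminorm ℂ (G d α)) : Prop :=
  ∀ h : ℝ, 0 < h → ∃ C : ℝ, ∀ (f : G d α) (M : ℝ), StepBound α h M f.toSmooth → p f ≤ C * M

/-- The family of all admissible seminorms. -/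
def admissibleSeminorms (d : ℕ) (α : ℝ) :
    SeminormFamily ℂ (G d α) {p : Seminorm ℂ (G d α) // IsAdmissible p} :=
  fun p => p.1

instance (d : ℕ) (α : ℝ) : Nonempty {p : Seminorm ℂ (G d α) // IsAdmissible p} :=
  ⟨⟨0, fun _ _ => ⟨0, fun _ _ _ => by simp⟩⟩⟩

/-- The locally convex inductive limit topology of `𝒢_α = ⋃_{h > 0} 𝒢_{α,h}`, i.e. the finest
locally convex topology for which all inclusions `𝒢_{α,h} → 𝒢_α` are continuous. It is generated
by all seminorms whose restrictions to the `𝒢_{α,h}` are continuous. -/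
instance (d : ℕ) (α : ℝ) : TopologicalSpace (G d α) :=
  (admissibleSeminorms d α).moduleFilterBasis.topology

theorem withSeminorms_G (d : ℕ) (α : ℝ) : WithSeminorms (admissibleSeminorms d α) := ⟨rfl⟩

instance (d : ℕ) (α : ℝ) : IsTopologicalAddGroup (G d α) :=
  (withSeminorms_G d α).topologicalAddGroup

instance (d : ℕ) (α : ℝ) : ContinuousSMul ℂ (G d α) :=
  (withSeminorms_G d α).continuousSMul

/-- The space `𝒢'_α` of ultradistributions: the strong dual of `𝒢_α`, i.e. the continuous linear
functionals with the topology of uniform convergence on bounded sets. -/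
abbrev GDual (d : ℕ) (α : ℝ) : Type := StrongDual ℂ (G d α)

/-! ### Laguerre functions -/

/-- The Laguerre polynomial `L_n (x) = ∑_{k ≤ n} (-1)^k (n choose k) x^k / k!`. -/
def laguerrePoly (n : ℕ) : Polynomial ℝ :=
  ∑ k ∈ Finset.range (n + 1),
    Polynomial.monomial k ((-1) ^ k * (n.choose k : ℝ) / (k.factorial : ℝ))

/-- The Laguerre function of one variable `l_n (x) = L_n (x) e^{-x/2}`. -/
def laguerreFn (n : ℕ) (x : ℝ) : ℝ := (laguerrePoly n).eval x * Real.exp (-x / 2)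

/-- The Laguerre function of `d` variables `l_n (x) = ∏_j l_{n_j} (x_j)`. -/
def laguerreFun {d : ℕ} (n : Fin d → ℕ) (x : Fin d → ℝ) : ℝ := ∏ j, laguerreFn (n j) (x j)

theorem contDiff_laguerreFn (n : ℕ) : ContDiff ℝ ∞ (laguerreFn n) :=
  (laguerrePoly n).contDiff_aeval (𝕜 := ℝ) ∞ |>.mul (Real.contDiff_exp.comp (contDiff_id.neg.div_const 2))

/-- A product of functions of one variable, as an element of `C^∞((0, ∞)^d)`. -/
def tensor {d : ℕ} (φ : Fin d → ℝ → ℝ) (hφ : ∀ j, ContDiff ℝ ∞ (φ j)) : SmoothFun d :=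
  SmoothFun.mk (fun x => ((∏ j, φ j (x j) : ℝ) : ℂ))
    (Complex.ofRealCLM.contDiff.comp
      (contDiff_prod fun j _ => (hφ j).comp (contDiff_apply ℝ ℝ j))).contDiffOn

/-- The Laguerre function `l_n` as an element of `C^∞((0, ∞)^d)`. -/
def laguerreSmooth {d : ℕ} (n : Fin d → ℕ) : SmoothFun d :=
  tensor (fun j => laguerreFn (n j)) fun j => contDiff_laguerreFn (n j)

theorem tensor_eq {d : ℕ} (φ : Fin d → ℝ → ℝ) (hφ : ∀ j, ContDiff ℝ ∞ (φ j)) (j : Fin d)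
    {x : Fin d → ℝ} (hx : x ∈ orthant d) :
    (tensor φ hφ).1 x = (φ j (x j) : ℂ) * ((∏ i ∈ Finset.univ.erase j, φ i (x i) : ℝ) : ℂ) := by
  refine (SmoothFun.mk_apply _ _ hx).trans ?_
  rw [← Finset.mul_prod_erase _ _ (Finset.mem_univ j)]
  push_cast
  rfl

/-- If `f (x) = φ (x_j) K (x)` on the orthant and `K` does not depend on `x_j`, then
`∂_j f (x) = φ' (x_j) K (x)`. -/
theorem partialDeriv_apply_of_eq {d : ℕ} (j : Fin d) (f : SmoothFun d) (φ φ' : ℝ → ℝ)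
    (hφ : ∀ t, HasDerivAt φ (φ' t) t) (K : (Fin d → ℝ) → ℂ)
    (hK : ∀ x (t : ℝ), K (x + t • Pi.single j 1) = K x)
    (hf : ∀ x ∈ orthant d, f.1 x = (φ (x j) : ℂ) * K x) {x : Fin d → ℝ} (hx : x ∈ orthant d) :
    (partialDeriv j f).1 x = (φ' (x j) : ℂ) * K x := by
  rw [partialDeriv_apply j f hx, ← (SmoothFun.diffAt f hx).lineDeriv_eq_fderiv]
  have hc : Continuous fun t : ℝ => x + t • (Pi.single j 1 : Fin d → ℝ) := by fun_prop
  have hmem : ∀ᶠ t in nhds (0 : ℝ), x + t • (Pi.single j 1 : Fin d → ℝ) ∈ orthant d :=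
    hc.continuousAt.eventually_mem ((isOpen_orthant d).mem_nhds (by simpa using hx))
  have heq : (fun t : ℝ => f.1 (x + t • Pi.single j 1)) =ᶠ[nhds 0]
      fun t : ℝ => (φ (x j + t) : ℂ) * K x := by
    filter_upwards [hmem] with t ht
    rw [hf _ ht, hK]
    simp
  have hd : HasDerivAt (fun t : ℝ => (φ (x j + t) : ℂ) * K x) ((φ' (x j) : ℂ) * K x) 0 := by
    have h1 : HasDerivAt (fun t : ℝ => φ (x j + t)) (φ' (x j)) 0 := by
      have := hφ (x j + 0)
      simpa using this.comp_const_add (x j) 0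
    exact h1.ofReal_comp.mul_const _
  exact (hd.congr_of_eventuallyEq heq).deriv

/-- The Laguerre differential equation `x L'' + (1 - x) L' + n L = 0`. -/
theorem laguerrePoly_ode (n : ℕ) :
    Polynomial.X * Polynomial.derivative (Polynomial.derivative (laguerrePoly n))
      + (1 - Polynomial.X) * Polynomial.derivative (laguerrePoly n)
      + Polynomial.C (n : ℝ) * laguerrePoly n = 0 := by
  have hc : ∀ k, (laguerrePoly n).coeff k
      = (-1) ^ k * (n.choose k : ℝ) / (k.factorial : ℝ) := by
    intro k
    rw [laguerrePoly, Polynomial.finsetSum_coeff]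
    simp only [Polynomial.coeff_monomial]
    rw [Finset.sum_ite_eq' ]
    split_ifs with h
    · rfl
    · rw [Nat.choose_eq_zero_of_lt (by simpa using h)]
      simp
  have hrec : ∀ k : ℕ, ((k : ℝ) + 1) ^ 2 * (laguerrePoly n).coeff (k + 1)
      = ((k : ℝ) - n) * (laguerrePoly n).coeff k := by
    intro k
    rw [hc, hc]
    have h1 : ((n.choose (k + 1) : ℝ)) * ((k : ℝ) + 1) = (n.choose k : ℝ) * ((n : ℝ) - k) := by
      rcases le_or_gt k n with h | h
      · have := Nat.choose_succ_right_eq n k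
        rw [← Nat.cast_sub h]
        exact_mod_cast this
      · rw [Nat.choose_eq_zero_of_lt h, Nat.choose_eq_zero_of_lt (h.trans (Nat.lt_succ_self k))]
        simp
    rw [Nat.factorial_succ]
    push_cast
    have hk : (k.factorial : ℝ) ≠ 0 := by positivity
    have hk' : (k : ℝ) + 1 ≠ 0 := by positivity
    field_simp
    rw [pow_succ]
    linear_combination (-(-1) ^ k) * h1
  ext k
  rw [sub_mul, one_mul]
  rcases k with _ | k
  · have := hrec 0
    simp [Polynomial.coeff_derivative] at this ⊢
    linear_combination this
  · have := hrec (k + 1)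
    simp only [Polynomial.coeff_add, Polynomial.coeff_sub, Polynomial.coeff_X_mul,
      Polynomial.coeff_derivative, Polynomial.coeff_C_mul, Polynomial.coeff_zero]
    push_cast at this ⊢
    linear_combination this

/-- The derivative of `L_n (x) e^{-x/2}`. -/
def laguerreFnDeriv (n : ℕ) (x : ℝ) : ℝ :=
  ((Polynomial.derivative (laguerrePoly n)).eval x - (laguerrePoly n).eval x / 2)
    * Real.exp (-x / 2)

theorem hasDerivAt_exp_half (t : ℝ) :
    HasDerivAt (fun x : ℝ => Real.exp (-x / 2)) (Real.exp (-t / 2) * (-1 / 2)) t :=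
  (((hasDerivAt_id t).neg).div_const 2).exp

theorem hasDerivAt_laguerreFn (n : ℕ) (t : ℝ) :
    HasDerivAt (laguerreFn n) (laguerreFnDeriv n t) t := by
  have h := ((laguerrePoly n).hasDerivAt t).mul (hasDerivAt_exp_half t)
  refine h.congr_deriv ?_
  unfold laguerreFnDeriv
  ring

theorem hasDerivAt_mul_laguerreFnDeriv (n : ℕ) (t : ℝ) :
    HasDerivAt (fun x => x * laguerreFnDeriv n x)
      ((t / 4 - 1 / 2 - n) * laguerreFn n t) t := by
  have h := (hasDerivAt_id t).mul
    ((((Polynomial.derivative (laguerrePoly n)).hasDerivAt t).sub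
      (((laguerrePoly n).hasDerivAt t).div_const 2)).mul (hasDerivAt_exp_half t))
  refine h.congr_deriv ?_
  have hode := congrArg (Polynomial.eval t) (laguerrePoly_ode n)
  simp only [Polynomial.eval_add, Polynomial.eval_sub, Polynomial.eval_mul, Polynomial.eval_X,
    Polynomial.eval_C, Polynomial.eval_one, Polynomial.eval_zero] at hode
  unfold laguerreFn
  simp only [id_eq, Pi.sub_apply, Pi.mul_apply]
  linear_combination Real.exp (-t / 2) * hode

theorem laguerreOp_laguerreSmooth {d : ℕ} (n : Fin d → ℕ) :
    laguerreOp d (laguerreSmooth n) = ((∑ j, n j : ℕ) : ℂ) • laguerreSmooth n := by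
  have key : ∀ j : Fin d, (partialDeriv j ∘ₗ mulCoord j ∘ₗ partialDeriv j
      - (1 / 4 : ℂ) • mulCoord j + (1 / 2 : ℂ) • LinearMap.id : Module.End ℂ (SmoothFun d))
        (laguerreSmooth n)
      = (-(n j : ℂ)) • laguerreSmooth n := by
    intro j
    set K : (Fin d → ℝ) → ℂ := fun x =>
      ((∏ i ∈ Finset.univ.erase j, laguerreFn (n i) (x i) : ℝ) : ℂ) with hKdef
    have hK : ∀ x (t : ℝ), K (x + t • Pi.single j 1) = K x := by
      intro x t
      simp only [hKdef]
      congr 1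
      refine Finset.prod_congr rfl fun i hi => ?_
      simp [Pi.single_eq_of_ne (Finset.ne_of_mem_erase hi)]
    have h0 : ∀ x ∈ orthant d, (laguerreSmooth n).1 x = (laguerreFn (n j) (x j) : ℂ) * K x :=
      fun x hx => tensor_eq _ _ j hx
    have h1 : ∀ x ∈ orthant d, (partialDeriv j (laguerreSmooth n)).1 x
        = (laguerreFnDeriv (n j) (x j) : ℂ) * K x := fun x hx =>
      partialDeriv_apply_of_eq j _ _ _ (hasDerivAt_laguerreFn (n j)) K hK h0 hx
    have h2 : ∀ x ∈ orthant d, (mulCoord j (partialDeriv j (laguerreSmooth n))).1 x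
        = (((x j) * laguerreFnDeriv (n j) (x j) : ℝ) : ℂ) * K x := fun x hx => by
      rw [mulCoord_apply _ _ hx, h1 x hx]
      push_cast
      ring
    have h3 : ∀ x ∈ orthant d,
        (partialDeriv j (mulCoord j (partialDeriv j (laguerreSmooth n)))).1 x
        = (((x j / 4 - 1 / 2 - n j) * laguerreFn (n j) (x j) : ℝ) : ℂ) * K x := fun x hx =>
      partialDeriv_apply_of_eq j _ (fun t => t * laguerreFnDeriv (n j) t)
        (fun t => (t / 4 - 1 / 2 - n j) * laguerreFn (n j) t)
        (hasDerivAt_mul_laguerreFnDeriv (n j)) K hK h2 hx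
    refine SmoothFun.ext_orthant fun x hx => ?_
    have h4 : (mulCoord j (laguerreSmooth n)).1 x
        = (x j : ℂ) * ((laguerreFn (n j) (x j) : ℂ) * K x) := by
      rw [mulCoord_apply _ _ hx, h0 x hx]
    simp only [LinearMap.add_apply, LinearMap.sub_apply, LinearMap.comp_apply,
      LinearMap.smul_apply, LinearMap.id_apply, Submodule.coe_add, Submodule.coe_sub,
      Submodule.coe_smul, Pi.add_apply, Pi.sub_apply, Pi.smul_apply, smul_eq_mul]
    rw [h3 x hx, h4, h0 x hx]
    push_cast
    ring
  rw [laguerreOp, LinearMap.neg_apply, LinearMap.sum_apply, Finset.sum_congr rfl fun j _ => key j,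
    ← Finset.sum_smul, ← neg_smul]
  congr 1
  push_cast
  simp

theorem laguerreOp_pow_laguerreSmooth {d : ℕ} (n : Fin d → ℕ) (N : ℕ) :
    (laguerreOp d ^ N) (laguerreSmooth n) = ((∑ j, n j : ℕ) : ℂ) ^ N • laguerreSmooth n := by
  induction N with
  | zero => simp
  | succ N ih => rw [pow_succ', Module.End.mul_apply, ih, map_smul, laguerreOp_laguerreSmooth,
      smul_smul, pow_succ]

theorem laguerreFn_bounded (n : ℕ) : ∃ B : ℝ, 0 ≤ B ∧ ∀ x : ℝ, 0 < x → |laguerreFn n x| ≤ B := by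
  have hlim : Filter.Tendsto (laguerreFn n) Filter.atTop (nhds 0) := by
    have h := (((laguerrePoly n).comp (Polynomial.C 2 * Polynomial.X)).tendsto_div_exp_atTop).comp
      (Filter.tendsto_id.atTop_div_const (two_pos : (0 : ℝ) < 2))
    refine h.congr fun x => ?_
    simp only [Function.comp_apply, id_eq, Polynomial.eval_comp, Polynomial.eval_mul,
      Polynomial.eval_C, Polynomial.eval_X, laguerreFn, neg_div, Real.exp_neg]
    rw [mul_div_cancel₀ x (two_ne_zero : (2 : ℝ) ≠ 0), div_eq_mul_inv]
  obtain ⟨A, hA⟩ := Filter.eventually_atTop.1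
    (hlim.eventually (Metric.ball_mem_nhds (0 : ℝ) one_pos))
  obtain ⟨B, hB⟩ := (isCompact_Icc (a := (0 : ℝ)) (b := A)).exists_bound_of_continuousOn
    (contDiff_laguerreFn n).continuous.continuousOn
  refine ⟨max B 1, le_max_of_le_right zero_le_one, fun x hx => ?_⟩
  rcases le_total x A with h | h
  · exact (hB x ⟨hx.le, h⟩).trans (le_max_left _ _)
  · have := hA x h
    rw [dist_zero_right] at this
    exact this.le.trans (le_max_right _ _)

theorem laguerreSmooth_mem {d : ℕ} {α : ℝ} (hα : 0 < α) (n : Fin d → ℕ) :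
    laguerreSmooth n ∈ gSubmodule d α := by
  choose B hB0 hB using laguerreFn_bounded
  have hP : 0 ≤ ∏ j, B (n j) := Finset.prod_nonneg fun j _ => hB0 (n j)
  refine ⟨(∏ j, B (n j)) + 1, ((∑ j, n j : ℕ) : ℝ) + 1, by positivity, by positivity,
    fun N x hx => ?_⟩
  rw [laguerreOp_pow_laguerreSmooth, Submodule.coe_smul, Pi.smul_apply, norm_smul, norm_pow,
    Complex.norm_natCast]
  have h1 : ‖(laguerreSmooth n).1 x‖ ≤ (∏ j, B (n j)) + 1 := by
    have : (laguerreSmooth n).1 x = ((∏ j, laguerreFn (n j) (x j) : ℝ) : ℂ) :=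
      Set.indicator_of_mem hx fun x => ((∏ j, laguerreFn (n j) (x j) : ℝ) : ℂ)
    rw [this, Complex.norm_real, Real.norm_eq_abs, Finset.abs_prod]
    exact (Finset.prod_le_prod (fun _ _ => abs_nonneg _) fun j _ => hB _ _ (hx j)).trans
      (by linarith)
  have h2 : (1 : ℝ) ≤ (N.factorial : ℝ) ^ α :=
    Real.one_le_rpow (by exact_mod_cast Nat.factorial_pos N) hα.le
  calc ((∑ j, n j : ℕ) : ℝ) ^ N * ‖(laguerreSmooth n).1 x‖
      ≤ (((∑ j, n j : ℕ) : ℝ) + 1) ^ N * ((∏ j, B (n j)) + 1) := by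
        gcongr
        linarith
    _ = ((∏ j, B (n j)) + 1) * (((∑ j, n j : ℕ) : ℝ) + 1) ^ N * 1 := by ring
    _ ≤ _ := by gcongr

/-- The Laguerre function `l_n` as an element of `𝒢_α`, `α > 0`. -/
def laguerreG {d : ℕ} {α : ℝ} (hα : 0 < α) (n : Fin d → ℕ) : G d α :=
  ⟨laguerreSmooth n, laguerreSmooth_mem hα n⟩

/-! ### Formal Laguerre series and the propagator -/

/-- The space `𝒢'_0` of all formal Laguerre series `∑_n a_n l_n`, given by their coefficients. -/
abbrev FormalSeries (d : ℕ) : Type := (Fin d → ℕ) → ℂ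

/-- The Laguerre series of `f ∈ 𝒢_α`, with coefficients `a_n (f) = ∫ f (x) l_n (x) dx`. -/
def series {d : ℕ} {α : ℝ} (f : G d α) : FormalSeries d :=
  fun n => ∫ x in orthant d, f.toSmooth.1 x * (laguerreFun n x : ℂ)

/-- The Laguerre series of an ultradistribution `F ∈ 𝒢'_α`, with coefficients
`a_n (F) = ⟨F, l_n⟩`. -/
def dualSeries {d : ℕ} {α : ℝ} (hα : 0 < α) (F : GDual d α) : FormalSeries d :=
  fun n => F (laguerreG hα n)

/-- The propagator `e^{zE}` on formal Laguerre series: `∑ a_n l_n ↦ ∑ e^{z|n|} a_n l_n`, where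
`|n| = n_1 + ⋯ + n_d`. -/
def propagator {d : ℕ} (z : ℂ) (a : FormalSeries d) : FormalSeries d :=
  fun n => Complex.exp (z * ((∑ j, n j : ℕ) : ℂ)) * a n

end Laguerre

end

/-!
# The propagator of the Laguerre operator on `𝒢_α` and on its dual

The spaces are reduced to spaces of coefficient sequences, on which the propagator is the multiplier
`e^{z|n|}`. The counterpart of the step bound `|E^N f| ≤ M h^N N!^α` is
`|n|^N |a_n| ≤ M h^N N!^α` (`SeqBound`), and both passages preserve the steps of the inductive limit:

* Analysis (`exists_analysis`). One needs `a_n (E f) = |n| a_n (f)`, although functions in `𝒢_α`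
  satisfy no explicit boundary condition. Boundedness of `f` and `E f` replaces it: with the cutoffs
  `ψ (log x_j / L)` the error terms in Green's formula are `O(1 / L)` in `L¹`, that is, the boundary
  has capacity zero (`integral_laguerreOp_mul`). The norms `‖l_n‖₁` grow polynomially in `n`, which
  is absorbed by enlarging `h` (`exists_weight_absorb`).
* Synthesis (`exists_synthesis`). The Euler operator `x_j ∂_j` shifts the index of `l_n` by at most
  one, with coefficients linear in `n`, and `‖l_n‖_∞` grows polynomially. Hence a Laguerre series
  with rapidly decreasing coefficients is smooth on the orthant and `E` acts on it term by term.
* Uniqueness (`series_injective`). All weighted moments of a bounded function with vanishing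
  coefficients vanish; expanding `e^{iθ}` in small steps of `θ`, so does the Fourier transform of
  `f e^{-|x|/2}`.

A map that sends steps to steps is continuous for the inductive limit topology, so a multiplier that
preserves the bounds on coefficients acts continuously on `𝒢_α`, and its transpose acts on `𝒢'_α` by
the same multiplier. For `Re z ≤ 0` this is clear; for `α < 1` one expands
`e^{r|n|} = ∑ r^m |n|^m / m!` and uses that `∑ x^m m!^{α-1}` converges. For `α > 1` exponential decay
of the coefficients is enough for `𝒢_α`. So the function with coefficients `e^{z|n|}`, `Re z < 0`,
lies in `𝒢_α`, but the constant sequence `1` does not belong to `𝒢_α`; and `e^{z|n|} l_n → 0` in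
`𝒢_α`, whereas the functional `f ↦ ∑ a_n (f)` is `1` on every `l_n`. These two facts give the failure
of surjectivity and of continuity. The functional determined by its values on the `l_n`
(`dualSeries_injective`) comes from the convergence of Laguerre series within a step.
-/

namespace Laguerre

open MeasureTheory Set Filter Topology

noncomputable section

/-! ### Laguerre functions of one variable -/

theorem coeff_laguerrePoly (n k : ℕ) :
    (laguerrePoly n).coeff k = (-1) ^ k * (n.choose k : ℝ) / (k.factorial : ℝ) := by
  rw [laguerrePoly, Polynomial.finsetSum_coeff]
  simp only [Polynomial.coeff_monomial]
  rw [Finset.sum_ite_eq']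
  split_ifs with h
  · rfl
  · rw [Nat.choose_eq_zero_of_lt (by simpa using h)]
    simp

theorem cast_choose_mul_succ (n k : ℕ) :
    ((n.choose k : ℕ) : ℝ) * (n + 1) = ((n + 1).choose k : ℝ) * (n + 1 - k) := by
  rcases le_or_gt k (n + 1) with h | h
  · have := Nat.choose_mul_succ_eq n k
    have h2 : ((n + 1 - k : ℕ) : ℝ) = n + 1 - k := by
      rw [Nat.cast_sub h]; push_cast; ring
    rw [← h2]
    exact_mod_cast this
  · rw [Nat.choose_eq_zero_of_lt h, Nat.choose_eq_zero_of_lt (by omega)]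
    simp

/-- `x L_n' = n (L_n - L_{n-1})`. -/
theorem X_mul_derivative_laguerrePoly (n : ℕ) :
    Polynomial.X * Polynomial.derivative (laguerrePoly n)
      = Polynomial.C (n : ℝ) * (laguerrePoly n - laguerrePoly (n - 1)) := by
  rcases n with _ | n
  · simp [laguerrePoly]
  ext k
  rw [Polynomial.coeff_C_mul, Polynomial.coeff_sub, Nat.add_sub_cancel]
  have h := cast_choose_mul_succ n k
  rcases k with _ | k
  · simp [coeff_laguerrePoly]
  · rw [Polynomial.coeff_X_mul, Polynomial.coeff_derivative, coeff_laguerrePoly,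
      coeff_laguerrePoly]
    have hk : ((k + 1).factorial : ℝ) ≠ 0 := by positivity
    field_simp
    push_cast at h ⊢
    linear_combination h

/-- `L_{n+1}' = L_n' - L_n`. -/
theorem derivative_laguerrePoly_succ (n : ℕ) :
    Polynomial.derivative (laguerrePoly (n + 1))
      = Polynomial.derivative (laguerrePoly n) - laguerrePoly n := by
  ext k
  rw [Polynomial.coeff_sub, Polynomial.coeff_derivative, Polynomial.coeff_derivative,
    coeff_laguerrePoly, coeff_laguerrePoly, coeff_laguerrePoly, Nat.choose_succ_succ,
    Nat.factorial_succ]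
  have hk : (k.factorial : ℝ) ≠ 0 := by positivity
  push_cast
  field_simp
  ring

/-- The three-term recurrence `x L_n = -(n+1) L_{n+1} + (2n+1) L_n - n L_{n-1}`. -/
theorem X_mul_laguerrePoly (n : ℕ) :
    Polynomial.X * laguerrePoly n = -Polynomial.C ((n : ℝ) + 1) * laguerrePoly (n + 1)
      + Polynomial.C (2 * (n : ℝ) + 1) * laguerrePoly n
      - Polynomial.C (n : ℝ) * laguerrePoly (n - 1) := by
  rcases n with _ | n
  · ext k
    rcases k with _ | _ | k
    · simp [coeff_laguerrePoly]
    · simp [coeff_laguerrePoly, Polynomial.coeff_X_mul, neg_mul]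
    · simp [coeff_laguerrePoly, Polynomial.coeff_X_mul, neg_mul,
        Nat.choose_eq_zero_of_lt (show 1 < k + 1 + 1 by omega)]
  ext k
  rw [Nat.add_sub_cancel, neg_mul]
  simp only [Polynomial.coeff_add, Polynomial.coeff_sub, Polynomial.coeff_neg,
    Polynomial.coeff_C_mul]
  rcases k with _ | k
  · simp [coeff_laguerrePoly]
    ring
  · rw [Polynomial.coeff_X_mul]
    simp only [coeff_laguerrePoly]
    have h := cast_choose_mul_succ n k
    rw [Nat.choose_succ_succ (n + 1) k, Nat.choose_succ_succ n k, Nat.factorial_succ]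
    have hk : (k.factorial : ℝ) ≠ 0 := by positivity
    push_cast
    field_simp
    rw [pow_succ]
    linear_combination (-1) ^ k * h

theorem mul_laguerreFn (n : ℕ) (x : ℝ) :
    x * laguerreFn n x = -((n : ℝ) + 1) * laguerreFn (n + 1) x
      + (2 * (n : ℝ) + 1) * laguerreFn n x - n * laguerreFn (n - 1) x := by
  have h := congrArg (Polynomial.eval x) (X_mul_laguerrePoly n)
  simp only [Polynomial.eval_add, Polynomial.eval_sub, Polynomial.eval_mul, Polynomial.eval_X,
    Polynomial.eval_C, Polynomial.eval_neg] at h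
  unfold laguerreFn
  linear_combination Real.exp (-x / 2) * h

theorem mul_laguerreFnDeriv (n : ℕ) (x : ℝ) :
    x * laguerreFnDeriv n x = ((n : ℝ) + 1) / 2 * laguerreFn (n + 1) x
      - 1 / 2 * laguerreFn n x - n / 2 * laguerreFn (n - 1) x := by
  have h := congrArg (Polynomial.eval x) (X_mul_derivative_laguerrePoly n)
  have h2 := mul_laguerreFn n x
  simp only [Polynomial.eval_sub, Polynomial.eval_mul, Polynomial.eval_X,
    Polynomial.eval_C] at h
  unfold laguerreFn at h2 ⊢
  unfold laguerreFnDeriv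
  linear_combination Real.exp (-x / 2) * h - 1 / 2 * h2

theorem laguerreFnDeriv_eq_sum (n : ℕ) (x : ℝ) :
    laguerreFnDeriv n x = -∑ k ∈ Finset.range n, laguerreFn k x - laguerreFn n x / 2 := by
  have h : (Polynomial.derivative (laguerrePoly n)).eval x
      = -∑ k ∈ Finset.range n, (laguerrePoly k).eval x := by
    induction n with
    | zero => simp [laguerrePoly]
    | succ n ih =>
      rw [derivative_laguerrePoly_succ, Polynomial.eval_sub, ih, Finset.sum_range_succ]
      ring
  unfold laguerreFnDeriv laguerreFn
  rw [h, ← Finset.sum_mul]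
  ring

theorem tendsto_eval_mul_exp_neg (P : Polynomial ℝ) {b : ℝ} (hb : 0 < b) :
    Tendsto (fun x => P.eval x * Real.exp (-b * x)) atTop (𝓝 0) := by
  have h := ((P.comp (Polynomial.C b⁻¹ * Polynomial.X)).tendsto_div_exp_atTop).comp
    (tendsto_id.const_mul_atTop hb)
  refine h.congr fun x => ?_
  simp only [Function.comp_apply, id_eq, Polynomial.eval_comp, Polynomial.eval_mul,
    Polynomial.eval_C, Polynomial.eval_X, neg_mul, Real.exp_neg]
  rw [inv_mul_cancel_left₀ hb.ne', div_eq_mul_inv]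

theorem integrableOn_eval_mul_exp_neg (P : Polynomial ℝ) {b : ℝ} (hb : 0 < b) :
    IntegrableOn (fun x => P.eval x * Real.exp (-b * x)) (Ioi 0) := by
  refine integrable_of_isBigO_exp_neg (half_pos hb) (by fun_prop) ?_
  have h := (tendsto_eval_mul_exp_neg P (half_pos hb)).isBigO_one ℝ
  have h2 := h.mul (Asymptotics.isBigO_refl (fun x => Real.exp (-(b / 2) * x)) atTop)
  refine (h2.congr_left fun x => ?_).congr_right fun x => by simp
  rw [mul_assoc, ← Real.exp_add]
  congr 2
  ring

theorem laguerreFn_mul_eq (P : Polynomial ℝ) (n : ℕ) (x : ℝ) :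
    P.eval x * laguerreFn n x = (P * laguerrePoly n).eval x * Real.exp (-(1 / 2) * x) := by
  rw [laguerreFn, Polynomial.eval_mul, mul_assoc]
  congr 3
  ring

theorem integrableOn_laguerreFn (n : ℕ) : IntegrableOn (laguerreFn n) (Ioi 0) := by
  refine (integrableOn_eval_mul_exp_neg (laguerrePoly n) (b := 1 / 2) (by norm_num)).congr_fun
    (fun x _ => ?_) measurableSet_Ioi
  simpa using (laguerreFn_mul_eq 1 n x).symm

theorem laguerreFn_mul_laguerreFn (P : Polynomial ℝ) (n m : ℕ) (x : ℝ) :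
    P.eval x * (laguerreFn n x * laguerreFn m x)
      = (P * laguerrePoly n * laguerrePoly m).eval x * Real.exp (-1 * x) := by
  have : Real.exp (-1 * x) = Real.exp (-x / 2) * Real.exp (-x / 2) := by
    rw [← Real.exp_add]; congr 1; ring
  rw [this]
  simp only [laguerreFn, Polynomial.eval_mul]
  ring

theorem integrableOn_laguerreFn_mul (P : Polynomial ℝ) (n m : ℕ) :
    IntegrableOn (fun x => P.eval x * (laguerreFn n x * laguerreFn m x)) (Ioi 0) := by
  simp_rw [laguerreFn_mul_laguerreFn]
  exact integrableOn_eval_mul_exp_neg _ one_pos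

theorem integrableOn_laguerreFn_mul_laguerreFn (n m : ℕ) :
    IntegrableOn (fun x => laguerreFn n x * laguerreFn m x) (Ioi 0) := by
  simpa using integrableOn_laguerreFn_mul 1 n m

/-- The Wronskian identity `(x (l_n' l_m - l_n l_m'))' = (m - n) l_n l_m` gives orthogonality. -/
theorem integral_laguerreFn_mul_of_ne {n m : ℕ} (h : n ≠ m) :
    ∫ x in Ioi (0 : ℝ), laguerreFn n x * laguerreFn m x = 0 := by
  have hd : ∀ x : ℝ, HasDerivAt (fun x => (x * laguerreFnDeriv n x) * laguerreFn m x
      - laguerreFn n x * (x * laguerreFnDeriv m x))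
      (((m : ℝ) - n) * (laguerreFn n x * laguerreFn m x)) x := by
    intro x
    have := ((hasDerivAt_mul_laguerreFnDeriv n x).mul (hasDerivAt_laguerreFn m x)).sub
      ((hasDerivAt_laguerreFn n x).mul (hasDerivAt_mul_laguerreFnDeriv m x))
    refine this.congr_deriv ?_
    ring
  have hlim : Tendsto (fun x => (x * laguerreFnDeriv n x) * laguerreFn m x
      - laguerreFn n x * (x * laguerreFnDeriv m x)) atTop (𝓝 0) := by
    refine (tendsto_eval_mul_exp_neg (Polynomial.X *
      (Polynomial.derivative (laguerrePoly n) * laguerrePoly m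
        - laguerrePoly n * Polynomial.derivative (laguerrePoly m))) one_pos).congr fun x => ?_
    have : Real.exp (-1 * x) = Real.exp (-x / 2) * Real.exp (-x / 2) := by
      rw [← Real.exp_add]; congr 1; ring
    rw [this]
    simp only [laguerreFn, laguerreFnDeriv, Polynomial.eval_mul, Polynomial.eval_sub,
      Polynomial.eval_X]
    ring
  have key := integral_Ioi_of_hasDerivAt_of_tendsto' (a := 0) (fun x _ => hd x)
    ((integrableOn_laguerreFn_mul_laguerreFn n m).const_mul _) hlim
  rw [integral_const_mul] at key
  have hne : (m : ℝ) - n ≠ 0 := sub_ne_zero.2 (by exact_mod_cast h.symm)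
  simpa [hne] using key

theorem integral_linear_combination_three {f g h : ℝ → ℝ} {s : Set ℝ} (hf : IntegrableOn f s)
    (hg : IntegrableOn g s) (hh : IntegrableOn h s) (a b c : ℝ) :
    ∫ x in s, (a * f x + b * g x + c * h x)
      = a * (∫ x in s, f x) + b * (∫ x in s, g x) + c * ∫ x in s, h x := by
  have h1 : IntegrableOn (fun x => a * f x + b * g x) s := (hf.const_mul a).add (hg.const_mul b)
  rw [integral_add h1 (hh.const_mul c), integral_add (hf.const_mul a) (hg.const_mul b),
    integral_const_mul, integral_const_mul, integral_const_mul]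

theorem laguerreFn_zero (x : ℝ) : laguerreFn 0 x = Real.exp (-x / 2) := by
  simp [laguerreFn, laguerrePoly]

/-- The three-term recurrence moves `x` from `l_{n+1}` to `l_n`, so all the norms agree. -/
theorem integral_laguerreFn_sq (n : ℕ) :
    ∫ x in Ioi (0 : ℝ), laguerreFn n x * laguerreFn n x = 1 := by
  induction n with
  | zero =>
    have : ∀ x : ℝ, laguerreFn 0 x * laguerreFn 0 x = Real.exp (-x) := by
      intro x
      rw [laguerreFn_zero, ← Real.exp_add]; congr 1; ring
    simp_rw [this]
    exact integral_exp_neg_Ioi_zero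
  | succ n ih =>
    have hi := integrableOn_laguerreFn_mul_laguerreFn
    have h1 : ∫ x in Ioi (0 : ℝ), x * (laguerreFn n x * laguerreFn (n + 1) x)
        = -((n : ℝ) + 1) * ∫ x in Ioi (0 : ℝ), laguerreFn (n + 1) x * laguerreFn (n + 1) x := by
      have : ∀ x : ℝ, x * (laguerreFn n x * laguerreFn (n + 1) x)
          = -((n : ℝ) + 1) * (laguerreFn (n + 1) x * laguerreFn (n + 1) x)
            + (2 * (n : ℝ) + 1) * (laguerreFn n x * laguerreFn (n + 1) x)
            + (-n : ℝ) * (laguerreFn (n - 1) x * laguerreFn (n + 1) x) := by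
        intro x
        linear_combination laguerreFn (n + 1) x * mul_laguerreFn n x
      simp_rw [this]
      rw [integral_linear_combination_three (hi _ _) (hi _ _) (hi _ _),
        integral_laguerreFn_mul_of_ne (by omega : n ≠ n + 1),
        integral_laguerreFn_mul_of_ne (by omega : n - 1 ≠ n + 1)]
      ring
    have h2 : ∫ x in Ioi (0 : ℝ), x * (laguerreFn n x * laguerreFn (n + 1) x)
        = -((n : ℝ) + 1) * ∫ x in Ioi (0 : ℝ), laguerreFn n x * laguerreFn n x := by
      have : ∀ x : ℝ, x * (laguerreFn n x * laguerreFn (n + 1) x)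
          = -((n : ℝ) + 2) * (laguerreFn n x * laguerreFn (n + 2) x)
            + (2 * (n : ℝ) + 3) * (laguerreFn n x * laguerreFn (n + 1) x)
            + (-((n : ℝ) + 1)) * (laguerreFn n x * laguerreFn n x) := by
        intro x
        have := mul_laguerreFn (n + 1) x
        rw [Nat.add_sub_cancel] at this
        push_cast at this
        linear_combination laguerreFn n x * this
      simp_rw [this]
      rw [integral_linear_combination_three (hi _ _) (hi _ _) (hi _ _),
        integral_laguerreFn_mul_of_ne (by omega : n ≠ n + 1),
        integral_laguerreFn_mul_of_ne (by omega : n ≠ n + 2)]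
      ring
    rw [h1, ih, mul_one] at h2
    have hn : -((n : ℝ) + 1) ≠ 0 := by
      have : (0 : ℝ) < n + 1 := by positivity
      linarith
    exact mul_left_cancel₀ hn (h2.trans (mul_one _).symm)

theorem tendsto_laguerreFn (n : ℕ) : Tendsto (laguerreFn n) atTop (𝓝 0) := by
  refine (tendsto_eval_mul_exp_neg (laguerrePoly n) (b := 1 / 2) (by norm_num)).congr fun x => ?_
  simpa using (laguerreFn_mul_eq 1 n x).symm

theorem integrableOn_laguerreFn_sq (n : ℕ) :
    IntegrableOn (fun x => laguerreFn n x ^ 2) (Ioi 0) := by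
  simpa [sq] using integrableOn_laguerreFn_mul_laguerreFn n n

theorem integral_laguerreFn_pow_two (n : ℕ) :
    ∫ x in Ioi (0 : ℝ), laguerreFn n x ^ 2 = 1 := by
  simpa [sq] using integral_laguerreFn_sq n

theorem laguerreFnDeriv_sq_le (n : ℕ) (x : ℝ) :
    laguerreFnDeriv n x ^ 2 ≤ (n + 1) * ∑ k ∈ Finset.range (n + 1), laguerreFn k x ^ 2 := by
  have h : laguerreFnDeriv n x = -∑ k ∈ Finset.range (n + 1),
      (if k = n then laguerreFn k x / 2 else laguerreFn k x) := by
    rw [laguerreFnDeriv_eq_sum, Finset.sum_range_succ, if_pos rfl,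
      Finset.sum_congr rfl fun k hk => if_neg (Finset.mem_range.1 hk).ne]
    ring
  rw [h, neg_sq]
  refine (sq_sum_le_card_mul_sum_sq).trans ?_
  rw [Finset.card_range]
  push_cast
  refine mul_le_mul_of_nonneg_left (Finset.sum_le_sum fun k _ => ?_) (by positivity)
  split_ifs
  · nlinarith [sq_nonneg (laguerreFn k x)]
  · rfl

theorem continuous_laguerreFn (n : ℕ) : Continuous (laguerreFn n) :=
  (contDiff_laguerreFn n).continuous

theorem continuous_laguerreFnDeriv (n : ℕ) : Continuous (laguerreFnDeriv n) := by
  unfold laguerreFnDeriv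
  fun_prop

theorem integrableOn_sum_laguerreFn_sq (n : ℕ) :
    IntegrableOn (fun x => ∑ k ∈ Finset.range n, laguerreFn k x ^ 2) (Ioi 0) :=
  integrable_finsetSum _ fun k _ => integrableOn_laguerreFn_sq k

theorem integral_sum_laguerreFn_sq (n : ℕ) :
    ∫ x in Ioi (0 : ℝ), ∑ k ∈ Finset.range n, laguerreFn k x ^ 2 = n := by
  rw [integral_finsetSum _ fun k _ => integrableOn_laguerreFn_sq k]
  simp [integral_laguerreFn_pow_two]

/-- A polynomial bound for the sup norm: `l_n (x)² = -∫_x^∞ 2 l_n l_n' ≤ ‖l_n‖² + ‖l_n'‖²`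
in `L²`, and `l_n'` is a combination of `l_0, …, l_n` with coefficients at most `1`. -/
theorem abs_laguerreFn_le (n : ℕ) {x : ℝ} (hx : 0 ≤ x) : |laguerreFn n x| ≤ n + 2 := by
  set g : ℝ → ℝ := fun t => laguerreFn n t ^ 2
    + (n + 1) * ∑ k ∈ Finset.range (n + 1), laguerreFn k t ^ 2 with hg
  have hgi : IntegrableOn g (Ioi 0) :=
    (integrableOn_laguerreFn_sq n).add ((integrableOn_sum_laguerreFn_sq (n + 1)).const_mul _)
  have hgint : ∫ t in Ioi (0 : ℝ), g t = 1 + (n + 1) * (n + 1) := by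
    rw [hg, integral_add (integrableOn_laguerreFn_sq n)
      ((integrableOn_sum_laguerreFn_sq (n + 1)).const_mul _), integral_const_mul,
      integral_sum_laguerreFn_sq, integral_laguerreFn_pow_two]
    push_cast
    ring
  have hle : ∀ t, |2 * laguerreFn n t * laguerreFnDeriv n t| ≤ g t := by
    intro t
    have h1 := laguerreFnDeriv_sq_le n t
    rw [abs_le]
    constructor
    · nlinarith [sq_nonneg (laguerreFn n t + laguerreFnDeriv n t)]
    · nlinarith [sq_nonneg (laguerreFn n t - laguerreFnDeriv n t)]
  have hd : ∀ t, HasDerivAt (fun t => laguerreFn n t ^ 2)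
      (2 * laguerreFn n t * laguerreFnDeriv n t) t := by
    intro t
    refine ((hasDerivAt_laguerreFn n t).pow 2).congr_deriv ?_
    norm_num
  have hsub : Ioi x ⊆ Ioi (0 : ℝ) := Ioi_subset_Ioi hx
  have hi : IntegrableOn (fun t => 2 * laguerreFn n t * laguerreFnDeriv n t) (Ioi x) := by
    refine (hgi.mono_set hsub).mono' ?_ (ae_of_all _ hle)
    exact (((continuous_laguerreFn n).const_mul 2).mul
      (continuous_laguerreFnDeriv n)).aestronglyMeasurable
  have hlim : Tendsto (fun t => laguerreFn n t ^ 2) atTop (𝓝 0) := by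
    simpa using (tendsto_laguerreFn n).pow 2
  have key := integral_Ioi_of_hasDerivAt_of_tendsto' (a := x) (fun t _ => hd t) hi hlim
  have h2 : laguerreFn n x ^ 2 ≤ 1 + (n + 1) * (n + 1) := by
    calc laguerreFn n x ^ 2 = |∫ t in Ioi x, 2 * laguerreFn n t * laguerreFnDeriv n t| := by
          rw [key, zero_sub, abs_neg, abs_of_nonneg (sq_nonneg _)]
      _ ≤ ∫ t in Ioi x, |2 * laguerreFn n t * laguerreFnDeriv n t| := abs_integral_le_integral_abs
      _ ≤ ∫ t in Ioi x, g t := integral_mono hi.abs (hgi.mono_set hsub) hle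
      _ ≤ ∫ t in Ioi (0 : ℝ), g t := by
          refine setIntegral_mono_set hgi (ae_of_all _ fun t => ?_) hsub.eventuallyLE
          exact (abs_nonneg _).trans (hle t)
      _ = _ := hgint
  refine abs_le_of_sq_le_sq (h2.trans ?_) (by positivity)
  have : (0 : ℝ) ≤ n := Nat.cast_nonneg n
  nlinarith

theorem integrableOn_one_add_inv_sq :
    IntegrableOn (fun x : ℝ => ((1 + x) ^ 2)⁻¹) (Ioi 0) ∧
      ∫ x in Ioi (0 : ℝ), ((1 + x) ^ 2)⁻¹ = 1 := by
  have hd : ∀ x ∈ Ici (0 : ℝ), HasDerivAt (fun x : ℝ => -(1 + x)⁻¹) (((1 + x) ^ 2)⁻¹) x := by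
    intro x hx
    have hx' : (0 : ℝ) ≤ x := hx
    have := (((hasDerivAt_id x).const_add 1).inv (by simp; linarith)).neg
    refine this.congr_deriv ?_
    simp [neg_div]
  have hlim : Tendsto (fun x : ℝ => -(1 + x)⁻¹) atTop (𝓝 0) := by
    have h : Tendsto (fun x : ℝ => (1 + x)⁻¹) atTop (𝓝 0) :=
      tendsto_inv_atTop_zero.comp (tendsto_atTop_add_const_left _ _ tendsto_id)
    simpa using h.neg
  have hi := integrableOn_Ioi_deriv_of_nonneg' (a := 0) hd (fun x _ => by positivity) hlim
  refine ⟨hi, ?_⟩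
  rw [integral_Ioi_of_hasDerivAt_of_tendsto' hd hi hlim]
  norm_num

/-- A polynomial bound for the `L¹` norm: `2 |l_n| ≤ ((1 + x) l_n)² + (1 + x)⁻²`, and
`(1 + x) l_n` is expanded by the three-term recurrence. -/
theorem integral_abs_laguerreFn_le (n : ℕ) :
    ∫ x in Ioi (0 : ℝ), |laguerreFn n x| ≤ 19 * ((n : ℝ) + 1) ^ 2 := by
  set S : ℝ → ℝ := fun x =>
    1 * laguerreFn (n + 1) x ^ 2 + 1 * laguerreFn n x ^ 2 + 1 * laguerreFn (n - 1) x ^ 2 with hS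
  have hi := integrableOn_laguerreFn_sq
  have hSi : IntegrableOn S (Ioi 0) :=
    (((hi _).const_mul 1).add ((hi _).const_mul 1)).add ((hi _).const_mul 1)
  have hSint : ∫ x in Ioi (0 : ℝ), S x = 3 := by
    rw [hS, integral_linear_combination_three (hi _) (hi _) (hi _)]
    simp only [integral_laguerreFn_pow_two]
    norm_num
  have hw := integrableOn_one_add_inv_sq
  have hgi : IntegrableOn (fun x => 6 * ((n : ℝ) + 1) ^ 2 * S x + 1 / 2 * ((1 + x) ^ 2)⁻¹)
      (Ioi 0) := (hSi.const_mul _).add (hw.1.const_mul _)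
  have hle : ∀ x ∈ Ioi (0 : ℝ),
      |laguerreFn n x| ≤ 6 * ((n : ℝ) + 1) ^ 2 * S x + 1 / 2 * ((1 + x) ^ 2)⁻¹ := by
    intro x hx
    have hx' : (0 : ℝ) < 1 + x := by
      have : (0 : ℝ) < x := hx
      linarith
    set a := laguerreFn (n + 1) x
    set b := laguerreFn n x
    set c := laguerreFn (n - 1) x
    have hrec : (1 + x) * b = -((n : ℝ) + 1) * a + 2 * ((n : ℝ) + 1) * b - n * c := by
      linear_combination mul_laguerreFn n x
    have hA : ((1 + x) * b) ^ 2 ≤ 12 * ((n : ℝ) + 1) ^ 2 * S x := by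
      have h3 : (n * c) ^ 2 ≤ (((n : ℝ) + 1) * c) ^ 2 := by
        rw [mul_pow, mul_pow]
        gcongr
        linarith
      have h4 : (-((n : ℝ) + 1) * a + 2 * ((n : ℝ) + 1) * b - n * c) ^ 2
          ≤ 3 * ((((n : ℝ) + 1) * a) ^ 2 + (2 * ((n : ℝ) + 1) * b) ^ 2 + (n * c) ^ 2) := by
        nlinarith [sq_nonneg (((n : ℝ) + 1) * a + 2 * ((n : ℝ) + 1) * b),
          sq_nonneg (((n : ℝ) + 1) * a - n * c), sq_nonneg (2 * ((n : ℝ) + 1) * b + n * c)]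
      rw [hrec]
      refine h4.trans ?_
      have : S x = a ^ 2 + b ^ 2 + c ^ 2 := by simp only [hS, one_mul]; rfl
      rw [this]
      nlinarith [sq_nonneg (((n : ℝ) + 1) * a), sq_nonneg (((n : ℝ) + 1) * c)]
    have hb : |b| = |(1 + x) * b| * (1 + x)⁻¹ := by
      rw [abs_mul, abs_of_pos hx']
      field_simp
    have hAM : |(1 + x) * b| * (1 + x)⁻¹ ≤ 1 / 2 * ((1 + x) * b) ^ 2 + 1 / 2 * ((1 + x) ^ 2)⁻¹ := by
      rw [← inv_pow, ← sq_abs ((1 + x) * b)]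
      nlinarith [sq_nonneg (|(1 + x) * b| - (1 + x)⁻¹)]
    rw [hb]
    linarith
  refine (setIntegral_mono_on (integrableOn_laguerreFn n).abs hgi measurableSet_Ioi hle).trans ?_
  rw [integral_add (hSi.const_mul _) (hw.1.const_mul _), integral_const_mul, integral_const_mul,
    hSint, hw.2]
  nlinarith [sq_nonneg (n : ℝ), (Nat.cast_nonneg n : (0 : ℝ) ≤ n)]

/-! ### Laguerre functions of several variables -/

/-- The length `|n| = n_1 + ⋯ + n_d` of a multi-index. -/
def deg {d : ℕ} (n : Fin d → ℕ) : ℕ := ∑ j, n j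

theorem le_deg {d : ℕ} (n : Fin d → ℕ) (j : Fin d) : n j ≤ deg n :=
  Finset.single_le_sum (f := n) (fun _ _ => Nat.zero_le _) (Finset.mem_univ j)

theorem cast_le_deg {d : ℕ} (n : Fin d → ℕ) (j : Fin d) : (n j : ℝ) ≤ deg n :=
  by exact_mod_cast le_deg n j

theorem volume_restrict_orthant (d : ℕ) :
    (volume : Measure (Fin d → ℝ)).restrict (orthant d)
      = Measure.pi fun _ => (volume : Measure ℝ).restrict (Ioi 0) := by
  have h : orthant d = Set.univ.pi fun _ => Ioi (0 : ℝ) := by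
    ext x
    simp [orthant]
  rw [h, volume_pi, Measure.restrict_pi_pi]

theorem integrableOn_orthant_prod {d : ℕ} {φ : Fin d → ℝ → ℝ}
    (h : ∀ j, IntegrableOn (φ j) (Ioi 0)) :
    IntegrableOn (fun x : Fin d → ℝ => ∏ j, φ j (x j)) (orthant d) := by
  rw [IntegrableOn, volume_restrict_orthant]
  exact Integrable.fintype_prod h

theorem integral_orthant_prod {d : ℕ} (φ : Fin d → ℝ → ℝ) :
    ∫ x in orthant d, ∏ j, φ j (x j) = ∏ j, ∫ t in Ioi 0, φ j t := by
  rw [volume_restrict_orthant]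
  exact integral_fintype_prod_eq_prod _

theorem measurableSet_orthant (d : ℕ) : MeasurableSet (orthant d) :=
  (isOpen_orthant d).measurableSet

theorem continuous_laguerreFun {d : ℕ} (n : Fin d → ℕ) : Continuous (laguerreFun n) :=
  continuous_finsetProd _ fun j _ => (continuous_laguerreFn (n j)).comp (continuous_apply j)

theorem integrableOn_laguerreFun {d : ℕ} (n : Fin d → ℕ) :
    IntegrableOn (laguerreFun n) (orthant d) :=
  integrableOn_orthant_prod fun j => integrableOn_laguerreFn (n j)

theorem integral_abs_laguerreFun_le {d : ℕ} (n : Fin d → ℕ) :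
    ∫ x in orthant d, |laguerreFun n x| ≤ 19 ^ d * (1 + (deg n : ℝ)) ^ (2 * d) := by
  simp only [laguerreFun, Finset.abs_prod]
  rw [integral_orthant_prod fun j t => |laguerreFn (n j) t|]
  calc ∏ j, ∫ t in Ioi 0, |laguerreFn (n j) t|
      ≤ ∏ _j : Fin d, 19 * (1 + (deg n : ℝ)) ^ 2 := by
        refine Finset.prod_le_prod (fun j _ => integral_nonneg fun _ => abs_nonneg _)
          fun j _ => (integral_abs_laguerreFn_le (n j)).trans ?_
        have := cast_le_deg n j
        gcongr 19 * ?_ ^ 2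
        linarith
    _ = _ := by
        rw [Finset.prod_const, Finset.card_univ, Fintype.card_fin, mul_pow, ← pow_mul]

theorem abs_laguerreFun_le {d : ℕ} (n : Fin d → ℕ) {x : Fin d → ℝ} (hx : x ∈ orthant d) :
    |laguerreFun n x| ≤ 2 ^ d * (1 + (deg n : ℝ)) ^ d := by
  rw [laguerreFun, Finset.abs_prod]
  calc ∏ j, |laguerreFn (n j) (x j)| ≤ ∏ _j : Fin d, (2 * (1 + (deg n : ℝ))) := by
        refine Finset.prod_le_prod (fun j _ => abs_nonneg _)
          fun j _ => (abs_laguerreFn_le (n j) (hx j).le).trans ?_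
        have := cast_le_deg n j
        have h0 : (0 : ℝ) ≤ n j := Nat.cast_nonneg _
        linarith
    _ = _ := by rw [Finset.prod_const, Finset.card_univ, Fintype.card_fin, mul_pow]

theorem integral_laguerreFun_mul {d : ℕ} (n m : Fin d → ℕ) :
    ∫ x in orthant d, laguerreFun n x * laguerreFun m x = if n = m then 1 else 0 := by
  simp only [laguerreFun, ← Finset.prod_mul_distrib]
  rw [integral_orthant_prod fun j t => laguerreFn (n j) t * laguerreFn (m j) t]
  split_ifs with h
  · subst h
    simp [integral_laguerreFn_sq]
  · obtain ⟨j, hj⟩ := Function.ne_iff.1 h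
    exact Finset.prod_eq_zero (Finset.mem_univ j) (integral_laguerreFn_mul_of_ne hj)

theorem summable_inv_one_add_deg_pow (d : ℕ) :
    Summable fun n : Fin d → ℕ => ((1 + (deg n : ℝ)) ^ (2 * d))⁻¹ := by
  have h1 : Summable fun k : ℕ => ((1 + (k : ℝ)) ^ 2)⁻¹ := by
    have := (summable_nat_add_iff 1).2 (Real.summable_nat_pow_inv.2 (one_lt_two))
    refine this.congr fun k => ?_
    push_cast
    rw [add_comm]
  refine summable_of_sum_le (c := (∑' k : ℕ, ((1 + (k : ℝ)) ^ 2)⁻¹) ^ d)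
    (fun n => by positivity) fun s => ?_
  -- a finite set of multi-indices lies in a cube, on which the product weight factorizes
  set K := s.sup deg + 1
  have hsub : s ⊆ Fintype.piFinset fun _ : Fin d => Finset.range K := by
    intro n hn
    rw [Fintype.mem_piFinset]
    intro j
    exact Finset.mem_range.2 (Nat.lt_succ_of_le ((le_deg n j).trans (Finset.le_sup hn)))
  calc ∑ n ∈ s, ((1 + (deg n : ℝ)) ^ (2 * d))⁻¹
      ≤ ∑ n ∈ s, ∏ j, ((1 + (n j : ℝ)) ^ 2)⁻¹ := by
        refine Finset.sum_le_sum fun n _ => ?_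
        rw [Finset.prod_inv_distrib]
        refine inv_anti₀ (Finset.prod_pos fun j _ => by positivity) ?_
        calc ∏ j, (1 + (n j : ℝ)) ^ 2 ≤ ∏ _j : Fin d, (1 + (deg n : ℝ)) ^ 2 := by
              refine Finset.prod_le_prod (fun j _ => by positivity) fun j _ => ?_
              have := cast_le_deg n j
              gcongr
          _ = _ := by rw [Finset.prod_const, Finset.card_univ, Fintype.card_fin, ← pow_mul]
    _ ≤ ∑ n ∈ Fintype.piFinset fun _ : Fin d => Finset.range K, ∏ j, ((1 + (n j : ℝ)) ^ 2)⁻¹ :=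
        Finset.sum_le_sum_of_subset_of_nonneg hsub fun _ _ _ =>
          Finset.prod_nonneg fun j _ => by positivity
    _ = ∏ _j : Fin d, ∑ k ∈ Finset.range K, ((1 + (k : ℝ)) ^ 2)⁻¹ :=
        (Finset.prod_univ_sum (fun _ : Fin d => Finset.range K)
          fun _ k => ((1 + (k : ℝ)) ^ 2)⁻¹).symm
    _ ≤ ∏ _j : Fin d, ∑' k : ℕ, ((1 + (k : ℝ)) ^ 2)⁻¹ :=
        Finset.prod_le_prod (fun _ _ => Finset.sum_nonneg fun _ _ => by positivity)
          fun _ _ => h1.sum_le_tsum _ fun _ _ => by positivity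
    _ = _ := by rw [Finset.prod_const, Finset.card_univ, Fintype.card_fin]

theorem laguerreSmooth_apply {d : ℕ} (n : Fin d → ℕ) {x : Fin d → ℝ} (hx : x ∈ orthant d) :
    (laguerreSmooth n).1 x = (laguerreFun n x : ℂ) :=
  Set.indicator_of_mem hx fun x => ((∏ j, laguerreFn (n j) (x j) : ℝ) : ℂ)

theorem norm_laguerreSmooth_le {d : ℕ} (n : Fin d → ℕ) (x : Fin d → ℝ) :
    ‖(laguerreSmooth n).1 x‖ ≤ 2 ^ d * (1 + (deg n : ℝ)) ^ d := by
  by_cases hx : x ∈ orthant d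
  · rw [laguerreSmooth_apply n hx, Complex.norm_real]
    exact abs_laguerreFun_le n hx
  · rw [(laguerreSmooth n).2.2 x hx, norm_zero]
    positivity

theorem laguerreOp_laguerreSmooth_deg {d : ℕ} (n : Fin d → ℕ) :
    laguerreOp d (laguerreSmooth n) = (deg n : ℂ) • laguerreSmooth n :=
  laguerreOp_laguerreSmooth n

theorem laguerreOp_apply {d : ℕ} (f : SmoothFun d) (x : Fin d → ℝ) : (laguerreOp d f).1 x
    = -∑ j, ((partialDeriv j (mulCoord j (partialDeriv j f))).1 x
      - (1 / 4 : ℂ) * (mulCoord j f).1 x + (1 / 2 : ℂ) * f.1 x) := by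
  simp [laguerreOp, Finset.sum_apply]

/-- The product of all factors of `l_n` except the `j`-th one. -/
def laguerreFunErase {d : ℕ} (n : Fin d → ℕ) (j : Fin d) (x : Fin d → ℝ) : ℂ :=
  ((∏ i ∈ Finset.univ.erase j, laguerreFn (n i) (x i) : ℝ) : ℂ)

theorem laguerreSmooth_update_apply {d : ℕ} (n : Fin d → ℕ) (j : Fin d) (m : ℕ)
    {x : Fin d → ℝ} (hx : x ∈ orthant d) :
    (laguerreSmooth (Function.update n j m)).1 x
      = (laguerreFn m (x j) : ℂ) * laguerreFunErase n j x := by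
  refine (tensor_eq _ _ j hx).trans ?_
  rw [Function.update_self, laguerreFunErase]
  congr 2
  refine Finset.prod_congr rfl fun i hi => ?_
  rw [Function.update_of_ne (Finset.ne_of_mem_erase hi)]

theorem partialDeriv_laguerreSmooth_apply {d : ℕ} (n : Fin d → ℕ) (j : Fin d)
    {x : Fin d → ℝ} (hx : x ∈ orthant d) :
    (partialDeriv j (laguerreSmooth n)).1 x
      = (laguerreFnDeriv (n j) (x j) : ℂ) * laguerreFunErase n j x := by
  refine partialDeriv_apply_of_eq j _ _ _ (hasDerivAt_laguerreFn (n j)) _ ?_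
    (fun x hx => tensor_eq _ _ j hx) hx
  intro x t
  unfold laguerreFunErase
  congr 1
  refine Finset.prod_congr rfl fun i hi => ?_
  simp [Pi.single_eq_of_ne (Finset.ne_of_mem_erase hi)]

/-- The Euler operator `x_j ∂_j` shifts the index of `l_n` by at most one. -/
theorem euler_laguerreSmooth {d : ℕ} (n : Fin d → ℕ) (j : Fin d) :
    mulCoord j (partialDeriv j (laguerreSmooth n))
      = (((n j : ℂ) + 1) / 2) • laguerreSmooth (Function.update n j (n j + 1))
        + (-1 / 2 : ℂ) • laguerreSmooth n
        + (-(n j : ℂ) / 2) • laguerreSmooth (Function.update n j (n j - 1)) := by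
  refine SmoothFun.ext_orthant fun x hx => ?_
  have h0 : (laguerreSmooth n).1 x = (laguerreFn (n j) (x j) : ℂ) * laguerreFunErase n j x := by
    simpa using laguerreSmooth_update_apply n j (n j) hx
  have h := congrArg (fun t : ℝ => (t : ℂ)) (mul_laguerreFnDeriv (n j) (x j))
  rw [mulCoord_apply _ _ hx, partialDeriv_laguerreSmooth_apply n j hx]
  simp only [Submodule.coe_add, Submodule.coe_smul, Pi.add_apply, Pi.smul_apply, smul_eq_mul]
  rw [laguerreSmooth_update_apply n j _ hx, laguerreSmooth_update_apply n j _ hx, h0]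
  push_cast at h
  linear_combination laguerreFunErase n j x * h

/-! ### Sums of Laguerre series with rapidly decreasing coefficients -/

/-- The coefficients `c_i` of the family `(c_i l_{σ i})` decrease faster than any power of `|σ i|`.
Indexing by an arbitrary `σ` lets operators that shift the index of `l_n` act on the family without
any reordering of sums. -/
def RapidDecay {d : ℕ} {ι : Type} (c : ι → ℂ) (σ : ι → Fin d → ℕ) : Prop :=
  ∀ p : ℕ, Summable fun i => ‖c i‖ * (1 + (deg (σ i) : ℝ)) ^ p

theorem RapidDecay.of_le {d : ℕ} {ι : Type} {c c' : ι → ℂ} {σ σ' : ι → Fin d → ℕ}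
    (h : RapidDecay c σ) (hc : ∀ i, ‖c' i‖ ≤ ‖c i‖ * (1 + (deg (σ i) : ℝ)))
    (hσ : ∀ i, deg (σ' i) ≤ deg (σ i) + 1) : RapidDecay c' σ' := by
  intro p
  refine Summable.of_nonneg_of_le (fun i => by positivity) (fun i => ?_)
    ((h (p + 1)).mul_left (2 ^ p))
  have h1 : 1 + (deg (σ' i) : ℝ) ≤ 2 * (1 + (deg (σ i) : ℝ)) := by
    have h2 : (deg (σ' i) : ℝ) ≤ deg (σ i) + 1 := by exact_mod_cast hσ i
    have h3 : (0 : ℝ) ≤ deg (σ i) := Nat.cast_nonneg _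
    linarith
  calc ‖c' i‖ * (1 + (deg (σ' i) : ℝ)) ^ p
      ≤ (‖c i‖ * (1 + (deg (σ i) : ℝ))) * (2 * (1 + (deg (σ i) : ℝ))) ^ p := by
        gcongr
        exact hc i
    _ = _ := by rw [mul_pow]; ring

theorem deg_update_le {d : ℕ} (n : Fin d → ℕ) (j : Fin d) {m : ℕ} (hm : m ≤ n j + 1) :
    deg (Function.update n j m) ≤ deg n + 1 := by
  unfold deg
  rw [Finset.sum_update_of_mem (Finset.mem_univ j),
    ← Finset.add_sum_erase _ _ (Finset.mem_univ j), Finset.sdiff_singleton_eq_erase]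
  omega

section Synthesis

variable {d : ℕ} {ι : Type} {c : ι → ℂ} {σ : ι → Fin d → ℕ}

theorem RapidDecay.up (h : RapidDecay c σ) (j : Fin d) :
    RapidDecay (fun i => c i * (((σ i j : ℂ) + 1) / 2))
      (fun i => Function.update (σ i) j (σ i j + 1)) := by
  refine h.of_le (fun i => ?_) fun i => deg_update_le _ _ le_rfl
  have h1 : ‖((σ i j : ℂ) + 1) / 2‖ ≤ 1 + (deg (σ i) : ℝ) := by
    have : ((σ i j : ℂ) + 1) = ((σ i j + 1 : ℕ) : ℂ) := by push_cast; rfl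
    rw [norm_div, this, Complex.norm_natCast]
    have := cast_le_deg (σ i) j
    have h0 : (0 : ℝ) ≤ σ i j := Nat.cast_nonneg _
    simp only [Nat.cast_add, Nat.cast_one, Complex.norm_ofNat]
    linarith
  rw [norm_mul]
  gcongr

theorem RapidDecay.half (h : RapidDecay c σ) : RapidDecay (fun i => c i * (-1 / 2 : ℂ)) σ := by
  refine h.of_le (fun i => ?_) fun i => Nat.le_succ _
  rw [norm_mul]
  gcongr
  have h0 : (0 : ℝ) ≤ deg (σ i) := Nat.cast_nonneg _
  norm_num
  linarith

theorem RapidDecay.down (h : RapidDecay c σ) (j : Fin d) :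
    RapidDecay (fun i => c i * (-(σ i j : ℂ) / 2))
      (fun i => Function.update (σ i) j (σ i j - 1)) := by
  refine h.of_le (fun i => ?_) fun i => deg_update_le _ _ (by omega)
  have h1 : ‖-(σ i j : ℂ) / 2‖ ≤ 1 + (deg (σ i) : ℝ) := by
    rw [norm_div, norm_neg, Complex.norm_natCast]
    have := cast_le_deg (σ i) j
    have h0 : (0 : ℝ) ≤ σ i j := Nat.cast_nonneg _
    simp only [Complex.norm_ofNat]
    linarith
  rw [norm_mul]
  gcongr

theorem RapidDecay.mul_deg (h : RapidDecay c σ) :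
    RapidDecay (fun i => c i * (deg (σ i) : ℂ)) σ := by
  refine h.of_le (fun i => ?_) fun i => Nat.le_succ _
  rw [norm_mul, Complex.norm_natCast]
  gcongr
  linarith

theorem RapidDecay.summable_norm_mul (h : RapidDecay c σ) (x : Fin d → ℝ) :
    Summable fun i => ‖c i * (laguerreSmooth (σ i)).1 x‖ := by
  refine Summable.of_nonneg_of_le (fun i => norm_nonneg _) (fun i => ?_) ((h d).mul_left (2 ^ d))
  rw [norm_mul]
  calc ‖c i‖ * ‖(laguerreSmooth (σ i)).1 x‖
      ≤ ‖c i‖ * (2 ^ d * (1 + (deg (σ i) : ℝ)) ^ d) := by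
        gcongr
        exact norm_laguerreSmooth_le _ _
    _ = _ := by ring

variable (c σ) in
/-- The function `∑_i c_i l_{σ i}`. -/
def laguerreSum (x : Fin d → ℝ) : ℂ := ∑' i, c i * (laguerreSmooth (σ i)).1 x

theorem RapidDecay.hasSum (h : RapidDecay c σ) (x : Fin d → ℝ) :
    HasSum (fun i => c i * (laguerreSmooth (σ i)).1 x) (laguerreSum c σ x) :=
  (h.summable_norm_mul x).of_norm.hasSum

theorem norm_coord_mul_partialDeriv_laguerreSmooth_le (n : Fin d → ℕ) (j : Fin d)
    (x : Fin d → ℝ) :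
    ‖(mulCoord j (partialDeriv j (laguerreSmooth n))).1 x‖
      ≤ 2 * 4 ^ d * (1 + (deg n : ℝ)) ^ (d + 1) := by
  have hb : ∀ m, m ≤ n j + 1 → ‖(laguerreSmooth (Function.update n j m)).1 x‖
      ≤ 4 ^ d * (1 + (deg n : ℝ)) ^ d := by
    intro m hm
    refine (norm_laguerreSmooth_le _ x).trans ?_
    have h1 : (deg (Function.update n j m) : ℝ) ≤ deg n + 1 := by
      exact_mod_cast deg_update_le n j hm
    have h0 : (0 : ℝ) ≤ deg n := Nat.cast_nonneg _
    calc 2 ^ d * (1 + (deg (Function.update n j m) : ℝ)) ^ d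
        ≤ 2 ^ d * (2 * (1 + (deg n : ℝ))) ^ d := by
          gcongr
          linarith
      _ = _ := by
          rw [mul_pow, ← mul_assoc, ← mul_pow]
          norm_num
  have h1 := hb (n j + 1) le_rfl
  have h2 := hb (n j) (by omega)
  have h3 := hb (n j - 1) (by omega)
  rw [Function.update_eq_self] at h2
  have hn := cast_le_deg n j
  have h0 : (0 : ℝ) ≤ n j := Nat.cast_nonneg _
  set B : ℝ := 4 ^ d * (1 + (deg n : ℝ)) ^ d with hB
  have hB0 : 0 ≤ B := by positivity
  rw [euler_laguerreSmooth]
  simp only [Submodule.coe_add, Submodule.coe_smul, Pi.add_apply, Pi.smul_apply, smul_eq_mul]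
  have e1 : ‖((n j : ℂ) + 1) / 2‖ = ((n j : ℝ) + 1) / 2 := by
    have : ((n j : ℂ) + 1) = ((n j + 1 : ℕ) : ℂ) := by push_cast; rfl
    rw [norm_div, this, Complex.norm_natCast]
    simp
  have e2 : ‖(-1 / 2 : ℂ)‖ = 1 / 2 := by norm_num
  have e3 : ‖-(n j : ℂ) / 2‖ = (n j : ℝ) / 2 := by
    rw [norm_div, norm_neg, Complex.norm_natCast]
    simp
  refine (norm_add₃_le).trans ?_
  rw [norm_mul, norm_mul, norm_mul, e1, e2, e3]
  calc _ ≤ ((n j : ℝ) + 1) / 2 * B + 1 / 2 * B + (n j : ℝ) / 2 * B := by gcongr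
    _ = (n j + 1) * B := by ring
    _ ≤ (2 * (1 + (deg n : ℝ))) * B := by
        gcongr
        linarith
    _ = _ := by rw [hB]; ring

theorem norm_clm_le_sum (T : (Fin d → ℝ) →L[ℝ] ℂ) : ‖T‖ ≤ ∑ j, ‖T (Pi.single j 1)‖ := by
  refine T.opNorm_le_bound (Finset.sum_nonneg fun _ _ => norm_nonneg _) fun v => ?_
  have hv : T v = ∑ j, v j • T (Pi.single j 1) := by
    have hvs : v = ∑ j, v j • (Pi.single j 1 : Fin d → ℝ) := by
      ext i
      simp [Finset.sum_apply, Pi.single_apply]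
    conv_lhs => rw [hvs, map_sum]
    exact Finset.sum_congr rfl fun j _ => map_smul _ _ _
  rw [hv, Finset.sum_mul]
  refine (norm_sum_le _ _).trans (Finset.sum_le_sum fun j _ => ?_)
  rw [norm_smul, mul_comm]
  gcongr
  exact norm_le_pi_norm v j

/-- A derivative bound away from the boundary of the orthant, polynomial in `n`. -/
theorem norm_fderiv_laguerreSmooth_le (n : Fin d → ℕ) {ε : ℝ} (hε : 0 < ε) {x : Fin d → ℝ}
    (hx : ∀ j, ε < x j) : ‖fderiv ℝ (laguerreSmooth n).1 x‖
      ≤ d * (ε⁻¹ * (2 * 4 ^ d * (1 + (deg n : ℝ)) ^ (d + 1))) := by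
  have hxo : x ∈ orthant d := fun j => hε.trans (hx j)
  refine (norm_clm_le_sum _).trans ?_
  refine (Finset.sum_le_card_nsmul Finset.univ _
    (ε⁻¹ * (2 * 4 ^ d * (1 + (deg n : ℝ)) ^ (d + 1))) fun j _ => ?_).trans_eq
    (by rw [Finset.card_univ, Fintype.card_fin, nsmul_eq_mul])
  have h := norm_coord_mul_partialDeriv_laguerreSmooth_le n j x
  rw [mulCoord_apply _ _ hxo, partialDeriv_apply _ _ hxo, norm_mul, Complex.norm_real,
    Real.norm_of_nonneg (hxo j).le] at h
  have h2 : ε * ‖fderiv ℝ (laguerreSmooth n).1 x (Pi.single j 1)‖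
      ≤ 2 * 4 ^ d * (1 + (deg n : ℝ)) ^ (d + 1) :=
    (mul_le_mul_of_nonneg_right (hx j).le (norm_nonneg _)).trans h
  rwa [← div_eq_inv_mul, le_div_iff₀' hε]

/-- The sum of a Laguerre series with rapidly decreasing coefficients may be differentiated
term by term. -/
theorem RapidDecay.hasFDerivAt (h : RapidDecay c σ) {x : Fin d → ℝ} (hx : x ∈ orthant d) :
    HasFDerivAt (laguerreSum c σ) (∑' i, c i • fderiv ℝ (laguerreSmooth (σ i)).1 x) x ∧
      Summable fun i => c i • fderiv ℝ (laguerreSmooth (σ i)).1 x := by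
  obtain ⟨ε, hε, hεx⟩ : ∃ ε : ℝ, 0 < ε ∧ ∀ j, ε < x j := by
    rcases isEmpty_or_nonempty (Fin d) with hd | hd
    · exact ⟨1, one_pos, fun j => (hd.false j).elim⟩
    · obtain ⟨j, hj⟩ := Finite.exists_min x
      exact ⟨x j / 2, half_pos (hx j), fun i => (half_lt_self (hx j)).trans_le (hj i)⟩
  set s : Set (Fin d → ℝ) := Set.univ.pi fun _ => Ioi ε with hs
  have hso : IsOpen s := isOpen_set_pi Set.finite_univ fun _ _ => isOpen_Ioi
  have hsc : IsPreconnected s := (convex_pi fun _ _ => convex_Ioi ε).isPreconnected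
  have hxs : x ∈ s := fun j _ => hεx j
  have hu : Summable fun i =>
      ‖c i‖ * (d * (ε⁻¹ * (2 * 4 ^ d * (1 + (deg (σ i) : ℝ)) ^ (d + 1)))) := by
    refine ((h (d + 1)).mul_left (d * (ε⁻¹ * (2 * 4 ^ d)))).congr fun i => ?_
    ring
  have hb : ∀ i, ∀ y ∈ s, ‖c i • fderiv ℝ (laguerreSmooth (σ i)).1 y‖
      ≤ ‖c i‖ * (d * (ε⁻¹ * (2 * 4 ^ d * (1 + (deg (σ i) : ℝ)) ^ (d + 1)))) := by
    intro i y hy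
    rw [norm_smul]
    gcongr
    exact norm_fderiv_laguerreSmooth_le _ hε fun j => hy j trivial
  refine ⟨hasFDerivAt_tsum_of_isPreconnected hu hso hsc (fun i y hy => ?_) hb hxs
    (h.hasSum x).summable hxs, Summable.of_norm_bounded hu fun i => hb i x hxs⟩
  have hd := SmoothFun.diffAt (laguerreSmooth (σ i)) fun j => hε.trans (hy j trivial)
  exact hd.hasFDerivAt.const_mul (c i)

theorem RapidDecay.hasSum_fderiv_apply (h : RapidDecay c σ) {x : Fin d → ℝ} (hx : x ∈ orthant d)
    (j : Fin d) : HasSum (fun i => c i * (partialDeriv j (laguerreSmooth (σ i))).1 x)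
      (fderiv ℝ (laguerreSum c σ) x (Pi.single j 1)) := by
  obtain ⟨h1, h2⟩ := h.hasFDerivAt hx
  rw [h1.fderiv]
  have := (ContinuousLinearMap.apply ℝ ℂ (Pi.single j (1 : ℝ) : Fin d → ℝ)).hasSum h2.hasSum
  refine this.congr_fun fun i => ?_
  rw [partialDeriv_apply _ _ hx]
  simp

/-- The Euler operator `x_j ∂_j` maps sums of rapidly decreasing Laguerre series to such sums. -/
theorem RapidDecay.coord_mul_fderiv (h : RapidDecay c σ) {x : Fin d → ℝ} (hx : x ∈ orthant d)
    (j : Fin d) : (x j : ℂ) * fderiv ℝ (laguerreSum c σ) x (Pi.single j 1)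
      = laguerreSum (fun i => c i * (((σ i j : ℂ) + 1) / 2))
          (fun i => Function.update (σ i) j (σ i j + 1)) x
        + laguerreSum (fun i => c i * (-1 / 2 : ℂ)) σ x
        + laguerreSum (fun i => c i * (-(σ i j : ℂ) / 2))
          (fun i => Function.update (σ i) j (σ i j - 1)) x := by
  refine ((h.hasSum_fderiv_apply hx j).mul_left (x j : ℂ)).unique ?_
  refine ((((h.up j).hasSum x).add (h.half.hasSum x)).add ((h.down j).hasSum x)).congr_fun
    fun i => ?_
  have := congrFun (congrArg Subtype.val (euler_laguerreSmooth (σ i) j)) x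
  rw [mulCoord_apply _ _ hx] at this
  simp only [Submodule.coe_add, Submodule.coe_smul, Pi.add_apply, Pi.smul_apply,
    smul_eq_mul] at this
  linear_combination c i * this

/-- Smoothness, one order at a time: `∂_j` of such a sum is `x_j⁻¹` times a combination of three
sums of the same kind. -/
theorem RapidDecay.contDiffOn_nat (k : ℕ) : ∀ {c : ι → ℂ} {σ : ι → Fin d → ℕ}, RapidDecay c σ →
    ContDiffOn ℝ k (laguerreSum c σ) (orthant d) := by
  induction k with
  | zero =>
    intro c σ h
    exact contDiffOn_zero.2 fun x hx => (h.hasFDerivAt hx).1.continuousAt.continuousWithinAt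
  | succ k ih =>
    intro c σ h
    push_cast
    rw [contDiffOn_succ_iff_fderiv_of_isOpen (isOpen_orthant d)]
    refine ⟨fun x hx => (h.hasFDerivAt hx).1.differentiableAt.differentiableWithinAt,
      by simp, ?_⟩
    rw [contDiffOn_clm_apply]
    intro v
    have hv : ∀ x ∈ orthant d, fderiv ℝ (laguerreSum c σ) x v
        = ∑ j, (v j : ℂ) * ((x j : ℂ)⁻¹ * ((x j : ℂ)
            * fderiv ℝ (laguerreSum c σ) x (Pi.single j 1))) := by
      intro x hx
      have hvs : v = ∑ j, v j • (Pi.single j 1 : Fin d → ℝ) := by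
        ext i
        simp [Finset.sum_apply, Pi.single_apply]
      conv_lhs => rw [hvs, map_sum]
      refine Finset.sum_congr rfl fun j _ => ?_
      have : (x j : ℂ) ≠ 0 := by exact_mod_cast (hx j).ne'
      rw [map_smul, inv_mul_cancel_left₀ this, Complex.real_smul]
    refine ContDiffOn.congr ?_ hv
    refine ContDiffOn.sum fun j _ => contDiffOn_const.mul (ContDiffOn.mul ?_ ?_)
    · refine ContDiffOn.inv ?_ fun x hx => by exact_mod_cast (hx j).ne'
      exact (Complex.ofRealCLM.contDiff.comp (contDiff_apply ℝ ℝ j)).contDiffOn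
    · exact (((ih (h.up j)).add (ih h.half)).add (ih (h.down j))).congr
        fun x hx => h.coord_mul_fderiv hx j

/-- The sum of a rapidly decreasing Laguerre series, as an element of `C^∞((0, ∞)^d)`. -/
def RapidDecay.smooth (h : RapidDecay c σ) : SmoothFun d :=
  ⟨laguerreSum c σ, contDiffOn_infty.2 fun k => h.contDiffOn_nat k, fun x hx => by
    unfold laguerreSum
    simp [(laguerreSmooth _).2.2 x hx]⟩

theorem RapidDecay.hasSum_partialDeriv (h : RapidDecay c σ) (j : Fin d) {x : Fin d → ℝ}
    (hx : x ∈ orthant d) : HasSum (fun i => c i * (partialDeriv j (laguerreSmooth (σ i))).1 x)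
      ((partialDeriv j h.smooth).1 x) := by
  rw [partialDeriv_apply j h.smooth hx]
  exact h.hasSum_fderiv_apply hx j

theorem RapidDecay.euler_smooth (h : RapidDecay c σ) (j : Fin d) :
    mulCoord j (partialDeriv j h.smooth)
      = (h.up j).smooth + h.half.smooth + (h.down j).smooth := by
  refine SmoothFun.ext_orthant fun x hx => ?_
  rw [mulCoord_apply _ _ hx, partialDeriv_apply _ _ hx]
  exact h.coord_mul_fderiv hx j

/-- The Laguerre operator multiplies the `n`-th coefficient by `|n|`. -/
theorem RapidDecay.laguerreOp_smooth (h : RapidDecay c σ) :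
    laguerreOp d h.smooth = h.mul_deg.smooth := by
  refine SmoothFun.ext_orthant fun x hx => ?_
  have hD : ∀ j, HasSum
      (fun i => c i * (partialDeriv j (mulCoord j (partialDeriv j (laguerreSmooth (σ i))))).1 x)
      ((partialDeriv j (mulCoord j (partialDeriv j h.smooth))).1 x) := by
    intro j
    rw [h.euler_smooth j, map_add, map_add]
    refine ((((h.up j).hasSum_partialDeriv j hx).add (h.half.hasSum_partialDeriv j hx)).add
      ((h.down j).hasSum_partialDeriv j hx)).congr_fun fun i => ?_
    rw [euler_laguerreSmooth, map_add, map_add, map_smul, map_smul, map_smul]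
    simp only [Submodule.coe_add, Submodule.coe_smul, Pi.add_apply, Pi.smul_apply, smul_eq_mul]
    ring
  have hM : ∀ j, HasSum (fun i => c i * (mulCoord j (laguerreSmooth (σ i))).1 x)
      ((mulCoord j h.smooth).1 x) := by
    intro j
    rw [mulCoord_apply _ _ hx]
    refine ((h.hasSum x).mul_left (x j : ℂ)).congr_fun fun i => ?_
    rw [mulCoord_apply _ _ hx]
    ring
  have hS : HasSum (fun i => c i * (laguerreOp d (laguerreSmooth (σ i))).1 x)
      ((laguerreOp d h.smooth).1 x) := by
    rw [laguerreOp_apply]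
    refine (hasSum_sum (s := Finset.univ) fun j _ => ((hD j).sub ((hM j).mul_left (1 / 4 : ℂ))).add
      ((h.hasSum x).mul_left (1 / 2 : ℂ))).neg.congr_fun fun i => ?_
    rw [laguerreOp_apply, mul_neg, Finset.mul_sum]
    congr 1
    refine Finset.sum_congr rfl fun j _ => ?_
    ring
  refine hS.unique ((h.mul_deg.hasSum x).congr_fun fun i => ?_)
  rw [laguerreOp_laguerreSmooth_deg]
  simp only [Submodule.coe_smul, Pi.smul_apply, smul_eq_mul]
  ring

end Synthesis

/-! ### Coefficient sequences of functions in `𝒢_α` -/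

section Synthesis

variable {d : ℕ}

theorem integrableOn_laguerreFun_mul (n m : Fin d → ℕ) :
    IntegrableOn (fun x => laguerreFun n x * laguerreFun m x) (orthant d) := by
  simp only [laguerreFun, ← Finset.prod_mul_distrib]
  exact integrableOn_orthant_prod (φ := fun j t => laguerreFn (n j) t * laguerreFn (m j) t)
    fun j => integrableOn_laguerreFn_mul_laguerreFn _ _

/-- The Laguerre coefficients of the sum of a Laguerre series are the given coefficients. -/
theorem RapidDecay.integral_smooth_mul {c : (Fin d → ℕ) → ℂ} (h : RapidDecay c id)
    (n : Fin d → ℕ) : ∫ x in orthant d, h.smooth.1 x * (laguerreFun n x : ℂ) = c n := by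
  set F : (Fin d → ℕ) → (Fin d → ℝ) → ℂ := fun m x =>
    c m * ((laguerreFun m x * laguerreFun n x : ℝ) : ℂ) with hF
  have hFi : ∀ m, Integrable (F m) (volume.restrict (orthant d)) := fun m =>
    ((integrableOn_laguerreFun_mul m n).ofReal (𝕜 := ℂ)).const_mul (c m)
  have hFint : ∀ m, ∫ x in orthant d, F m x = if m = n then c n else 0 := by
    intro m
    rw [hF]
    simp only
    rw [integral_const_mul, integral_complex_ofReal, integral_laguerreFun_mul]
    split_ifs with hm
    · subst hm; simp
    · simp
  have hsum : Summable fun m => ∫ x in orthant d, ‖F m x‖ := by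
    refine Summable.of_nonneg_of_le (fun m => integral_nonneg fun _ => norm_nonneg _) (fun m => ?_)
      (((h d).mul_left (2 ^ d)).mul_right (∫ x in orthant d, |laguerreFun n x|))
    rw [← integral_const_mul]
    refine setIntegral_mono_on (hFi m).norm ((integrableOn_laguerreFun n).abs.const_mul _)
      (measurableSet_orthant d) fun x hx => ?_
    have := abs_laguerreFun_le m hx
    rw [hF]
    simp only [norm_mul, Complex.norm_real, Real.norm_eq_abs, id]
    calc ‖c m‖ * (|laguerreFun m x| * |laguerreFun n x|)
        ≤ ‖c m‖ * (2 ^ d * (1 + (deg m : ℝ)) ^ d * |laguerreFun n x|) := by gcongr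
      _ = _ := by ring
  have key := hasSum_integral_of_summable_integral_norm hFi hsum
  have h1 : ∫ x in orthant d, h.smooth.1 x * (laguerreFun n x : ℂ)
      = ∫ x in orthant d, ∑' m, F m x := by
    refine setIntegral_congr_fun (measurableSet_orthant d) fun x hx => ?_
    refine (((h.hasSum x).mul_right (laguerreFun n x : ℂ)).tsum_eq.symm).trans
      (tsum_congr fun m => ?_)
    rw [hF, id, laguerreSmooth_apply m hx]
    push_cast
    ring
  rw [h1]
  refine key.unique ?_
  simp_rw [hFint]
  exact hasSum_ite_eq n (c n)

theorem RapidDecay.laguerreOp_pow_smooth {ι : Type} {c : ι → ℂ} {σ : ι → Fin d → ℕ}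
    (h : RapidDecay c σ) (N : ℕ) :
    ∃ hN : RapidDecay (fun i => c i * (deg (σ i) : ℂ) ^ N) σ,
      (laguerreOp d ^ N) h.smooth = hN.smooth := by
  induction N with
  | zero =>
    have : (fun i => c i * (deg (σ i) : ℂ) ^ 0) = c := by simp
    simp only [this]
    exact ⟨h, rfl⟩
  | succ N ih =>
    obtain ⟨hN, hE⟩ := ih
    have : (fun i => c i * (deg (σ i) : ℂ) ^ (N + 1))
        = fun i => c i * (deg (σ i) : ℂ) ^ N * (deg (σ i) : ℂ) := by
      funext i
      ring
    simp only [this]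
    refine ⟨hN.mul_deg, ?_⟩
    rw [pow_succ', Module.End.mul_apply, hE, hN.laguerreOp_smooth]

/-- The bound `|n|^N |a_n| ≤ M h^N N!^α` for all `N` and `n`: the counterpart of `StepBound` for
the Laguerre coefficients. -/
def SeqBound (α h M : ℝ) (a : FormalSeries d) : Prop :=
  ∀ (N : ℕ) (n : Fin d → ℕ), (deg n : ℝ) ^ N * ‖a n‖ ≤ M * h ^ N * (N.factorial : ℝ) ^ α

theorem SeqBound.nonneg {α h M : ℝ} {a : FormalSeries d} (ha : SeqBound α h M a) : 0 ≤ M := by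
  have := ha 0 0
  simp only [pow_zero, one_mul, mul_one, Nat.factorial_zero, Nat.cast_one, Real.one_rpow] at this
  exact (norm_nonneg _).trans this

theorem factorial_add_rpow_le {α : ℝ} (hα : 0 < α) (N m : ℕ) :
    ((N + m).factorial : ℝ) ^ α
      ≤ ((2 : ℝ) ^ α) ^ N * ((2 : ℝ) ^ α) ^ m * (N.factorial : ℝ) ^ α * (m.factorial : ℝ) ^ α := by
  have h1 : ((N + m).factorial : ℝ) ≤ 2 ^ (N + m) * N.factorial * m.factorial := by
    have h2 := Nat.add_choose_mul_factorial_mul_factorial N m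
    have h3 : (N + m).choose m ≤ 2 ^ (N + m) := Nat.choose_le_two_pow _ _
    have : (N + m).factorial ≤ 2 ^ (N + m) * N.factorial * m.factorial := by
      rw [← h2]
      gcongr
    exact_mod_cast this
  calc ((N + m).factorial : ℝ) ^ α
      ≤ (2 ^ (N + m) * N.factorial * m.factorial : ℝ) ^ α := by gcongr
    _ = _ := by
        rw [Real.mul_rpow (by positivity) (by positivity), Real.mul_rpow (by positivity)
          (by positivity), ← Real.rpow_natCast 2 (N + m), ← Real.rpow_mul (by norm_num),
          mul_comm _ α, Real.rpow_mul (by norm_num), Real.rpow_natCast, pow_add]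

/-- Polynomial factors are absorbed in the bounds at the price of a larger `h`. -/
theorem exists_weight_absorb {α h : ℝ} (hα : 0 < α) (hh : 0 < h) (p : ℕ) :
    ∃ C h' : ℝ, 0 < C ∧ 0 < h' ∧ ∀ (k b M : ℝ), 0 ≤ k → 0 ≤ b → 0 ≤ M →
      (∀ N : ℕ, k ^ N * b ≤ M * h ^ N * (N.factorial : ℝ) ^ α) →
      ∀ N : ℕ, (1 + k) ^ p * (k ^ N * b) ≤ C * M * h' ^ N * (N.factorial : ℝ) ^ α := by
  set A : ℝ := (2 : ℝ) ^ α with hA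
  have hA1 : 1 ≤ A := Real.one_le_rpow one_le_two hα.le
  refine ⟨2 ^ p * (1 + h ^ p * A ^ p * (p.factorial : ℝ) ^ α), A * h, by positivity, by positivity,
    fun k b M hk hb hM hkb N => ?_⟩
  have h1 : (1 + k) ^ p ≤ 2 ^ p * (1 + k ^ p) := by
    have h2 : 1 + k ≤ 2 * max 1 k := by
      have := le_max_left 1 k
      have := le_max_right 1 k
      linarith
    calc (1 + k) ^ p ≤ (2 * max 1 k) ^ p := by gcongr
      _ = 2 ^ p * max 1 k ^ p := mul_pow _ _ _
      _ ≤ _ := by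
        gcongr
        rcases max_choice 1 k with h | h <;> rw [h]
        · rw [one_pow]; linarith [pow_nonneg hk p]
        · linarith
  have h3 := hkb (N + p)
  have h4 := hkb N
  have h5 := factorial_add_rpow_le hα N p
  calc (1 + k) ^ p * (k ^ N * b) ≤ 2 ^ p * (1 + k ^ p) * (k ^ N * b) := by gcongr
    _ = 2 ^ p * (k ^ N * b + k ^ (N + p) * b) := by ring
    _ ≤ 2 ^ p * (M * h ^ N * (N.factorial : ℝ) ^ α
        + M * h ^ (N + p) * (A ^ N * A ^ p * (N.factorial : ℝ) ^ α * (p.factorial : ℝ) ^ α)) := by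
        have h6 := h3.trans (mul_le_mul_of_nonneg_left h5 (by positivity : 0 ≤ M * h ^ (N + p)))
        exact mul_le_mul_of_nonneg_left (add_le_add h4 h6) (by positivity)
    _ = 2 ^ p * (M * (1 * h) ^ N * (N.factorial : ℝ) ^ α
        + h ^ p * A ^ p * (p.factorial : ℝ) ^ α * (M * (A * h) ^ N * (N.factorial : ℝ) ^ α)) := by
        rw [one_mul, mul_pow, pow_add]; ring
    _ ≤ 2 ^ p * (M * (A * h) ^ N * (N.factorial : ℝ) ^ α
        + h ^ p * A ^ p * (p.factorial : ℝ) ^ α * (M * (A * h) ^ N * (N.factorial : ℝ) ^ α)) := by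
        gcongr
    _ = _ := by ring

theorem SeqBound.exists_weight {α h : ℝ} (hα : 0 < α) (hh : 0 < h) (p : ℕ) :
    ∃ C h' : ℝ, 0 < C ∧ 0 < h' ∧ ∀ (a : FormalSeries d) (M : ℝ), SeqBound α h M a →
      ∀ (N : ℕ) (n : Fin d → ℕ), (1 + (deg n : ℝ)) ^ p * ((deg n : ℝ) ^ N * ‖a n‖)
        ≤ C * M * h' ^ N * (N.factorial : ℝ) ^ α := by
  obtain ⟨C, h', hC, hh', H⟩ := exists_weight_absorb hα hh p
  exact ⟨C, h', hC, hh', fun a M ha N n => H _ _ M (Nat.cast_nonneg _) (norm_nonneg _) ha.nonneg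
    (fun N => ha N n) N⟩

theorem SeqBound.rapidDecay {α h M : ℝ} (hα : 0 < α) (hh : 0 < h) {a : FormalSeries d}
    (ha : SeqBound α h M a) : RapidDecay a id := by
  intro p
  obtain ⟨C, h', -, -, H⟩ := SeqBound.exists_weight (d := d) hα hh (p + 2 * d)
  refine Summable.of_nonneg_of_le (fun n => by positivity) (fun n => ?_)
    ((summable_inv_one_add_deg_pow d).mul_left (C * M))
  have := H a M ha 0 n
  simp only [pow_zero, one_mul, mul_one, Nat.factorial_zero, Nat.cast_one, Real.one_rpow] at this
  rw [← div_eq_mul_inv, le_div_iff₀ (by positivity), id]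
  calc _ = (1 + (deg n : ℝ)) ^ (p + 2 * d) * ‖a n‖ := by rw [pow_add]; ring
    _ ≤ _ := this

/-- Synthesis: coefficient sequences with the bounds of `SeqBound` are the Laguerre coefficients of
functions in `𝒢_α`, with control of the step norms. -/
theorem exists_synthesis {α h : ℝ} (hα : 0 < α) (hh : 0 < h) :
    ∃ C h' : ℝ, 0 < C ∧ 0 < h' ∧ ∀ (a : FormalSeries d) (M : ℝ), SeqBound α h M a →
      ∃ f : G d α, series f = a ∧ StepBound α h' (C * M) f.toSmooth := by
  obtain ⟨C, h', hC, hh', H⟩ := SeqBound.exists_weight (d := d) hα hh (d + 2 * d)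
  have hS := summable_inv_one_add_deg_pow d
  set S : ℝ := ∑' n : Fin d → ℕ, ((1 + (deg n : ℝ)) ^ (2 * d))⁻¹ with hSdef
  have hS0 : 0 ≤ S := tsum_nonneg fun n => by positivity
  refine ⟨2 ^ d * C * (S + 1), h', by positivity, hh', fun a M ha => ?_⟩
  have hM := ha.nonneg
  have hr := ha.rapidDecay hα hh
  -- of the weight `(1 + |n|)^{3d}`, one part pays for `‖l_n‖_∞` and the rest for summability
  have hstep : StepBound α h' (2 ^ d * C * (S + 1) * M) hr.smooth := by
    intro N x hx
    obtain ⟨hN, hE⟩ := hr.laguerreOp_pow_smooth N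
    rw [hE]
    set D : ℝ := 2 ^ d * (C * M * h' ^ N * (N.factorial : ℝ) ^ α) with hD
    have hterm : ∀ n, ‖a n * (deg n : ℂ) ^ N * (laguerreSmooth n).1 x‖
        ≤ D * ((1 + (deg n : ℝ)) ^ (2 * d))⁻¹ := by
      intro n
      have h1 := H a M ha N n
      have h2 := norm_laguerreSmooth_le n x
      rw [norm_mul, norm_mul, norm_pow, Complex.norm_natCast, ← div_eq_mul_inv,
        le_div_iff₀ (by positivity)]
      calc ‖a n‖ * (deg n : ℝ) ^ N * ‖(laguerreSmooth n).1 x‖ * (1 + (deg n : ℝ)) ^ (2 * d)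
          ≤ ‖a n‖ * (deg n : ℝ) ^ N * (2 ^ d * (1 + (deg n : ℝ)) ^ d)
            * (1 + (deg n : ℝ)) ^ (2 * d) := by gcongr
        _ = 2 ^ d * ((1 + (deg n : ℝ)) ^ (d + 2 * d) * ((deg n : ℝ) ^ N * ‖a n‖)) := by
            rw [pow_add]; ring
        _ ≤ D := by
            rw [hD]
            gcongr
    have hD0 : 0 ≤ D := by positivity
    calc ‖hN.smooth.1 x‖ ≤ D * S := tsum_of_norm_bounded (hS.hasSum.mul_left D) hterm
      _ ≤ D * (S + 1) := by gcongr; linarith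
      _ = _ := by rw [hD]; ring
  refine ⟨⟨hr.smooth, 2 ^ d * C * (S + 1) * M + 1, h', by positivity, hh',
    hstep.mono (by positivity) hh'.le le_rfl (by linarith)⟩, ?_, hstep⟩
  funext n
  exact hr.integral_smooth_mul n

end Synthesis

/-! ### Integration by parts on the orthant -/

section Green

variable {d : ℕ}

/-- The pointwise product of two elements of `C^∞((0, ∞)^d)`. -/
def SmoothFun.mul (f g : SmoothFun d) : SmoothFun d :=
  ⟨fun x => f.1 x * g.1 x, (SmoothFun.contDiffOn f).mul (SmoothFun.contDiffOn g), fun x hx => by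
    simp only [f.2.2 x hx, zero_mul]⟩

theorem partialDeriv_mul_apply (j : Fin d) (f g : SmoothFun d) {x : Fin d → ℝ}
    (hx : x ∈ orthant d) : (partialDeriv j (SmoothFun.mul f g)).1 x
      = (partialDeriv j f).1 x * g.1 x + f.1 x * (partialDeriv j g).1 x := by
  rw [partialDeriv_apply _ _ hx, partialDeriv_apply _ _ hx, partialDeriv_apply _ _ hx]
  have := (SmoothFun.diffAt f hx).hasFDerivAt.mul (SmoothFun.diffAt g hx).hasFDerivAt
  have h2 : HasFDerivAt (SmoothFun.mul f g).1 _ x := this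
  rw [h2.fderiv]
  simp
  ring

/-- `g` vanishes off the compact subset `K` of the orthant. -/
structure SupportedIn (K : Set (Fin d → ℝ)) (g : SmoothFun d) : Prop where
  isCompact : IsCompact K
  subset : K ⊆ orthant d
  eq_zero : ∀ x, x ∉ K → g.1 x = 0

variable {K : Set (Fin d → ℝ)} {f g : SmoothFun d}

theorem SupportedIn.mul_left (f : SmoothFun d) (h : SupportedIn K g) :
    SupportedIn K (SmoothFun.mul f g) :=
  ⟨h.isCompact, h.subset, fun x hx => by
    change f.1 x * g.1 x = 0
    rw [h.eq_zero x hx, mul_zero]⟩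

theorem SupportedIn.mulCoord (h : SupportedIn K g) (j : Fin d) :
    SupportedIn K (Laguerre.mulCoord j g) :=
  ⟨h.isCompact, h.subset, fun x hx => by
    by_cases hxo : x ∈ orthant d
    · rw [mulCoord_apply _ _ hxo, h.eq_zero x hx, mul_zero]
    · exact (Laguerre.mulCoord j g).2.2 x hxo⟩

theorem SupportedIn.eventuallyEq_zero (h : SupportedIn K g) {x : Fin d → ℝ} (hx : x ∉ K) :
    g.1 =ᶠ[𝓝 x] fun _ => 0 := by
  filter_upwards [h.isCompact.isClosed.isOpen_compl.mem_nhds hx] with y hy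
  exact h.eq_zero y hy

theorem SupportedIn.partialDeriv (h : SupportedIn K g) (j : Fin d) :
    SupportedIn K (Laguerre.partialDeriv j g) :=
  ⟨h.isCompact, h.subset, fun x hx => by
    by_cases hxo : x ∈ orthant d
    · rw [partialDeriv_apply _ _ hxo, (h.eventuallyEq_zero hx).fderiv_eq]
      simp
    · exact (Laguerre.partialDeriv j g).2.2 x hxo⟩

theorem SupportedIn.sub (hf : SupportedIn K f) (hg : SupportedIn K g) : SupportedIn K (f - g) :=
  ⟨hf.isCompact, hf.subset, fun x hx => by
    change f.1 x - g.1 x = 0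
    rw [hf.eq_zero x hx, hg.eq_zero x hx, sub_zero]⟩

theorem SupportedIn.contDiff (h : SupportedIn K g) : ContDiff ℝ ∞ g.1 := by
  rw [contDiff_iff_contDiffAt]
  intro x
  by_cases hx : x ∈ K
  · exact (SmoothFun.contDiffOn g).contDiffAt ((isOpen_orthant d).mem_nhds (h.subset hx))
  · exact contDiffAt_const.congr_of_eventuallyEq (h.eventuallyEq_zero hx)

theorem SupportedIn.integrable (h : SupportedIn K g) : Integrable g.1 :=
  h.contDiff.continuous.integrable_of_hasCompactSupport
    (HasCompactSupport.intro h.isCompact h.eq_zero)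

theorem SupportedIn.integral_partialDeriv (h : SupportedIn K g) (j : Fin d) :
    ∫ x in orthant d, (Laguerre.partialDeriv j g).1 x = 0 := by
  rw [setIntegral_eq_integral_of_forall_compl_eq_zero fun x hx =>
    (Laguerre.partialDeriv j g).2.2 x hx]
  have hfd : ∀ x, (Laguerre.partialDeriv j g).1 x = fderiv ℝ g.1 x (Pi.single j 1) := by
    intro x
    by_cases hx : x ∈ K
    · exact partialDeriv_apply _ _ (h.subset hx)
    · rw [(h.partialDeriv j).eq_zero x hx, (h.eventuallyEq_zero hx).fderiv_eq]
      simp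
  have hint : Integrable fun x => fderiv ℝ g.1 x (Pi.single j 1) :=
    (h.partialDeriv j).integrable.congr (ae_of_all _ hfd)
  have key := integral_mul_fderiv_eq_neg_fderiv_mul_of_integrable (μ := volume) (𝕜 := ℂ)
    (f := fun _ : Fin d → ℝ => (1 : ℂ)) (g := g.1) (v := Pi.single j 1) (by simp)
    (by simpa using hint) (by simpa using h.integrable) (fun _ _ => by fun_prop)
    (fun x _ => (h.contDiff.differentiable (by simp)) x)
  simp_rw [hfd]
  simpa using key

/-- Green's formula: the Laguerre operator is symmetric when one of the functions has compact
support in the orthant. -/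
theorem SupportedIn.integral_green (f : SmoothFun d) {w : SmoothFun d} (h : SupportedIn K w) :
    IntegrableOn (fun x => (laguerreOp d f).1 x * w.1 x - f.1 x * (laguerreOp d w).1 x)
      (orthant d) ∧
    ∫ x in orthant d, ((laguerreOp d f).1 x * w.1 x - f.1 x * (laguerreOp d w).1 x) = 0 := by
  set u : Fin d → SmoothFun d := fun j =>
    SmoothFun.mul (Laguerre.mulCoord j (Laguerre.partialDeriv j f)) w
      - SmoothFun.mul f (Laguerre.mulCoord j (Laguerre.partialDeriv j w)) with hu
  have hus : ∀ j, SupportedIn K (u j) := fun j =>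
    (h.mul_left _).sub (((h.partialDeriv j).mulCoord j).mul_left f)
  have heq : EqOn (fun x => (laguerreOp d f).1 x * w.1 x - f.1 x * (laguerreOp d w).1 x)
      (fun x => -∑ j, (Laguerre.partialDeriv j (u j)).1 x) (orthant d) := by
    intro x hx
    have hj : ∀ j, (Laguerre.partialDeriv j (u j)).1 x
        = (Laguerre.partialDeriv j (Laguerre.mulCoord j (Laguerre.partialDeriv j f))).1 x * w.1 x
          - f.1 x * (Laguerre.partialDeriv j
            (Laguerre.mulCoord j (Laguerre.partialDeriv j w))).1 x := by
      intro j
      rw [hu, map_sub, Submodule.coe_sub, Pi.sub_apply, partialDeriv_mul_apply _ _ _ hx,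
        partialDeriv_mul_apply _ _ _ hx, mulCoord_apply j (Laguerre.partialDeriv j f) hx,
        mulCoord_apply j (Laguerre.partialDeriv j w) hx]
      ring
    simp only
    rw [laguerreOp_apply, laguerreOp_apply, neg_mul, mul_neg, sub_neg_eq_add, neg_add_eq_sub,
      ← neg_sub, Finset.sum_mul, Finset.mul_sum, ← Finset.sum_sub_distrib]
    congr 1
    refine Finset.sum_congr rfl fun j _ => ?_
    rw [hj, mulCoord_apply j f hx, mulCoord_apply j w hx]
    ring
  have hi : ∀ j, IntegrableOn (Laguerre.partialDeriv j (u j)).1 (orthant d) := fun j =>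
    ((hus j).partialDeriv j).integrable.integrableOn
  constructor
  · exact IntegrableOn.congr_fun (integrable_finsetSum _ fun j _ => hi j).neg
      (fun x hx => (heq hx).symm) (measurableSet_orthant d)
  · rw [setIntegral_congr_fun (measurableSet_orthant d) heq, integral_neg,
      integral_finsetSum _ fun j _ => hi j]
    simp [(hus _).integral_partialDeriv]

end Green

/-! ### Logarithmic cutoffs -/

section Cutoff

/-- A smooth function on `ℝ` equal to `1` on `[-1, 1]` and vanishing off `(-2, 2)`. -/
def plateau : ContDiffBump (0 : ℝ) := ⟨1, 2, one_pos, one_lt_two⟩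

/-- The cutoff `ψ (log t / L)`, where `ψ` is the plateau function. It is constant near both ends
of `(0, ∞)`, and it is extended by `0` to `t ≤ 0`. -/
def logCutoff (L t : ℝ) : ℝ := if t ≤ 0 then 0 else plateau (Real.log t / L)

theorem plateau_eq_zero {s : ℝ} (hs : 2 ≤ |s|) : plateau s = 0 :=
  plateau.zero_of_le_dist (by simpa [plateau] using hs)

theorem contDiff_plateau : ContDiff ℝ ∞ plateau := plateau.contDiff

theorem logCutoff_of_pos (L : ℝ) {t : ℝ} (ht : 0 < t) :
    logCutoff L t = plateau (Real.log t / L) := if_neg ht.not_ge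

theorem two_le_abs_log_div {L t : ℝ} (hL : 0 < L) (ht : 0 < t)
    (h : t ∉ Icc (Real.exp (-(2 * L))) (Real.exp (2 * L))) : 2 ≤ |Real.log t / L| := by
  rw [abs_div, abs_of_pos hL, le_div_iff₀ hL]
  by_contra! hlt
  obtain ⟨h1, h2⟩ := abs_lt.1 hlt
  refine h ⟨?_, ?_⟩
  · rw [← Real.le_log_iff_exp_le ht]
    exact h1.le
  · rw [← Real.log_le_iff_le_exp ht]
    exact h2.le

theorem logCutoff_eq_zero {L t : ℝ} (hL : 0 < L)
    (h : t ∉ Icc (Real.exp (-(2 * L))) (Real.exp (2 * L))) : logCutoff L t = 0 := by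
  rcases le_or_gt t 0 with ht | ht
  · exact if_pos ht
  · rw [logCutoff_of_pos L ht, plateau_eq_zero (two_le_abs_log_div hL ht h)]

theorem logCutoff_eventuallyEq (L : ℝ) {t : ℝ} (ht : 0 < t) :
    logCutoff L =ᶠ[𝓝 t] fun t => plateau (Real.log t / L) := by
  filter_upwards [Ioi_mem_nhds ht] with s hs
  exact logCutoff_of_pos L hs

theorem contDiff_logCutoff {L : ℝ} (hL : 0 < L) : ContDiff ℝ ∞ (logCutoff L) := by
  rw [contDiff_iff_contDiffAt]
  intro t
  rcases le_or_gt t 0 with ht | ht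
  · refine (contDiffAt_const (c := (0 : ℝ))).congr_of_eventuallyEq ?_
    filter_upwards [Iio_mem_nhds (ht.trans_lt (Real.exp_pos (-(2 * L))))] with s hs
    exact logCutoff_eq_zero hL fun h => h.1.not_gt hs
  · refine ContDiffAt.congr_of_eventuallyEq ?_ (logCutoff_eventuallyEq L ht)
    exact contDiff_plateau.contDiffAt.comp t ((Real.contDiffAt_log.2 ht.ne').div_const L)

theorem abs_logCutoff_le (L t : ℝ) : |logCutoff L t| ≤ 1 := by
  unfold logCutoff
  split_ifs
  · simp
  · rw [abs_of_nonneg plateau.nonneg]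
    exact plateau.le_one

theorem hasDerivAt_plateau (s : ℝ) : HasDerivAt plateau (deriv plateau s) s :=
  ((contDiff_plateau.differentiable (by simp)) s).hasDerivAt

theorem contDiff_deriv_plateau : ContDiff ℝ ∞ (deriv plateau) :=
  (contDiff_infty_iff_deriv.1 contDiff_plateau).2

theorem hasDerivAt_deriv_plateau (s : ℝ) :
    HasDerivAt (deriv plateau) (deriv (deriv plateau) s) s :=
  ((contDiff_deriv_plateau.differentiable (by simp)) s).hasDerivAt

theorem hasDerivAt_logCutoff (L : ℝ) {t : ℝ} (ht : 0 < t) :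
    HasDerivAt (logCutoff L) (deriv plateau (Real.log t / L) * (t⁻¹ / L)) t :=
  ((hasDerivAt_plateau _).comp t ((Real.hasDerivAt_log ht.ne').div_const L)).congr_of_eventuallyEq
    (logCutoff_eventuallyEq L ht)

theorem hasCompactSupport_plateau : HasCompactSupport plateau := plateau.hasCompactSupport

theorem exists_bound_deriv_plateau : ∃ B : ℝ, 0 ≤ B ∧ (∀ s, |deriv plateau s| ≤ B) ∧
    ∀ s, |deriv (deriv plateau) s| ≤ B := by
  have h1 : HasCompactSupport (deriv plateau) := hasCompactSupport_plateau.deriv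
  obtain ⟨B1, hB1⟩ := h1.exists_bound_of_continuous contDiff_deriv_plateau.continuous
  obtain ⟨B2, hB2⟩ := h1.deriv.exists_bound_of_continuous
    (contDiff_infty_iff_deriv.1 contDiff_deriv_plateau).2.continuous
  exact ⟨max B1 B2, (norm_nonneg _).trans ((hB1 0).trans (le_max_left _ _)),
    fun s => (hB1 s).trans (le_max_left _ _), fun s => (hB2 s).trans (le_max_right _ _)⟩

theorem deriv_deriv_plateau_eq_zero {s : ℝ} (hs : 2 ≤ |s|) : deriv (deriv plateau) s = 0 := by
  -- on the closed set `2 ≤ |s|` the second derivative vanishes, by continuity from `2 < |s|`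
  have h1 : ∀ s ∈ {s : ℝ | 2 < |s|}, deriv (deriv plateau) s = 0 := by
    intro s hs
    have ho : IsOpen {s : ℝ | 2 < |s|} := isOpen_lt continuous_const continuous_abs
    have h : plateau =ᶠ[𝓝 s] fun _ => (0 : ℝ) := by
      filter_upwards [ho.mem_nhds hs] with r hr
      exact plateau_eq_zero (le_of_lt hr)
    have := h.deriv.deriv_eq
    simpa using this
  have hc : Continuous (deriv (deriv plateau)) :=
    (contDiff_infty_iff_deriv.1 contDiff_deriv_plateau).2.continuous
  have hcl : IsClosed {s : ℝ | deriv (deriv plateau) s = 0} := isClosed_singleton.preimage hc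
  have hlim : Tendsto (fun r : ℝ => r * s) (𝓝[>] 1) (𝓝 s) := by
    have : Tendsto (fun r : ℝ => r * s) (𝓝 1) (𝓝 (1 * s)) := tendsto_id.mul_const s
    rw [one_mul] at this
    exact this.mono_left nhdsWithin_le_nhds
  refine hcl.mem_of_tendsto hlim ?_
  filter_upwards [self_mem_nhdsWithin] with r hr
  refine h1 _ ?_
  have hr' : (1 : ℝ) < r := hr
  change 2 < |r * s|
  rw [abs_mul, abs_of_pos (by linarith)]
  nlinarith

/-- The Laguerre function cut off logarithmically at `0` and at `∞`. -/
def cutLaguerreFn (L : ℝ) (n : ℕ) (t : ℝ) : ℝ := laguerreFn n t * logCutoff L t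

theorem contDiff_cutLaguerreFn {L : ℝ} (hL : 0 < L) (n : ℕ) : ContDiff ℝ ∞ (cutLaguerreFn L n) :=
  (contDiff_laguerreFn n).mul (contDiff_logCutoff hL)

/-- The error made by the cutoff in the Laguerre differential equation. -/
def cutError (L : ℝ) (n : ℕ) (t : ℝ) : ℝ :=
  2 * laguerreFnDeriv n t * (deriv plateau (Real.log t / L) / L)
    + laguerreFn n t * (deriv (deriv plateau) (Real.log t / L) * (t⁻¹ / L) / L)

theorem deriv_mul_deriv_cutLaguerreFn (L : ℝ) (n : ℕ) {t : ℝ} (ht : 0 < t) :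
    deriv (fun t => t * deriv (cutLaguerreFn L n) t) t
      = (t / 4 - 1 / 2 - n) * cutLaguerreFn L n t + cutError L n t := by
  have h1 : ∀ s : ℝ, 0 < s → deriv (cutLaguerreFn L n) s
      = laguerreFnDeriv n s * logCutoff L s
        + laguerreFn n s * (deriv plateau (Real.log s / L) * (s⁻¹ / L)) := fun s hs =>
    ((hasDerivAt_laguerreFn n s).mul (hasDerivAt_logCutoff L hs)).deriv
  have h2 : (fun t => t * deriv (cutLaguerreFn L n) t) =ᶠ[𝓝 t] fun s =>
      (s * laguerreFnDeriv n s) * logCutoff L s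
        + laguerreFn n s * (deriv plateau (Real.log s / L) / L) := by
    filter_upwards [Ioi_mem_nhds ht] with s hs
    have : s ≠ 0 := (ne_of_gt hs)
    rw [h1 s hs]
    field_simp
  rw [h2.deriv_eq]
  have h3 := ((hasDerivAt_mul_laguerreFnDeriv n t).mul (hasDerivAt_logCutoff L ht)).add
    ((hasDerivAt_laguerreFn n t).mul (((hasDerivAt_deriv_plateau _).comp t
      ((Real.hasDerivAt_log ht.ne').div_const L)).div_const L))
  refine h3.deriv.trans ?_
  have ht' := ht.ne'
  simp only [cutLaguerreFn, cutError, Function.comp_apply]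
  have e : t * t⁻¹ = 1 := mul_inv_cancel₀ ht'
  linear_combination laguerreFnDeriv n t * (deriv plateau (Real.log t / L) / L) * e

/-- An integrable majorant of the cutoff error. -/
def errorBound (B L : ℝ) (n : ℕ) (t : ℝ) : ℝ :=
  2 * B / L * |laguerreFnDeriv n t|
    + (n + 2) * B / L ^ 2
      * (Icc (Real.exp (-(2 * L))) (Real.exp (2 * L))).indicator (fun t => t⁻¹) t

theorem abs_cutError_le {B L : ℝ} (hL : 0 < L) (n : ℕ) (hB1 : ∀ s, |deriv plateau s| ≤ B)
    (hB2 : ∀ s, |deriv (deriv plateau) s| ≤ B) {t : ℝ} (ht : 0 < t) :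
    |cutError L n t| ≤ errorBound B L n t := by
  have hB : 0 ≤ B := (abs_nonneg _).trans (hB1 0)
  refine (abs_add_le _ _).trans (add_le_add ?_ ?_)
  · rw [abs_mul, abs_mul, abs_div, abs_of_pos hL, abs_of_pos (two_pos : (0 : ℝ) < 2)]
    calc 2 * |laguerreFnDeriv n t| * (|deriv plateau (Real.log t / L)| / L)
        ≤ 2 * |laguerreFnDeriv n t| * (B / L) := by
          gcongr
          exact hB1 _
      _ = _ := by ring
  · by_cases hI : t ∈ Icc (Real.exp (-(2 * L))) (Real.exp (2 * L))
    · rw [indicator_of_mem hI, abs_mul, abs_div, abs_mul, abs_div, abs_of_pos hL,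
        abs_of_pos (inv_pos.2 ht)]
      calc |laguerreFn n t| * (|deriv (deriv plateau) (Real.log t / L)| * (t⁻¹ / L) / L)
          ≤ (n + 2) * (B * (t⁻¹ / L) / L) := by
            gcongr
            · exact abs_laguerreFn_le n ht.le
            · exact hB2 _
        _ = _ := by
            field_simp
    · rw [deriv_deriv_plateau_eq_zero (two_le_abs_log_div hL ht hI), indicator_of_notMem hI]
      simp

theorem integrableOn_laguerreFnDeriv (n : ℕ) : IntegrableOn (laguerreFnDeriv n) (Ioi 0) := by
  have : laguerreFnDeriv n
      = fun x => -∑ k ∈ Finset.range n, laguerreFn k x - laguerreFn n x / 2 :=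
    funext (laguerreFnDeriv_eq_sum n)
  rw [this]
  exact (integrable_finsetSum _ fun k _ => integrableOn_laguerreFn k).neg.sub
    ((integrableOn_laguerreFn n).div_const 2)

theorem integral_indicator_inv {L : ℝ} (hL : 0 < L) :
    IntegrableOn ((Icc (Real.exp (-(2 * L))) (Real.exp (2 * L))).indicator fun t => t⁻¹) (Ioi 0) ∧
      ∫ t in Ioi (0 : ℝ), (Icc (Real.exp (-(2 * L))) (Real.exp (2 * L))).indicator
        (fun t => t⁻¹) t = 4 * L := by
  have hpos := Real.exp_pos (-(2 * L))
  have hle : Real.exp (-(2 * L)) ≤ Real.exp (2 * L) := Real.exp_le_exp.2 (by linarith)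
  have hI : IntegrableOn (fun t : ℝ => t⁻¹) (Icc (Real.exp (-(2 * L))) (Real.exp (2 * L))) := by
    refine ContinuousOn.integrableOn_Icc (continuousOn_inv₀.mono fun t ht => ?_)
    exact (hpos.trans_le ht.1).ne'
  constructor
  · exact (hI.integrable_indicator measurableSet_Icc).integrableOn
  · rw [setIntegral_indicator measurableSet_Icc, inter_eq_self_of_subset_right
      (show Icc (Real.exp (-(2 * L))) (Real.exp (2 * L)) ⊆ Ioi 0 from
        fun t ht => hpos.trans_le ht.1), integral_Icc_eq_integral_Ioc,
      ← intervalIntegral.integral_of_le hle, integral_inv_of_pos hpos (Real.exp_pos _),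
      ← Real.exp_sub, Real.log_exp]
    ring

/-- The cutoff error is `O(1 / L)` in `L¹`: the factor `L⁻²` beats `∫ dt / t = 4 L` over the support
of the cutoff. -/
theorem integral_errorBound {L : ℝ} (hL : 0 < L) (B : ℝ) (n : ℕ) :
    IntegrableOn (errorBound B L n) (Ioi 0) ∧ ∫ t in Ioi (0 : ℝ), errorBound B L n t
      = (2 * B * (∫ t in Ioi (0 : ℝ), |laguerreFnDeriv n t|) + 4 * (n + 2) * B) / L := by
  have h1 := (integrableOn_laguerreFnDeriv n).abs.const_mul (2 * B / L)
  have h2 := (integral_indicator_inv hL).1.const_mul ((n + 2) * B / L ^ 2)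
  refine ⟨h1.add h2, ?_⟩
  unfold errorBound
  rw [integral_add h1 h2, integral_const_mul, integral_const_mul, (integral_indicator_inv hL).2]
  field_simp

end Cutoff

/-! ### Symmetry of the Laguerre operator on bounded functions -/

section Symmetry

variable {d : ℕ}

theorem tensor_second_order (φ : Fin d → ℝ → ℝ) (hφ : ∀ j, ContDiff ℝ ∞ (φ j)) (j : Fin d)
    {x : Fin d → ℝ} (hx : x ∈ orthant d) :
    (partialDeriv j (mulCoord j (partialDeriv j (tensor φ hφ)))).1 x
      = ((deriv (fun t => t * deriv (φ j) t) (x j) : ℝ) : ℂ)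
        * ((∏ i ∈ Finset.univ.erase j, φ i (x i) : ℝ) : ℂ) := by
  set K : (Fin d → ℝ) → ℂ := fun x => ((∏ i ∈ Finset.univ.erase j, φ i (x i) : ℝ) : ℂ) with hKdef
  have hK : ∀ x (t : ℝ), K (x + t • Pi.single j 1) = K x := by
    intro x t
    simp only [hKdef]
    congr 1
    refine Finset.prod_congr rfl fun i hi => ?_
    simp [Pi.single_eq_of_ne (Finset.ne_of_mem_erase hi)]
  have hd1 : ∀ t, HasDerivAt (φ j) (deriv (φ j) t) t := fun t =>
    ((hφ j).differentiable (by simp) t).hasDerivAt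
  have hc : ContDiff ℝ ∞ fun t => t * deriv (φ j) t :=
    contDiff_id.mul (contDiff_infty_iff_deriv.1 (hφ j)).2
  have hd2 : ∀ t, HasDerivAt (fun t => t * deriv (φ j) t)
      (deriv (fun t => t * deriv (φ j) t) t) t := fun t => (hc.differentiable (by simp) t).hasDerivAt
  refine partialDeriv_apply_of_eq j _ _ _ hd2 K hK (fun y hy => ?_) hx
  rw [mulCoord_apply _ _ hy, partialDeriv_apply_of_eq j _ _ _ hd1 K hK
    (fun z hz => tensor_eq φ hφ j hz) hy]
  push_cast
  ring

/-- The Laguerre function `l_n` cut off logarithmically in each variable. -/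
def cutLaguerreSmooth {L : ℝ} (hL : 0 < L) (n : Fin d → ℕ) : SmoothFun d :=
  tensor (fun j => cutLaguerreFn L (n j)) fun j => contDiff_cutLaguerreFn hL (n j)

theorem cutLaguerreSmooth_apply {L : ℝ} (hL : 0 < L) (n : Fin d → ℕ) {x : Fin d → ℝ}
    (hx : x ∈ orthant d) :
    (cutLaguerreSmooth hL n).1 x = ((∏ j, cutLaguerreFn L (n j) (x j) : ℝ) : ℂ) :=
  Set.indicator_of_mem hx fun x => ((∏ j, cutLaguerreFn L (n j) (x j) : ℝ) : ℂ)

theorem abs_cutLaguerreFn_le (L : ℝ) (n : ℕ) (t : ℝ) :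
    |cutLaguerreFn L n t| ≤ |laguerreFn n t| := by
  rw [cutLaguerreFn, abs_mul]
  exact mul_le_of_le_one_right (abs_nonneg _) (abs_logCutoff_le L t)

theorem supportedIn_cutLaguerreSmooth {L : ℝ} (hL : 0 < L) (n : Fin d → ℕ) :
    SupportedIn (Set.univ.pi fun _ : Fin d => Icc (Real.exp (-(2 * L))) (Real.exp (2 * L)))
      (cutLaguerreSmooth hL n) := by
  refine ⟨isCompact_univ_pi fun _ => isCompact_Icc,
    fun x hx j => (Real.exp_pos _).trans_le (hx j trivial).1, fun x hx => ?_⟩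
  by_cases hxo : x ∈ orthant d
  · rw [cutLaguerreSmooth_apply hL n hxo]
    have : ∃ j, x j ∉ Icc (Real.exp (-(2 * L))) (Real.exp (2 * L)) := by
      by_contra! h
      exact hx fun j _ => h j
    obtain ⟨j, hj⟩ := this
    rw [Finset.prod_eq_zero (Finset.mem_univ j)]
    · simp
    · rw [cutLaguerreFn, logCutoff_eq_zero hL hj, mul_zero]
  · exact (cutLaguerreSmooth hL n).2.2 x hxo

theorem laguerreOp_cutLaguerreSmooth {L : ℝ} (hL : 0 < L) (n : Fin d → ℕ) {x : Fin d → ℝ}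
    (hx : x ∈ orthant d) :
    (laguerreOp d (cutLaguerreSmooth hL n)).1 x - (deg n : ℂ) * (cutLaguerreSmooth hL n).1 x
      = -∑ j, (cutError L (n j) (x j) : ℂ)
        * ((∏ i ∈ Finset.univ.erase j, cutLaguerreFn L (n i) (x i) : ℝ) : ℂ) := by
  have hn : (deg n : ℂ) = ∑ j, (n j : ℂ) := by
    rw [deg]
    push_cast
    rfl
  rw [laguerreOp_apply, hn, Finset.sum_mul, ← neg_add', neg_inj, ← Finset.sum_add_distrib]
  refine Finset.sum_congr rfl fun j _ => ?_
  have h0 : (cutLaguerreSmooth hL n).1 x = _ :=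
    tensor_eq (fun j => cutLaguerreFn L (n j)) (fun j => contDiff_cutLaguerreFn hL (n j)) j hx
  have h1 : (partialDeriv j (mulCoord j (partialDeriv j (cutLaguerreSmooth hL n)))).1 x = _ :=
    tensor_second_order (fun j => cutLaguerreFn L (n j))
      (fun j => contDiff_cutLaguerreFn hL (n j)) j hx
  rw [mulCoord_apply _ _ hx, h1, deriv_mul_deriv_cutLaguerreFn L (n j) (hx j), h0]
  push_cast
  ring

/-- The contribution of the cutoff in the variable `x_j` to the defect of symmetry. -/
def defectBound (B L : ℝ) (n : Fin d → ℕ) (j : Fin d) (x : Fin d → ℝ) : ℝ :=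
  ∏ i, Function.update (fun i t => |laguerreFn (n i) t|) j (errorBound B L (n j)) i (x i)

theorem integrableOn_defectBound {L : ℝ} (hL : 0 < L) (B : ℝ) (n : Fin d → ℕ) (j : Fin d) :
    IntegrableOn (defectBound B L n j) (orthant d) := by
  refine integrableOn_orthant_prod fun i => ?_
  rcases eq_or_ne i j with rfl | hij
  · rw [Function.update_self]
    exact (integral_errorBound hL B _).1
  · rw [Function.update_of_ne hij]
    exact (integrableOn_laguerreFn _).abs

theorem tendsto_integral_defectBound (B : ℝ) (n : Fin d → ℕ) (j : Fin d) :
    Tendsto (fun k : ℕ => ∫ x in orthant d, defectBound B ((k : ℝ) + 1) n j x) atTop (𝓝 0) := by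
  have h1 : ∀ k : ℕ, ∫ x in orthant d, defectBound B ((k : ℝ) + 1) n j x
      = (2 * B * (∫ t in Ioi (0 : ℝ), |laguerreFnDeriv (n j) t|) + 4 * (n j + 2) * B)
        * (∏ i ∈ Finset.univ.erase j, ∫ t in Ioi (0 : ℝ), |laguerreFn (n i) t|)
        * (1 / ((k : ℝ) + 1)) := by
    intro k
    unfold defectBound
    rw [integral_orthant_prod, ← Finset.mul_prod_erase _ _ (Finset.mem_univ j),
      Function.update_self, (integral_errorBound (by positivity) B (n j)).2,
      Finset.prod_congr rfl fun i hi => by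
        rw [Function.update_of_ne (Finset.ne_of_mem_erase hi)]]
    ring
  simp_rw [h1]
  simpa using tendsto_one_div_add_atTop_nhds_zero_nat.const_mul
    ((2 * B * (∫ t in Ioi (0 : ℝ), |laguerreFnDeriv (n j) t|) + 4 * (n j + 2) * B)
        * ∏ i ∈ Finset.univ.erase j, ∫ t in Ioi (0 : ℝ), |laguerreFn (n i) t|)

theorem norm_error_le_defectBound {B L : ℝ} (hL : 0 < L) (n : Fin d → ℕ)
    (hB1 : ∀ s, |deriv plateau s| ≤ B) (hB2 : ∀ s, |deriv (deriv plateau) s| ≤ B) (j : Fin d)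
    {x : Fin d → ℝ} (hx : x ∈ orthant d) :
    ‖(cutError L (n j) (x j) : ℂ)
      * ((∏ i ∈ Finset.univ.erase j, cutLaguerreFn L (n i) (x i) : ℝ) : ℂ)‖
      ≤ defectBound B L n j x := by
  have he := abs_cutError_le hL (n j) hB1 hB2 (hx j)
  rw [norm_mul, Complex.norm_real, Complex.norm_real, Real.norm_eq_abs, Real.norm_eq_abs,
    Finset.abs_prod, defectBound, ← Finset.mul_prod_erase _ _ (Finset.mem_univ j),
    Function.update_self]
  refine mul_le_mul he ?_ (Finset.prod_nonneg fun _ _ => abs_nonneg _)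
    ((abs_nonneg _).trans he)
  refine Finset.prod_le_prod (fun _ _ => abs_nonneg _) fun i hi => ?_
  rw [Function.update_of_ne (Finset.ne_of_mem_erase hi)]
  exact abs_cutLaguerreFn_le _ _ _

/-- The defect of symmetry for the cut-off Laguerre function. Green's formula removes the derivatives
of `f`, of which nothing is known near the boundary. -/
theorem norm_integral_cut_le {B L M : ℝ} (hL : 0 < L) (n : Fin d → ℕ)
    (hB1 : ∀ s, |deriv plateau s| ≤ B) (hB2 : ∀ s, |deriv (deriv plateau) s| ≤ B)
    (f : SmoothFun d) (hf : ∀ x ∈ orthant d, ‖f.1 x‖ ≤ M) :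
    ‖(∫ x in orthant d, (laguerreOp d f).1 x * (cutLaguerreSmooth hL n).1 x)
      - (deg n : ℂ) * ∫ x in orthant d, f.1 x * (cutLaguerreSmooth hL n).1 x‖
      ≤ ∑ j, M * ∫ x in orthant d, defectBound B L n j x := by
  set w := cutLaguerreSmooth hL n
  have hw : SupportedIn _ w := supportedIn_cutLaguerreSmooth hL n
  have hi1 : IntegrableOn (fun x => (laguerreOp d f).1 x * w.1 x) (orthant d) :=
    (hw.mul_left (laguerreOp d f)).integrable.integrableOn
  have hi2 : IntegrableOn (fun x => f.1 x * w.1 x) (orthant d) :=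
    (hw.mul_left f).integrable.integrableOn
  obtain ⟨hg1, hg2⟩ := hw.integral_green f
  have heq : ∀ x, (laguerreOp d f).1 x * w.1 x - (deg n : ℂ) * (f.1 x * w.1 x)
      - ((laguerreOp d f).1 x * w.1 x - f.1 x * (laguerreOp d w).1 x)
      = f.1 x * ((laguerreOp d w).1 x - (deg n : ℂ) * w.1 x) := fun x => by ring
  have h1 : (∫ x in orthant d, (laguerreOp d f).1 x * w.1 x)
      - (deg n : ℂ) * ∫ x in orthant d, f.1 x * w.1 x
      = ∫ x in orthant d, f.1 x * ((laguerreOp d w).1 x - (deg n : ℂ) * w.1 x) := by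
    have hi3 : IntegrableOn
        (fun x => (laguerreOp d f).1 x * w.1 x - (deg n : ℂ) * (f.1 x * w.1 x)) (orthant d) :=
      hi1.sub (hi2.const_mul _)
    simp_rw [← heq]
    rw [integral_sub hi3 hg1, hg2, sub_zero,
      integral_sub hi1 (hi2.const_mul _), integral_const_mul]
  rw [h1]
  have hbi : ∀ j, IntegrableOn (fun x => M * defectBound B L n j x) (orthant d) := fun j =>
    (integrableOn_defectBound hL B n j).const_mul M
  refine (norm_integral_le_of_norm_le (g := fun x => ∑ j, M * defectBound B L n j x)
    (integrable_finsetSum _ fun j _ => hbi j) ?_).trans_eq ?_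
  · refine (ae_restrict_iff' (measurableSet_orthant d)).2 (ae_of_all _ fun x hx => ?_)
    rw [laguerreOp_cutLaguerreSmooth hL n hx, norm_mul, norm_neg, ← Finset.mul_sum]
    refine mul_le_mul (hf x hx) ?_ (norm_nonneg _) ((norm_nonneg _).trans (hf x hx))
    exact (norm_sum_le _ _).trans
      (Finset.sum_le_sum fun j _ => norm_error_le_defectBound hL n hB1 hB2 j hx)
  · rw [integral_finsetSum _ fun j _ => hbi j]
    simp_rw [integral_const_mul]

theorem tendsto_cutLaguerreSmooth (n : Fin d → ℕ) {x : Fin d → ℝ} (hx : x ∈ orthant d) :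
    Tendsto (fun k : ℕ => (cutLaguerreSmooth (L := (k : ℝ) + 1) (by positivity) n).1 x) atTop
      (𝓝 (laguerreFun n x : ℂ)) := by
  have h1 : ∀ j, ∀ᶠ k : ℕ in atTop, cutLaguerreFn ((k : ℝ) + 1) (n j) (x j)
      = laguerreFn (n j) (x j) := by
    intro j
    filter_upwards [eventually_ge_atTop ⌈|Real.log (x j)|⌉₊] with k hk
    have hk' : |Real.log (x j)| ≤ k := (Nat.le_ceil _).trans (by exact_mod_cast hk)
    have hk0 : (0 : ℝ) < (k : ℝ) + 1 := by positivity
    rw [cutLaguerreFn, logCutoff_of_pos _ (hx j), plateau.one_of_mem_closedBall, mul_one]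
    rw [mem_closedBall_zero_iff, Real.norm_eq_abs, abs_div, abs_of_pos hk0, plateau,
      div_le_one hk0]
    linarith
  refine tendsto_const_nhds.congr' ?_
  filter_upwards [eventually_all.2 h1] with k hk
  rw [cutLaguerreSmooth_apply _ n hx, laguerreFun, Finset.prod_congr rfl fun j _ => hk j]

theorem norm_cutLaguerreSmooth_le {L : ℝ} (hL : 0 < L) (n : Fin d → ℕ) {x : Fin d → ℝ}
    (hx : x ∈ orthant d) : ‖(cutLaguerreSmooth hL n).1 x‖ ≤ |laguerreFun n x| := by
  rw [cutLaguerreSmooth_apply hL n hx, Complex.norm_real, Real.norm_eq_abs, laguerreFun,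
    Finset.abs_prod, Finset.abs_prod]
  exact Finset.prod_le_prod (fun _ _ => abs_nonneg _) fun j _ => abs_cutLaguerreFn_le _ _ _

theorem aestronglyMeasurable_smooth (f : SmoothFun d) :
    AEStronglyMeasurable f.1 (volume.restrict (orthant d)) :=
  (SmoothFun.contDiffOn f).continuousOn.aestronglyMeasurable (measurableSet_orthant d)

theorem tendsto_integral_cut (f : SmoothFun d) {M : ℝ} (hf : ∀ x ∈ orthant d, ‖f.1 x‖ ≤ M)
    (n : Fin d → ℕ) :
    Tendsto (fun k : ℕ => ∫ x in orthant d,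
        f.1 x * (cutLaguerreSmooth (L := (k : ℝ) + 1) (by positivity) n).1 x) atTop
      (𝓝 (∫ x in orthant d, f.1 x * (laguerreFun n x : ℂ))) := by
  refine tendsto_integral_of_dominated_convergence (fun x => M * |laguerreFun n x|)
    (fun k => (aestronglyMeasurable_smooth f).mul (aestronglyMeasurable_smooth _))
    ((integrableOn_laguerreFun n).abs.const_mul M) (fun k => ?_) ?_
  · refine (ae_restrict_iff' (measurableSet_orthant d)).2 (ae_of_all _ fun x hx => ?_)
    rw [norm_mul]
    exact mul_le_mul (hf x hx) (norm_cutLaguerreSmooth_le _ n hx) (norm_nonneg _)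
      ((norm_nonneg _).trans (hf x hx))
  · refine (ae_restrict_iff' (measurableSet_orthant d)).2 (ae_of_all _ fun x hx => ?_)
    exact (tendsto_cutLaguerreSmooth n hx).const_mul _

/-- No boundary condition is needed for the symmetry of `E`: boundedness of `f` and `E f` suffices,
because the boundary of the orthant has capacity zero for `∂_j x_j ∂_j`. -/
theorem integral_laguerreOp_mul (f : SmoothFun d) {M M' : ℝ}
    (hf : ∀ x ∈ orthant d, ‖f.1 x‖ ≤ M)
    (hf' : ∀ x ∈ orthant d, ‖(laguerreOp d f).1 x‖ ≤ M')
    (n : Fin d → ℕ) :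
    ∫ x in orthant d, (laguerreOp d f).1 x * (laguerreFun n x : ℂ)
      = (deg n : ℂ) * ∫ x in orthant d, f.1 x * (laguerreFun n x : ℂ) := by
  obtain ⟨B, -, hB1, hB2⟩ := exists_bound_deriv_plateau
  have h1 := (tendsto_integral_cut _ hf' n).sub ((tendsto_integral_cut f hf n).const_mul
    (deg n : ℂ))
  have h2 : Tendsto (fun k : ℕ => ∑ j, M * ∫ x in orthant d, defectBound B ((k : ℝ) + 1) n j x)
      atTop (𝓝 0) := by
    simpa using tendsto_finsetSum Finset.univ fun j _ =>
      (tendsto_integral_defectBound B n j).const_mul M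
  have h3 := squeeze_zero_norm
    (fun k : ℕ => norm_integral_cut_le (L := (k : ℝ) + 1) (by positivity) n hB1 hB2 f hf) h2
  exact sub_eq_zero.1 (tendsto_nhds_unique h1 h3)

theorem integral_laguerreOp_pow_mul (f : SmoothFun d)
    (hf : ∀ N, ∃ M, ∀ x ∈ orthant d, ‖((laguerreOp d ^ N) f).1 x‖ ≤ M) (N : ℕ) (n : Fin d → ℕ) :
    ∫ x in orthant d, ((laguerreOp d ^ N) f).1 x * (laguerreFun n x : ℂ)
      = (deg n : ℂ) ^ N * ∫ x in orthant d, f.1 x * (laguerreFun n x : ℂ) := by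
  induction N with
  | zero => simp
  | succ N ih =>
    obtain ⟨M, hM⟩ := hf N
    obtain ⟨M', hM'⟩ := hf (N + 1)
    rw [pow_succ', Module.End.mul_apply] at hM' ⊢
    rw [integral_laguerreOp_mul _ hM hM' n, ih]
    ring

theorem StepBound.nonneg {α h M : ℝ} {f : SmoothFun d} (hf : StepBound α h M f) : 0 ≤ M := by
  have := hf 0 (fun _ => 1) fun _ => one_pos
  simp only [pow_zero, mul_one, Nat.factorial_zero, Nat.cast_one, Real.one_rpow] at this
  exact (norm_nonneg _).trans this

/-- Analysis: the Laguerre coefficients of functions in `𝒢_α` satisfy the bounds of `SeqBound`,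
with control by the step norms. -/
theorem exists_analysis {α h : ℝ} (hα : 0 < α) (hh : 0 < h) :
    ∃ C h' : ℝ, 0 < C ∧ 0 < h' ∧ ∀ (f : G d α) (M : ℝ), StepBound α h M f.toSmooth →
      SeqBound α h' (C * M) (series f) := by
  obtain ⟨C, h', hC, hh', H⟩ := exists_weight_absorb hα hh (2 * d)
  refine ⟨19 ^ d * C, h', by positivity, hh', fun f M hf N n => ?_⟩
  have hM := hf.nonneg
  -- the coefficients divided by the bound for `‖l_n‖₁`
  set b : ℝ := ‖series f n‖ / (19 ^ d * (1 + (deg n : ℝ)) ^ (2 * d)) with hb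
  have hpos : (0 : ℝ) < 19 ^ d * (1 + (deg n : ℝ)) ^ (2 * d) := by positivity
  have h1 : ∀ N : ℕ, (deg n : ℝ) ^ N * b ≤ M * h ^ N * (N.factorial : ℝ) ^ α := by
    intro N
    have h2 := integral_laguerreOp_pow_mul f.toSmooth (fun N => ⟨_, hf N⟩) N n
    have h3 : ‖(deg n : ℂ) ^ N * series f n‖ ≤ (M * h ^ N * (N.factorial : ℝ) ^ α)
        * (19 ^ d * (1 + (deg n : ℝ)) ^ (2 * d)) := by
      unfold series
      rw [← h2]
      refine (norm_integral_le_of_norm_le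
        (g := fun x => (M * h ^ N * (N.factorial : ℝ) ^ α) * |laguerreFun n x|)
        ((integrableOn_laguerreFun n).abs.const_mul _) ?_).trans ?_
      · refine (ae_restrict_iff' (measurableSet_orthant d)).2 (ae_of_all _ fun x hx => ?_)
        rw [norm_mul, Complex.norm_real, Real.norm_eq_abs]
        gcongr
        exact hf N x hx
      · rw [integral_const_mul]
        gcongr
        exact integral_abs_laguerreFun_le n
    rw [norm_mul, norm_pow, Complex.norm_natCast] at h3
    rw [hb, ← mul_div_assoc, div_le_iff₀ hpos]
    exact h3
  have h4 := H (deg n) b M (Nat.cast_nonneg _) (by positivity) hM h1 N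
  have h5 : ‖series f n‖ = 19 ^ d * (1 + (deg n : ℝ)) ^ (2 * d) * b := by
    rw [hb]
    field_simp
  calc (deg n : ℝ) ^ N * ‖series f n‖
      = 19 ^ d * ((1 + (deg n : ℝ)) ^ (2 * d) * ((deg n : ℝ) ^ N * b)) := by rw [h5]; ring
    _ ≤ 19 ^ d * (C * M * h' ^ N * (N.factorial : ℝ) ^ α) := by gcongr
    _ = _ := by ring

end Symmetry

/-! ### Completeness of the Laguerre functions -/

section Completeness

variable {d : ℕ}

theorem integrableOn_mvPolynomial_mul (P : MvPolynomial (Fin d) ℝ) {φ : Fin d → ℝ → ℝ}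
    (h : ∀ j (k : ℕ), IntegrableOn (fun t => t ^ k * φ j t) (Ioi 0)) :
    IntegrableOn (fun x => MvPolynomial.eval x P * ∏ j, φ j (x j)) (orthant d) := by
  induction P using MvPolynomial.induction_on' with
  | monomial u a =>
    have := (integrableOn_orthant_prod (φ := fun j t => t ^ u j * φ j t)
      fun j => h j (u j)).const_mul a
    refine this.congr (ae_of_all _ fun x => ?_)
    simp only [MvPolynomial.eval_monomial]
    rw [Finsupp.prod_fintype _ _ fun _ => pow_zero _, Finset.prod_mul_distrib, mul_assoc]
  | add p q hp hq =>
    refine (hp.add hq).congr (ae_of_all _ fun x => ?_)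
    simp [add_mul]

theorem integrableOn_mvPolynomial_mul_laguerreFun (P : MvPolynomial (Fin d) ℝ) (n : Fin d → ℕ) :
    IntegrableOn (fun x => MvPolynomial.eval x P * laguerreFun n x) (orthant d) := by
  refine integrableOn_mvPolynomial_mul P fun j k => ?_
  refine (integrableOn_eval_mul_exp_neg (Polynomial.X ^ k * laguerrePoly (n j))
    (b := 1 / 2) (by norm_num)).congr_fun (fun t _ => ?_) measurableSet_Ioi
  simpa using (laguerreFn_mul_eq (Polynomial.X ^ k) (n j) t).symm

theorem coord_mul_laguerreFun (n : Fin d → ℕ) (j : Fin d) (x : Fin d → ℝ) :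
    x j * laguerreFun n x = -((n j : ℝ) + 1) * laguerreFun (Function.update n j (n j + 1)) x
      + (2 * (n j : ℝ) + 1) * laguerreFun n x
      + (-(n j : ℝ)) * laguerreFun (Function.update n j (n j - 1)) x := by
  have h : ∀ m, laguerreFun (Function.update n j m) x
      = laguerreFn m (x j) * ∏ i ∈ Finset.univ.erase j, laguerreFn (n i) (x i) := by
    intro m
    rw [laguerreFun, ← Finset.mul_prod_erase _ _ (Finset.mem_univ j), Function.update_self,
      Finset.prod_congr rfl fun i hi => by
        rw [Function.update_of_ne (Finset.ne_of_mem_erase hi)]]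
  have h0 := h (n j)
  rw [Function.update_eq_self] at h0
  rw [h, h, h0]
  linear_combination (∏ i ∈ Finset.univ.erase j, laguerreFn (n i) (x i))
    * mul_laguerreFn (n j) (x j)

variable {f : SmoothFun d} {M : ℝ}

theorem integrableOn_smooth_mul (hf : ∀ x ∈ orthant d, ‖f.1 x‖ ≤ M) {g : (Fin d → ℝ) → ℝ}
    (hg : IntegrableOn g (orthant d)) : IntegrableOn (fun x => f.1 x * (g x : ℂ)) (orthant d) := by
  refine Integrable.bdd_mul (c := M) (hg.ofReal (𝕜 := ℂ)) (aestronglyMeasurable_smooth f) ?_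
  exact (ae_restrict_iff' (measurableSet_orthant d)).2 (ae_of_all _ hf)

/-- If the Laguerre coefficients vanish, then so do all moments, by the three-term recurrence. -/
theorem integral_mul_mvPolynomial_eq_zero (hf : ∀ x ∈ orthant d, ‖f.1 x‖ ≤ M)
    (h0 : ∀ n, ∫ x in orthant d, f.1 x * (laguerreFun n x : ℂ) = 0)
    (P : MvPolynomial (Fin d) ℝ) : ∀ n,
    ∫ x in orthant d, f.1 x * ((MvPolynomial.eval x P * laguerreFun n x : ℝ) : ℂ) = 0 := by
  have hi := fun (P : MvPolynomial (Fin d) ℝ) n =>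
    integrableOn_smooth_mul hf (integrableOn_mvPolynomial_mul_laguerreFun P n)
  induction P using MvPolynomial.induction_on with
  | C a =>
    intro n
    have : ∀ x, f.1 x * ((MvPolynomial.eval x (MvPolynomial.C a) * laguerreFun n x : ℝ) : ℂ)
        = (a : ℂ) * (f.1 x * (laguerreFun n x : ℂ)) := by
      intro x
      rw [MvPolynomial.eval_C]
      push_cast
      ring
    simp_rw [this]
    rw [integral_const_mul, h0, mul_zero]
  | add p q hp hq =>
    intro n
    have : ∀ x, f.1 x * ((MvPolynomial.eval x (p + q) * laguerreFun n x : ℝ) : ℂ)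
        = f.1 x * ((MvPolynomial.eval x p * laguerreFun n x : ℝ) : ℂ)
          + f.1 x * ((MvPolynomial.eval x q * laguerreFun n x : ℝ) : ℂ) := by
      intro x
      rw [map_add]
      push_cast
      ring
    simp_rw [this]
    rw [integral_add (hi p n) (hi q n), hp, hq, add_zero]
  | mul_X p j hp =>
    intro n
    have : ∀ x, f.1 x * ((MvPolynomial.eval x (p * MvPolynomial.X j) * laguerreFun n x : ℝ) : ℂ)
        = (-((n j : ℂ) + 1)) * (f.1 x * ((MvPolynomial.eval x p
            * laguerreFun (Function.update n j (n j + 1)) x : ℝ) : ℂ))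
          + (2 * (n j : ℂ) + 1) * (f.1 x * ((MvPolynomial.eval x p * laguerreFun n x : ℝ) : ℂ))
          + (-(n j : ℂ)) * (f.1 x * ((MvPolynomial.eval x p
            * laguerreFun (Function.update n j (n j - 1)) x : ℝ) : ℂ)) := by
      intro x
      have h := congrArg (fun t : ℝ => (t : ℂ)) (coord_mul_laguerreFun n j x)
      rw [map_mul, MvPolynomial.eval_X]
      push_cast at h ⊢
      linear_combination f.1 x * (MvPolynomial.eval x p : ℂ) * h
    simp_rw [this]
    have h12 : IntegrableOn (fun x => (-((n j : ℂ) + 1)) * (f.1 x * ((MvPolynomial.eval x p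
            * laguerreFun (Function.update n j (n j + 1)) x : ℝ) : ℂ))
          + (2 * (n j : ℂ) + 1) * (f.1 x * ((MvPolynomial.eval x p * laguerreFun n x : ℝ) : ℂ)))
        (orthant d) := ((hi _ _).const_mul _).add ((hi _ _).const_mul _)
    rw [integral_add h12 ((hi _ _).const_mul _),
      integral_add ((hi _ _).const_mul _) ((hi _ _).const_mul _), integral_const_mul,
      integral_const_mul, integral_const_mul, hp, hp, hp]
    simp

theorem laguerreFun_zero (x : Fin d → ℝ) :
    laguerreFun 0 x = ∏ j, Real.exp (-(1 / 2) * x j) := by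
  unfold laguerreFun
  refine Finset.prod_congr rfl fun j _ => ?_
  rw [Pi.zero_apply, laguerreFn_zero]
  congr 1
  ring

theorem integrableOn_mvPolynomial_mul_exp (P : MvPolynomial (Fin d) ℝ) {b : ℝ} (hb : 0 < b) :
    IntegrableOn (fun x => MvPolynomial.eval x P * ∏ j, Real.exp (-b * x j)) (orthant d) := by
  refine integrableOn_mvPolynomial_mul P (φ := fun _ t => Real.exp (-b * t)) fun j k => ?_
  simpa using integrableOn_eval_mul_exp_neg (Polynomial.X ^ k) hb

/-- The weighted moments against `e^{iθ}` vanish, for linear forms `θ` that are integer multiples of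
a small form: one step expands `e^{iθ}` in its power series, which the weight dominates. -/
theorem integral_mul_exp_eq_zero (hf : ∀ x ∈ orthant d, ‖f.1 x‖ ≤ M)
    (h0 : ∀ n, ∫ x in orthant d, f.1 x * (laguerreFun n x : ℂ) = 0)
    {ξ : Fin d → ℝ} (hξ : ∀ j, |ξ j| ≤ 1 / 4) (l : ℕ) : ∀ P : MvPolynomial (Fin d) ℝ,
    ∫ x in orthant d, f.1 x * ((MvPolynomial.eval x P * laguerreFun 0 x : ℝ) : ℂ)
      * Complex.exp (((l : ℝ) * ∑ j, ξ j * x j : ℝ) * Complex.I) = 0 := by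
  induction l with
  | zero =>
    intro P
    simpa using integral_mul_mvPolynomial_eq_zero hf h0 P 0
  | succ l ih =>
    intro P
    set Θ : MvPolynomial (Fin d) ℝ := ∑ j, MvPolynomial.C (ξ j) * MvPolynomial.X j with hΘ
    have hΘe : ∀ x : Fin d → ℝ, MvPolynomial.eval x Θ = ∑ j, ξ j * x j := by
      intro x
      simp [hΘ]
    set F : ℕ → (Fin d → ℝ) → ℂ := fun k x =>
      ((k.factorial : ℂ)⁻¹ * Complex.I ^ k) * (f.1 x
        * ((MvPolynomial.eval x (P * Θ ^ k) * laguerreFun 0 x : ℝ) : ℂ)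
        * Complex.exp (((l : ℝ) * ∑ j, ξ j * x j : ℝ) * Complex.I)) with hF
    have hint : ∀ k, ∫ x in orthant d, F k x = 0 := by
      intro k
      rw [hF]
      simp only
      rw [integral_const_mul, ih, mul_zero]
    set bound : ℕ → (Fin d → ℝ) → ℝ := fun k x =>
      (M * (|MvPolynomial.eval x P| * laguerreFun 0 x))
        * ((1 / 4 * ∑ j, x j) ^ k / k.factorial) with hbound
    have hlag0 : ∀ x : Fin d → ℝ, 0 ≤ laguerreFun 0 x := fun x => by
      rw [laguerreFun_zero]
      exact Finset.prod_nonneg fun j _ => (Real.exp_pos _).le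
    have hmeas : ∀ k, AEStronglyMeasurable (F k) (volume.restrict (orthant d)) := by
      intro k
      refine AEStronglyMeasurable.const_mul (AEStronglyMeasurable.mul
        (integrableOn_smooth_mul hf
          (integrableOn_mvPolynomial_mul_laguerreFun (P * Θ ^ k) 0)).aestronglyMeasurable ?_) _
      refine Continuous.aestronglyMeasurable ?_
      fun_prop
    have hle : ∀ k, ∀ x ∈ orthant d, ‖F k x‖ ≤ bound k x := by
      intro k x hx
      have hθ : |∑ j, ξ j * x j| ≤ 1 / 4 * ∑ j, x j := by
        rw [Finset.mul_sum]
        refine (Finset.abs_sum_le_sum_abs _ _).trans (Finset.sum_le_sum fun j _ => ?_)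
        rw [abs_mul, abs_of_pos (hx j)]
        exact mul_le_mul_of_nonneg_right (hξ j) (hx j).le
      have hM : 0 ≤ M := (norm_nonneg _).trans (hf x hx)
      rw [hF, hbound]
      simp only [norm_mul, norm_inv, norm_pow, Complex.norm_natCast, Complex.norm_I, one_pow,
        mul_one, Complex.norm_real, Complex.norm_exp_ofReal_mul_I, map_mul, map_pow, hΘe,
        Real.norm_eq_abs, abs_of_nonneg (hlag0 x)]
      calc (k.factorial : ℝ)⁻¹ * (‖f.1 x‖
            * (|MvPolynomial.eval x P| * |∑ j, ξ j * x j| ^ k * laguerreFun 0 x))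
          ≤ (k.factorial : ℝ)⁻¹ * (M
            * (|MvPolynomial.eval x P| * (1 / 4 * ∑ j, x j) ^ k * laguerreFun 0 x)) := by
            have := hlag0 x
            gcongr
            exact hf x hx
        _ = _ := by ring
    have hsumb : ∀ x, HasSum (fun k => bound k x)
        ((M * (|MvPolynomial.eval x P| * laguerreFun 0 x)) * Real.exp (1 / 4 * ∑ j, x j)) := by
      intro x
      have := NormedSpace.expSeries_div_hasSum_exp (1 / 4 * ∑ j, x j : ℝ)
      rw [← Real.exp_eq_exp_ℝ] at this
      exact this.mul_left _
    have hbi : Integrable (fun x => ∑' k, bound k x) (volume.restrict (orthant d)) := by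
      have := ((integrableOn_mvPolynomial_mul_exp P (b := 1 / 4) (by norm_num)).abs).const_mul M
      refine this.congr (ae_of_all _ fun x => ?_)
      have e : (∏ j, Real.exp (-(1 / 2) * x j)) * Real.exp (1 / 4 * ∑ j, x j)
          = ∏ j, Real.exp (-(1 / 4) * x j) := by
        rw [← Real.exp_sum, ← Real.exp_sum, ← Real.exp_add, Finset.mul_sum,
          ← Finset.sum_add_distrib]
        congr 1
        refine Finset.sum_congr rfl fun j _ => ?_
        ring
      simp only
      rw [(hsumb x).tsum_eq, laguerreFun_zero, abs_mul, abs_of_nonneg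
        (Finset.prod_nonneg fun j _ => (Real.exp_pos _).le), ← e]
      ring
    have key := hasSum_integral_of_dominated_convergence (μ := volume.restrict (orthant d)) bound
      (F := F) (f := fun x => f.1 x * ((MvPolynomial.eval x P * laguerreFun 0 x : ℝ) : ℂ)
        * Complex.exp ((((l + 1 : ℕ) : ℝ) * ∑ j, ξ j * x j : ℝ) * Complex.I)) hmeas
      (fun k => (ae_restrict_iff' (measurableSet_orthant d)).2 (ae_of_all _ (hle k)))
      (ae_of_all _ fun x => (hsumb x).summable) hbi (ae_of_all _ fun x => ?_)
    · simp_rw [hint] at key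
      exact key.unique (hasSum_zero : HasSum (fun _ : ℕ => (0 : ℂ)) 0)
    · have h1 := NormedSpace.expSeries_div_hasSum_exp (((∑ j, ξ j * x j : ℝ) : ℂ) * Complex.I)
      rw [← Complex.exp_eq_exp_ℂ] at h1
      have h2 := h1.mul_left (f.1 x * ((MvPolynomial.eval x P * laguerreFun 0 x : ℝ) : ℂ)
        * Complex.exp (((l : ℝ) * ∑ j, ξ j * x j : ℝ) * Complex.I))
      have e : Complex.exp ((((l + 1 : ℕ) : ℝ) * ∑ j, ξ j * x j : ℝ) * Complex.I)
          = Complex.exp (((l : ℝ) * ∑ j, ξ j * x j : ℝ) * Complex.I)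
            * Complex.exp (((∑ j, ξ j * x j : ℝ) : ℂ) * Complex.I) := by
        rw [← Complex.exp_add]
        congr 1
        push_cast
        ring
      rw [e, ← mul_assoc]
      refine h2.congr_fun fun k => ?_
      rw [hF]
      simp only [map_mul, map_pow, hΘe]
      push_cast
      rw [mul_pow, div_eq_mul_inv]
      ring

theorem integral_mul_fourier_eq_zero (hf : ∀ x ∈ orthant d, ‖f.1 x‖ ≤ M)
    (h0 : ∀ n, ∫ x in orthant d, f.1 x * (laguerreFun n x : ℂ) = 0) (ξ : Fin d → ℝ) :
    ∫ x in orthant d, f.1 x * (laguerreFun 0 x : ℂ)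
      * Complex.exp ((∑ j, ξ j * x j : ℝ) * Complex.I) = 0 := by
  -- `ξ` is `m` times a form with coefficients at most `1 / 4`
  obtain ⟨m, hm⟩ := exists_nat_ge (4 * ∑ j, |ξ j| + 1)
  have hs : 0 ≤ ∑ j, |ξ j| := Finset.sum_nonneg fun _ _ => abs_nonneg _
  have hm0 : (0 : ℝ) < m := by linarith
  have hξ : ∀ j, |ξ j / m| ≤ 1 / 4 := by
    intro j
    have := Finset.single_le_sum (f := fun j => |ξ j|) (fun _ _ => abs_nonneg _)
      (Finset.mem_univ j)
    rw [abs_div, abs_of_pos hm0, div_le_iff₀ hm0]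
    linarith
  have := integral_mul_exp_eq_zero hf h0 hξ m 1
  simp only [map_one, one_mul] at this
  have e : ∀ x : Fin d → ℝ, (m : ℝ) * ∑ j, ξ j / m * x j = ∑ j, ξ j * x j := by
    intro x
    rw [Finset.mul_sum]
    refine Finset.sum_congr rfl fun j _ => ?_
    field_simp
  simpa only [e] using this

/-- A bounded smooth function on the orthant is determined by its Laguerre coefficients. -/
theorem eq_zero_of_coefficients (hf : ∀ x ∈ orthant d, ‖f.1 x‖ ≤ M)
    (h0 : ∀ n, ∫ x in orthant d, f.1 x * (laguerreFun n x : ℂ) = 0) : f = 0 := by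
  refine SmoothFun.ext_orthant fun x hx => ?_
  change f.1 x = 0
  -- Fourier inversion at points of continuity, for `f e^{-|x|/2}` extended by zero
  set g : (Fin d → ℝ) → ℂ := fun x => f.1 x * (laguerreFun 0 x : ℂ) with hg
  set G : EuclideanSpace ℝ (Fin d) → ℂ := fun v => g v.ofLp with hG
  have hpres := PiLp.volume_preserving_ofLp (Fin d)
  have hemb : MeasurableEmbedding (WithLp.ofLp : EuclideanSpace ℝ (Fin d) → Fin d → ℝ) :=
    (MeasurableEquiv.toLp 2 (Fin d → ℝ)).symm.measurableEmbedding
  have hgoff : ∀ x, x ∉ orthant d → g x = 0 := fun x hx => by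
    simp only [hg, f.2.2 x hx, zero_mul]
  have hgi : Integrable g := by
    rw [← integrableOn_iff_integrable_of_support_subset (s := orthant d) fun x hx => by
      by_contra h
      exact hx (hgoff x h)]
    exact integrableOn_smooth_mul hf (integrableOn_laguerreFun 0)
  have hGi : Integrable G := (hpres.integrable_comp_emb hemb).2 hgi
  have hfour : FourierTransform.fourier G = fun _ => (0 : ℂ) := by
    funext w
    rw [Real.fourier_eq']
    have h1 := hpres.integral_comp hemb fun y : Fin d → ℝ =>
      Complex.exp ((∑ j, (-2 * Real.pi * w j) * y j : ℝ) * Complex.I) • g y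
    have h2 : ∫ y : Fin d → ℝ,
        Complex.exp ((∑ j, (-2 * Real.pi * w j) * y j : ℝ) * Complex.I) • g y = 0 := by
      rw [← setIntegral_eq_integral_of_forall_compl_eq_zero (s := orthant d) fun y hy => by
        rw [hgoff y hy, smul_zero]]
      rw [← integral_mul_fourier_eq_zero hf h0 fun j => -2 * Real.pi * w j]
      refine integral_congr_ae (ae_of_all _ fun y => ?_)
      simp only [hg, smul_eq_mul]
      ring
    rw [h2] at h1
    rw [← h1]
    refine integral_congr_ae (ae_of_all _ fun v => ?_)
    simp only [hG]
    congr 4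
    rw [PiLp.inner_apply, Finset.mul_sum]
    refine Finset.sum_congr rfl fun j _ => ?_
    simp
    ring
  have hcont : ContinuousAt G (WithLp.toLp 2 x) := by
    have h1 : ContinuousAt g x :=
      ((SmoothFun.diffAt f hx).continuousAt).mul
        (Complex.continuous_ofReal.comp (continuous_laguerreFun 0)).continuousAt
    exact ContinuousAt.comp (g := g) (f := WithLp.ofLp) (x := WithLp.toLp 2 x) h1
      (PiLp.continuous_ofLp 2 _).continuousAt
  have key := hGi.fourierInv_fourier_eq (by rw [hfour]; exact integrable_zero _ _ _) hcont
  rw [hfour, Real.fourierInv_eq] at key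
  simp only [smul_zero, integral_zero] at key
  have h3 : f.1 x * (laguerreFun 0 x : ℂ) = 0 := key.symm
  refine (mul_eq_zero.1 h3).resolve_right ?_
  rw [laguerreFun_zero]
  exact_mod_cast (Finset.prod_pos fun j _ => Real.exp_pos _).ne'

theorem integrableOn_toSmooth_mul {α : ℝ} (f : G d α) (n : Fin d → ℕ) :
    IntegrableOn (fun x => f.toSmooth.1 x * (laguerreFun n x : ℂ)) (orthant d) := by
  obtain ⟨C, h, -, -, hf⟩ := f.2
  exact integrableOn_smooth_mul (hf 0) (integrableOn_laguerreFun n)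

/-- The map from `f ∈ 𝒢_α` to its Laguerre series, as a linear map. -/
def seriesLinear (d : ℕ) (α : ℝ) : G d α →ₗ[ℂ] FormalSeries d where
  toFun := series
  map_add' f g := by
    funext n
    refine Eq.trans ?_ (integral_add (integrableOn_toSmooth_mul f n)
      (integrableOn_toSmooth_mul g n))
    exact integral_congr_ae (ae_of_all _ fun x =>
      add_mul (f.toSmooth.1 x) (g.toSmooth.1 x) (laguerreFun n x : ℂ))
  map_smul' c f := by
    funext n
    refine Eq.trans ?_ (integral_const_mul c _)
    exact integral_congr_ae (ae_of_all _ fun x =>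
      mul_assoc c (f.toSmooth.1 x) (laguerreFun n x : ℂ))

theorem seriesLinear_injective (d : ℕ) (α : ℝ) : Function.Injective (seriesLinear d α) := by
  refine (injective_iff_map_eq_zero _).2 fun f hf => ?_
  obtain ⟨C, h, -, -, hb⟩ := f.2
  exact Subtype.ext (eq_zero_of_coefficients (hb 0) fun n => congrFun hf n)

theorem series_injective (α : ℝ) : Function.Injective (series : G d α → FormalSeries d) :=
  seriesLinear_injective d α

end Completeness

/-! ### Continuity in the inductive limit topology -/

section LimitTopology

variable {d : ℕ} {α : ℝ}

theorem IsAdmissible.finset_sup (s : Finset {p : Seminorm ℂ (G d α) // IsAdmissible p}) :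
    IsAdmissible (s.sup (admissibleSeminorms d α)) := by
  classical
  intro h hh
  induction s using Finset.induction_on with
  | empty => exact ⟨0, fun f M _ => by simp⟩
  | insert p s hp ih =>
    obtain ⟨C, hC⟩ := ih
    obtain ⟨C', hC'⟩ := p.2 h hh
    refine ⟨max C' C, fun f M hf => ?_⟩
    rw [Finset.sup_insert, Seminorm.sup_apply]
    refine max_le ((hC' f M hf).trans ?_) ((hC f M hf).trans ?_)
    · exact mul_le_mul_of_nonneg_right (le_max_left _ _) hf.nonneg
    · exact mul_le_mul_of_nonneg_right (le_max_right _ _) hf.nonneg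

/-- A continuous functional is bounded on each of the steps of the inductive limit. -/
theorem exists_bound_of_functional (F : GDual d α) {h : ℝ} (hh : 0 < h) :
    ∃ C : ℝ, ∀ (f : G d α) (M : ℝ), StepBound α h M f.toSmooth → ‖F f‖ ≤ C * M := by
  obtain ⟨s, C, -, hC⟩ := Seminorm.bound_of_continuous (withSeminorms_G d α)
    ((normSeminorm ℂ ℂ).comp F.toLinearMap) (F.continuous.norm)
  obtain ⟨C', hC'⟩ := IsAdmissible.finset_sup s h hh
  refine ⟨C * C', fun f M hf => (hC f).trans ?_⟩
  rw [mul_assoc]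
  exact mul_le_mul_of_nonneg_left (hC' f M hf) C.2

theorem continuous_functional (φ : G d α →ₗ[ℂ] ℂ)
    (H : ∀ h : ℝ, 0 < h → ∃ C : ℝ, ∀ (f : G d α) (M : ℝ), StepBound α h M f.toSmooth →
      ‖φ f‖ ≤ C * M) : Continuous φ := by
  have hadm : IsAdmissible ((normSeminorm ℂ ℂ).comp φ) := H
  refine (withSeminorms_G d α).continuous_normedSpace_rng ℂ φ ⟨{⟨_, hadm⟩}, 1, ?_⟩
  rw [Finset.sup_singleton, one_smul]
  rfl

/-- A linear map that takes each step of the inductive limit boundedly into some step is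
continuous: it pulls admissible seminorms back to admissible seminorms. -/
theorem continuous_of_step (T : G d α →ₗ[ℂ] G d α)
    (H : ∀ h : ℝ, 0 < h → ∃ C h' : ℝ, 0 < h' ∧ ∀ (f : G d α) (M : ℝ),
      StepBound α h M f.toSmooth → StepBound α h' (C * M) (T f).toSmooth) : Continuous T := by
  refine WithSeminorms.continuous_of_isBounded (withSeminorms_G d α) (withSeminorms_G d α) T
    fun p => ?_
  have hadm : IsAdmissible (p.1.comp T) := by
    intro h hh
    obtain ⟨C, h', hh', hT⟩ := H h hh
    obtain ⟨C', hC'⟩ := p.2 h' hh'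
    refine ⟨C' * C, fun f M hf => ?_⟩
    rw [mul_assoc]
    exact hC' _ _ (hT f M hf)
  refine ⟨{⟨_, hadm⟩}, 1, ?_⟩
  rw [Finset.sup_singleton, one_smul]
  rfl

theorem tendsto_zero_of_step {h : ℝ} (hh : 0 < h) {u : ℕ → G d α} {M : ℕ → ℝ}
    (hu : ∀ k, StepBound α h (M k) (u k).toSmooth) (hM : Tendsto M atTop (𝓝 0)) :
    Tendsto u atTop (𝓝 0) := by
  rw [(withSeminorms_G d α).tendsto_nhds]
  intro p ε hε
  obtain ⟨C, hC⟩ := p.2 h hh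
  have h1 : Tendsto (fun k => C * M k) atTop (𝓝 0) := by simpa using hM.const_mul C
  filter_upwards [h1.eventually (gt_mem_nhds hε)] with k hk
  rw [sub_zero]
  exact (hC _ _ (hu k)).trans_lt hk

end LimitTopology

/-! ### Multipliers of Laguerre series -/

section Multipliers

variable {d : ℕ} {α : ℝ}

theorem series_add (f g : G d α) : series (f + g) = series f + series g :=
  map_add (seriesLinear d α) f g

theorem series_smul (c : ℂ) (f : G d α) : series (c • f) = c • series f :=
  map_smul (seriesLinear d α) c f

theorem series_laguerreG (hα : 0 < α) (m : Fin d → ℕ) :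
    series (laguerreG hα m) = Pi.single m 1 := by
  funext n
  have h1 : series (laguerreG hα m) n
      = ∫ x in orthant d, ((laguerreFun m x * laguerreFun n x : ℝ) : ℂ) := by
    refine setIntegral_congr_fun (measurableSet_orthant d) fun x hx => ?_
    change (laguerreSmooth m).1 x * _ = _
    rw [laguerreSmooth_apply m hx]
    push_cast
    rfl
  rw [h1, integral_complex_ofReal, integral_laguerreFun_mul, Pi.single_apply]
  simp only [eq_comm]
  split_ifs <;> simp

/-- Multiplication of the coefficients by `m` preserves the class of coefficient sequences of
`𝒢_α`, with control of the bounds. -/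
def IsMultiplier (α : ℝ) (m : FormalSeries d) : Prop :=
  ∀ h : ℝ, 0 < h → ∃ C h' : ℝ, 0 < C ∧ 0 < h' ∧ ∀ (a : FormalSeries d) (M : ℝ),
    SeqBound α h M a → SeqBound α h' (C * M) (fun n => m n * a n)

theorem IsMultiplier.exists_map {m : FormalSeries d} (hm : IsMultiplier α m) (hα : 0 < α) :
    ∃ T : G d α →L[ℂ] G d α, ∀ f, series (T f) = fun n => m n * series f n := by
  -- the two spaces are compared through coefficient sequences: analysis, multiplier, synthesis
  have key : ∀ h : ℝ, 0 < h → ∃ C h' : ℝ, 0 < h' ∧ ∀ (f : G d α) (M : ℝ),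
      StepBound α h M f.toSmooth → ∃ g : G d α, series g = (fun n => m n * series f n) ∧
        StepBound α h' (C * M) g.toSmooth := by
    intro h hh
    obtain ⟨C1, h1, -, hh1, H1⟩ := exists_analysis (d := d) hα hh
    obtain ⟨C2, h2, -, hh2, H2⟩ := hm h1 hh1
    obtain ⟨C3, h3, -, hh3, H3⟩ := exists_synthesis (d := d) hα hh2
    refine ⟨C3 * (C2 * C1), h3, hh3, fun f M hf => ?_⟩
    rw [mul_assoc, mul_assoc]
    exact H3 _ _ (H2 _ _ (H1 f M hf))
  have hex : ∀ f : G d α, ∃ g : G d α, series g = fun n => m n * series f n := by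
    intro f
    obtain ⟨M, h, -, hh, hf⟩ := f.2
    obtain ⟨C, h', -, H⟩ := key h hh
    obtain ⟨g, hg, -⟩ := H f M hf
    exact ⟨g, hg⟩
  choose T hT using hex
  let Tl : G d α →ₗ[ℂ] G d α :=
    { toFun := T
      map_add' := fun f g => series_injective α <| by
        rw [series_add, hT, hT, hT, series_add]
        funext n
        simp only [Pi.add_apply]
        ring
      map_smul' := fun c f => series_injective α <| by
        rw [RingHom.id_apply, series_smul, hT, hT, series_smul]
        funext n
        simp only [Pi.smul_apply, smul_eq_mul]
        ring }
  refine ⟨⟨Tl, continuous_of_step Tl fun h hh => ?_⟩, hT⟩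
  obtain ⟨C, h', hh', H⟩ := key h hh
  refine ⟨C, h', hh', fun f M hf => ?_⟩
  obtain ⟨g, hg, hgb⟩ := H f M hf
  have : Tl f = g := series_injective α ((hT f).trans hg.symm)
  rwa [this]

theorem isMultiplier_of_norm_le_one {m : FormalSeries d} (hm : ∀ n, ‖m n‖ ≤ 1) :
    IsMultiplier α m := by
  refine fun h hh => ⟨1, h, one_pos, hh, fun a M ha N n => ?_⟩
  rw [one_mul, norm_mul]
  refine le_trans ?_ (ha N n)
  gcongr
  exact mul_le_of_le_one_left (norm_nonneg _) (hm n)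

theorem summable_pow_mul_factorial_rpow_div (hα1 : α < 1) {x : ℝ} (hx : 0 < x) :
    Summable fun m : ℕ => x ^ m * (m.factorial : ℝ) ^ α / m.factorial := by
  refine summable_of_ratio_test_tendsto_lt_one (l := 0) one_pos
    (Eventually.of_forall fun m => by positivity) ?_
  have h1 : ∀ m : ℕ, ‖x ^ (m + 1) * ((m + 1).factorial : ℝ) ^ α / (m + 1).factorial‖
      / ‖x ^ m * (m.factorial : ℝ) ^ α / m.factorial‖ = x * ((m : ℝ) + 1) ^ (-(1 - α)) := by
    intro m
    rw [Real.norm_of_nonneg (by positivity), Real.norm_of_nonneg (by positivity),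
      Nat.factorial_succ]
    push_cast
    rw [Real.mul_rpow (by positivity) (by positivity), neg_sub, Real.rpow_sub_one (by positivity)]
    have h2 : (m.factorial : ℝ) ^ α ≠ 0 := by positivity
    field_simp
    ring
  simp_rw [h1]
  have h2 : Tendsto (fun m : ℕ => (m : ℝ) + 1) atTop atTop :=
    tendsto_atTop_add_const_right _ _ tendsto_natCast_atTop_atTop
  have h3 := ((tendsto_rpow_neg_atTop (sub_pos.2 hα1)).comp h2).const_mul x
  simpa using h3

/-- For `α < 1` the coefficients decrease faster than any exponential: expanding `e^{r|n|}` in its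
power series costs a factor `m!^α / m!` in the `m`-th term. -/
theorem isMultiplier_of_norm_le_exp (hα : 0 < α) (hα1 : α < 1) {r : ℝ} (hr : 0 < r)
    {m : FormalSeries d} (hm : ∀ n, ‖m n‖ ≤ Real.exp (r * deg n)) : IsMultiplier α m := by
  intro h hh
  set A : ℝ := (2 : ℝ) ^ α with hA
  have hA0 : 0 < A := by positivity
  have hS := summable_pow_mul_factorial_rpow_div hα1 (x := r * h * A) (by positivity)
  set S : ℝ := ∑' k : ℕ, (r * h * A) ^ k * (k.factorial : ℝ) ^ α / k.factorial with hSdef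
  have hS0 : 0 ≤ S := tsum_nonneg fun k => by positivity
  refine ⟨S + 1, A * h, by positivity, by positivity, fun a M ha N n => ?_⟩
  have hM := ha.nonneg
  have h1 : HasSum (fun k : ℕ => (r * deg n) ^ k / k.factorial * ((deg n : ℝ) ^ N * ‖a n‖))
      (Real.exp (r * deg n) * ((deg n : ℝ) ^ N * ‖a n‖)) := by
    have := NormedSpace.expSeries_div_hasSum_exp (r * deg n : ℝ)
    rw [← Real.exp_eq_exp_ℝ] at this
    exact this.mul_right _
  have h2 : ∀ k : ℕ, (r * deg n) ^ k / k.factorial * ((deg n : ℝ) ^ N * ‖a n‖)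
      ≤ (M * (A * h) ^ N * (N.factorial : ℝ) ^ α)
        * ((r * h * A) ^ k * (k.factorial : ℝ) ^ α / k.factorial) := by
    intro k
    have h3 := ha (N + k) n
    have h4 := factorial_add_rpow_le hα N k
    calc (r * deg n) ^ k / k.factorial * ((deg n : ℝ) ^ N * ‖a n‖)
        = r ^ k / k.factorial * ((deg n : ℝ) ^ (N + k) * ‖a n‖) := by
          rw [mul_pow, pow_add]; ring
      _ ≤ r ^ k / k.factorial * (M * h ^ (N + k)
          * (A ^ N * A ^ k * (N.factorial : ℝ) ^ α * (k.factorial : ℝ) ^ α)) := by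
          refine mul_le_mul_of_nonneg_left (h3.trans ?_) (by positivity)
          exact mul_le_mul_of_nonneg_left h4 (by positivity)
      _ = _ := by
          rw [mul_pow, mul_pow, mul_pow, pow_add]; ring
  have h5 := hasSum_le h2 h1 (hS.hasSum.mul_left _)
  rw [norm_mul]
  calc (deg n : ℝ) ^ N * (‖m n‖ * ‖a n‖) ≤ (deg n : ℝ) ^ N * (Real.exp (r * deg n) * ‖a n‖) := by
        gcongr
        exact hm n
    _ = Real.exp (r * deg n) * ((deg n : ℝ) ^ N * ‖a n‖) := by ring
    _ ≤ M * (A * h) ^ N * (N.factorial : ℝ) ^ α * S := h5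
    _ ≤ M * (A * h) ^ N * (N.factorial : ℝ) ^ α * (S + 1) := by
        gcongr
        linarith
    _ = _ := by ring

theorem map_laguerreG (hα : 0 < α) {m : FormalSeries d} {T : G d α →L[ℂ] G d α}
    (hT : ∀ f, series (T f) = fun n => m n * series f n) (n : Fin d → ℕ) :
    T (laguerreG hα n) = m n • laguerreG hα n := by
  refine series_injective α ?_
  rw [hT, series_smul, series_laguerreG]
  funext k
  rcases eq_or_ne k n with rfl | h
  · simp
  · simp [Pi.single_eq_of_ne h]

end Multipliers

/-! ### Ultradistributions and their Laguerre coefficients -/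

section Dual

variable {d : ℕ} {α : ℝ}

/-- The dual of a multiplier map is the multiplier map with the same multiplier. -/
theorem dualSeries_precomp (hα : 0 < α) {m : FormalSeries d} {T : G d α →L[ℂ] G d α}
    (hT : ∀ f, series (T f) = fun n => m n * series f n) (F : GDual d α) :
    dualSeries hα (ContinuousLinearMap.precomp ℂ T F) = fun n => m n * dualSeries hα F n := by
  funext n
  change F (T (laguerreG hα n)) = m n * F (laguerreG hα n)
  rw [map_laguerreG hα hT, map_smul, smul_eq_mul]

/-- The tails of the Laguerre series of `f ∈ 𝒢_α` tend to `0` within one step of the inductive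
limit, so the Laguerre functions span a dense subspace. -/
theorem eq_zero_of_dualSeries (hα : 0 < α) {F : GDual d α} (hF : dualSeries hα F = 0) :
    F = 0 := by
  ext f
  obtain ⟨M, h, -, hh, hf⟩ := f.2
  obtain ⟨C1, h1, -, hh1, H1⟩ := exists_analysis (d := d) hα hh
  obtain ⟨C2, h2, -, hh2, H2⟩ := SeqBound.exists_weight (d := d) hα hh1 1
  obtain ⟨C3, h3, -, hh3, H3⟩ := exists_synthesis (d := d) hα hh2
  obtain ⟨C4, H4⟩ := exists_bound_of_functional F hh3
  have ha := H1 f M hf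
  have hw := H2 _ _ ha
  have hbound : ∀ K : ℕ, ‖F f‖ ≤ C4 * (C3 * (C2 * (C1 * M))) * (1 / ((K : ℝ) + 1)) := by
    intro K
    -- outside the cube `S` one has `|n| ≥ K`, so the weight `1 + |n|` gains a factor `1 / (K + 1)`
    set S : Finset (Fin d → ℕ) := Fintype.piFinset fun _ => Finset.range K with hS
    set b : FormalSeries d := fun n => if n ∈ S then 0 else series f n with hb
    have hbb : SeqBound α h2 (C2 * (C1 * M) * (1 / ((K : ℝ) + 1))) b := by
      intro N n
      have h5 := hw N n
      rw [pow_one] at h5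
      have h6 : 0 ≤ C2 * (C1 * M) * h2 ^ N * (N.factorial : ℝ) ^ α :=
        le_trans (by positivity) h5
      rw [hb]
      simp only
      split_ifs with hn
      · rw [norm_zero, mul_zero]
        calc 0 ≤ C2 * (C1 * M) * h2 ^ N * (N.factorial : ℝ) ^ α * (1 / ((K : ℝ) + 1)) := by
              positivity
          _ = _ := by ring
      · have hK : (K : ℝ) ≤ deg n := by
          rw [hS, Fintype.mem_piFinset] at hn
          push Not at hn
          obtain ⟨j, hj⟩ := hn
          have : K ≤ n j := by simpa using hj
          exact_mod_cast this.trans (le_deg n j)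
        have h7 : ((K : ℝ) + 1) * ((deg n : ℝ) ^ N * ‖series f n‖)
            ≤ C2 * (C1 * M) * h2 ^ N * (N.factorial : ℝ) ^ α := by
          refine le_trans ?_ h5
          exact mul_le_mul_of_nonneg_right (by linarith) (by positivity)
        calc (deg n : ℝ) ^ N * ‖series f n‖
            ≤ C2 * (C1 * M) * h2 ^ N * (N.factorial : ℝ) ^ α / ((K : ℝ) + 1) := by
              rwa [le_div_iff₀' (by positivity)]
          _ = _ := by ring
    obtain ⟨g, hg, hgb⟩ := H3 b _ hbb
    have hfg : f = g + ∑ n ∈ S, series f n • laguerreG hα n := by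
      refine series_injective α ?_
      have hsum : series (∑ n ∈ S, series f n • laguerreG hα n)
          = ∑ n ∈ S, series f n • Pi.single n (1 : ℂ) := by
        refine (map_sum (seriesLinear d α) _ _).trans (Finset.sum_congr rfl fun n _ => ?_)
        refine (map_smul (seriesLinear d α) _ _).trans ?_
        congr 1
        exact series_laguerreG hα n
      rw [series_add, hg, hsum]
      funext k
      rw [Pi.add_apply, Finset.sum_apply, hb]
      simp only [Pi.smul_apply, Pi.single_apply, smul_eq_mul, mul_ite, mul_one, mul_zero,
        Finset.sum_ite_eq]
      split_ifs <;> simp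
    have hFl : ∀ n, F (laguerreG hα n) = 0 := fun n => congrFun hF n
    have hFf : F f = F g := by
      rw [hfg, map_add, map_sum]
      simp [hFl]
    rw [hFf]
    refine (H4 g _ hgb).trans_eq ?_
    ring
  have hlim : Tendsto (fun K : ℕ => C4 * (C3 * (C2 * (C1 * M))) * (1 / ((K : ℝ) + 1))) atTop
      (𝓝 0) := by
    simpa using tendsto_one_div_add_atTop_nhds_zero_nat.const_mul (C4 * (C3 * (C2 * (C1 * M))))
  have := ge_of_tendsto' hlim hbound
  exact norm_le_zero_iff.1 this

theorem dualSeries_injective (hα : 0 < α) :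
    Function.Injective (dualSeries hα : GDual d α → FormalSeries d) := by
  intro F F' h
  refine sub_eq_zero.1 (eq_zero_of_dualSeries hα ?_)
  funext n
  exact sub_eq_zero.2 (congrFun h n)

theorem rapidDecay_series (hα : 0 < α) (f : G d α) : RapidDecay (series f) id := by
  obtain ⟨M, h, -, hh, hf⟩ := f.2
  obtain ⟨C1, h1, -, hh1, H1⟩ := exists_analysis (d := d) hα hh
  exact (H1 f M hf).rapidDecay hα hh1

theorem summable_series (hα : 0 < α) (f : G d α) : Summable (series f) := by
  refine Summable.of_norm ?_
  simpa using rapidDecay_series hα f 0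

/-- The ultradistribution `f ↦ ∑_n a_n (f)`, all of whose Laguerre coefficients are `1`. -/
theorem exists_dualSeries_eq_one (d : ℕ) (hα : 0 < α) :
    ∃ F : GDual d α, ∀ n, F (laguerreG hα n) = 1 := by
  let φ : G d α →ₗ[ℂ] ℂ :=
    { toFun := fun f => ∑' n, series f n
      map_add' := fun f g => by
        rw [series_add]
        exact (summable_series hα f).tsum_add (summable_series hα g)
      map_smul' := fun c f => by
        rw [series_smul]
        exact (summable_series hα f).tsum_const_smul c }
  refine ⟨⟨φ, continuous_functional φ fun h hh => ?_⟩, fun n => ?_⟩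
  · obtain ⟨C1, h1, -, hh1, H1⟩ := exists_analysis (d := d) hα hh
    obtain ⟨C2, h2, -, hh2, H2⟩ := SeqBound.exists_weight (d := d) hα hh1 (2 * d)
    refine ⟨C2 * C1 * ∑' n : Fin d → ℕ, ((1 + (deg n : ℝ)) ^ (2 * d))⁻¹, fun f M hf => ?_⟩
    have hw := H2 _ _ (H1 f M hf) 0
    simp only [pow_zero, one_mul, mul_one, Nat.factorial_zero, Nat.cast_one,
      Real.one_rpow] at hw
    refine (tsum_of_norm_bounded ((summable_inv_one_add_deg_pow d).hasSum.mul_left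
      (C2 * (C1 * M))) fun n => ?_).trans_eq (by ring)
    rw [← div_eq_mul_inv, le_div_iff₀' (by positivity)]
    exact hw n
  · change ∑' k, series (laguerreG hα n) k = 1
    rw [series_laguerreG]
    exact (hasSum_pi_single n 1).tsum_eq

end Dual

/-! ### Exponentially decreasing coefficients -/

section Exponential

variable {d : ℕ} {α : ℝ}

/-- For `α ≥ 1` exponential decay of the coefficients is enough for `𝒢_α`. -/
theorem seqBound_of_norm_le_exp (hα1 : 1 ≤ α) {r M : ℝ} (hr : 0 < r) {a : FormalSeries d}
    (hM : 0 ≤ M) (ha : ∀ n, ‖a n‖ ≤ M * Real.exp (-r * deg n)) : SeqBound α r⁻¹ M a := by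
  intro N n
  have h1 := Real.pow_div_factorial_le_exp (r * deg n) (by positivity) N
  rw [div_le_iff₀ (by positivity), mul_pow] at h1
  have h2 : (N.factorial : ℝ) ≤ (N.factorial : ℝ) ^ α :=
    Real.self_le_rpow_of_one_le (by exact_mod_cast N.factorial_pos) hα1
  have h3 : (deg n : ℝ) ^ N ≤ r⁻¹ ^ N * (Real.exp (r * deg n) * N.factorial) := by
    rw [inv_pow, ← div_eq_inv_mul, le_div_iff₀' (by positivity)]
    exact h1
  calc (deg n : ℝ) ^ N * ‖a n‖
      ≤ r⁻¹ ^ N * (Real.exp (r * deg n) * N.factorial) * (M * Real.exp (-r * deg n)) := by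
        gcongr
        exact ha n
    _ = M * r⁻¹ ^ N * N.factorial * (Real.exp (r * deg n) * Real.exp (-r * deg n)) := by ring
    _ = M * r⁻¹ ^ N * N.factorial := by
        rw [← Real.exp_add, neg_mul, add_neg_cancel, Real.exp_zero, mul_one]
    _ ≤ _ := by gcongr

theorem norm_exp_mul_natCast (z : ℂ) (k : ℕ) : ‖Complex.exp (z * k)‖ = Real.exp (z.re * k) := by
  rw [Complex.norm_exp]
  simp

theorem exists_series_eq_exp (hα1 : 1 ≤ α) {z : ℂ} (hz : z.re < 0) :
    ∃ f : G d α, series f = fun n => Complex.exp (z * (deg n : ℂ)) := by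
  obtain ⟨C, h', -, -, H⟩ := exists_synthesis (d := d) (α := α) (h := (-z.re)⁻¹)
    (by linarith) (inv_pos.2 (neg_pos.2 hz))
  obtain ⟨f, hf, -⟩ := H (fun n => Complex.exp (z * (deg n : ℂ))) 1
    (seqBound_of_norm_le_exp hα1 (neg_pos.2 hz) zero_le_one fun n => by
      rw [norm_exp_mul_natCast, neg_neg, one_mul])
  exact ⟨f, hf⟩

theorem deg_single (j : Fin d) (k : ℕ) : deg (Pi.single j k : Fin d → ℕ) = k := by
  simp [deg]

/-- The coefficients of a function in `𝒢_α` are not all equal to `1`. -/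
theorem series_ne_one (hd : 0 < d) (hα : 0 < α) (f : G d α) : series f ≠ fun _ => 1 := by
  intro h1
  have h2 := (summable_series hα f).comp_injective
    (i := fun k : ℕ => (Pi.single ⟨0, hd⟩ k : Fin d → ℕ))
    (Pi.single_injective (M := fun _ => ℕ) _)
  rw [h1] at h2
  have := tendsto_nhds_unique h2.tendsto_atTop_zero tendsto_const_nhds
  exact zero_ne_one this

/-- For `α ≥ 1` and `Re z < 0`, the functions `e^{z|n|} l_n` tend to `0` in `𝒢_α`, along the
multi-indices `n` with a single nonzero entry. -/
theorem tendsto_exp_smul_laguerreG (hα : 0 < α) (hα1 : 1 ≤ α) {z : ℂ} (hz : z.re < 0)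
    (j : Fin d) :
    Tendsto (fun k : ℕ => Complex.exp (z * (k : ℂ)) • laguerreG hα (Pi.single j k : Fin d → ℕ))
      atTop (𝓝 0) := by
  -- half of the decay is spent on membership in a step, the other half tends to `0`
  set r : ℝ := -z.re / 2 with hr
  have hr0 : 0 < r := by linarith
  obtain ⟨C, h', -, hh', H⟩ := exists_synthesis (d := d) (α := α) (h := r⁻¹) hα (inv_pos.2 hr0)
  refine tendsto_zero_of_step (M := fun k : ℕ => C * Real.exp (-r * k)) hh' (fun k => ?_) ?_
  · have hs : SeqBound α r⁻¹ (Real.exp (-r * k))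
        (series (Complex.exp (z * (k : ℂ)) • laguerreG hα (Pi.single j k : Fin d → ℕ))) := by
      refine seqBound_of_norm_le_exp hα1 hr0 (Real.exp_pos _).le fun n => ?_
      rw [series_smul, series_laguerreG, Pi.smul_apply, smul_eq_mul]
      rcases eq_or_ne n (Pi.single j k) with rfl | hn
      · rw [Pi.single_eq_same, mul_one, norm_exp_mul_natCast, deg_single, ← Real.exp_add]
        refine le_of_eq ?_
        congr 1
        rw [hr]
        ring
      · rw [Pi.single_eq_of_ne hn, mul_zero, norm_zero]
        positivity
    obtain ⟨f, hf, hfb⟩ := H _ _ hs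
    rwa [← series_injective α hf]
  · have h1 : Tendsto (fun k : ℕ => Real.exp (-r * k)) atTop (𝓝 0) := by
      refine Real.tendsto_exp_atBot.comp ?_
      exact tendsto_natCast_atTop_atTop.const_mul_atTop_of_neg (by linarith)
    simpa using h1.const_mul C

end Exponential

/-! ### The propagator -/

section Propagator

variable {d : ℕ} {α : ℝ}

theorem propagator_eq (z : ℂ) (a : FormalSeries d) :
    propagator z a = fun n => Complex.exp (z * (deg n : ℂ)) * a n := rfl

theorem propagator_neg_propagator (z : ℂ) (a : FormalSeries d) :
    propagator (-z) (propagator z a) = a := by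
  funext n
  simp only [propagator_eq]
  rw [← mul_assoc, ← Complex.exp_add, neg_mul, neg_add_cancel, Complex.exp_zero, one_mul]

theorem propagator_propagator_neg (z : ℂ) (a : FormalSeries d) :
    propagator z (propagator (-z) a) = a := by
  simpa using propagator_neg_propagator (-z) a

theorem propagator_injective (z : ℂ) :
    Function.Injective (propagator z : FormalSeries d → FormalSeries d) :=
  Function.LeftInverse.injective (propagator_neg_propagator z)

/-- The propagator is an isomorphism of both spaces if `e^{z|n|}` and `e^{-z|n|}` are
multipliers. -/
theorem exists_equiv_of_isMultiplier (hα : 0 < α) {z : ℂ}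
    (hz : IsMultiplier α fun n : Fin d → ℕ => Complex.exp (z * (deg n : ℂ)))
    (hz' : IsMultiplier α fun n : Fin d → ℕ => Complex.exp (-z * (deg n : ℂ))) :
    (∃ T : G d α ≃L[ℂ] G d α, ∀ f, series (T f) = propagator z (series f)) ∧
      ∃ T : GDual d α ≃L[ℂ] GDual d α, ∀ F, dualSeries hα (T F)
        = propagator z (dualSeries hα F) := by
  obtain ⟨T, hT⟩ := hz.exists_map hα
  obtain ⟨T', hT'⟩ := hz'.exists_map hα
  have hD := dualSeries_precomp hα hT
  have hD' := dualSeries_precomp hα hT'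
  constructor
  · refine ⟨ContinuousLinearEquiv.equivOfInverse T T' (fun f => series_injective α ?_)
      (fun f => series_injective α ?_), hT⟩
    · rw [hT', hT]
      exact propagator_neg_propagator z _
    · rw [hT, hT']
      exact propagator_propagator_neg z _
  · refine ⟨ContinuousLinearEquiv.equivOfInverse (ContinuousLinearMap.precomp ℂ T)
      (ContinuousLinearMap.precomp ℂ T') (fun F => dualSeries_injective hα ?_)
      (fun F => dualSeries_injective hα ?_), hD⟩
    · rw [hD', hD]
      exact propagator_neg_propagator z _
    · rw [hD, hD']
      exact propagator_propagator_neg z _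

theorem isMultiplier_exp_of_re_nonpos {z : ℂ} (hz : z.re ≤ 0) :
    IsMultiplier α fun n : Fin d → ℕ => Complex.exp (z * (deg n : ℂ)) := by
  refine isMultiplier_of_norm_le_one fun n => ?_
  rw [norm_exp_mul_natCast]
  exact Real.exp_le_one_iff.2 (mul_nonpos_of_nonpos_of_nonneg hz (Nat.cast_nonneg _))

theorem isMultiplier_exp_of_lt_one (hα : 0 < α) (hα1 : α < 1) (z : ℂ) :
    IsMultiplier α fun n : Fin d → ℕ => Complex.exp (z * (deg n : ℂ)) := by
  refine isMultiplier_of_norm_le_exp hα hα1 (r := ‖z‖ + 1) (by positivity) fun n => ?_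
  rw [norm_exp_mul_natCast]
  have := Complex.re_le_norm z
  gcongr
  linarith

theorem propagator_series_laguerreG (hα : 0 < α) (z : ℂ) (n : Fin d → ℕ) :
    propagator z (series (laguerreG hα n))
      = series (Complex.exp (z * (deg n : ℂ)) • laguerreG hα n) := by
  rw [series_smul, series_laguerreG]
  funext k
  rcases eq_or_ne k n with rfl | h
  · simp [propagator_eq]
  · simp [propagator_eq, Pi.single_eq_of_ne h]

end Propagator

end

end Laguerre

theorem theorem1p1 (d : ℕ) (hd : 0 < d) (α : ℝ) (hα : 0 < α) (z : ℂ) :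
    -- elements of `𝒢_α` and `𝒢'_α` are identified with their formal Laguerre series
    (Function.Injective (Laguerre.series : Laguerre.G d α → Laguerre.FormalSeries d) ∧
      Function.Injective (Laguerre.dualSeries hα : Laguerre.GDual d α → Laguerre.FormalSeries d)) ∧
    -- (i)
    (z ≠ 0 → α < 1 →
      (∃ T : Laguerre.G d α ≃L[ℂ] Laguerre.G d α,
        ∀ f, Laguerre.series (T f) = Laguerre.propagator z (Laguerre.series f)) ∧
      (∃ T : Laguerre.GDual d α ≃L[ℂ] Laguerre.GDual d α,
        ∀ F, Laguerre.dualSeries hα (T F) = Laguerre.propagator z (Laguerre.dualSeries hα F))) ∧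
    -- (ii)
    (z.re = 0 →
      (∃ T : Laguerre.G d α ≃L[ℂ] Laguerre.G d α,
        ∀ f, Laguerre.series (T f) = Laguerre.propagator z (Laguerre.series f)) ∧
      (∃ T : Laguerre.GDual d α ≃L[ℂ] Laguerre.GDual d α,
        ∀ F, Laguerre.dualSeries hα (T F) = Laguerre.propagator z (Laguerre.dualSeries hα F))) ∧
    -- (iii)
    (1 < α → z.re < 0 →
      (∃ T : Laguerre.G d α →L[ℂ] Laguerre.G d α,
        (∀ f, Laguerre.series (T f) = Laguerre.propagator z (Laguerre.series f)) ∧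
        Function.Injective T ∧ ¬ Function.Surjective T) ∧
      (∃ T : Laguerre.GDual d α →L[ℂ] Laguerre.GDual d α,
        (∀ F, Laguerre.dualSeries hα (T F) = Laguerre.propagator z (Laguerre.dualSeries hα F)) ∧
        Function.Injective T ∧ ¬ Function.Surjective T)) ∧
    -- (iv): there is no continuous realization on `𝒢_α`, and even on its natural domain
    -- `{f ∈ 𝒢_α : e^{zE} f ∈ 𝒢_α}` the map is not continuous
    (1 < α → 0 < z.re →
      (¬ ∃ T : Laguerre.G d α → Laguerre.G d α, Continuous T ∧
        ∀ f, Laguerre.series (T f) = Laguerre.propagator z (Laguerre.series f)) ∧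
      (∀ T : {f : Laguerre.G d α //
            ∃ g : Laguerre.G d α, Laguerre.series g = Laguerre.propagator z (Laguerre.series f)} →
          Laguerre.G d α,
        (∀ f, Laguerre.series (T f) = Laguerre.propagator z (Laguerre.series f.1)) →
        ¬ Continuous T)) := by

  refine ⟨⟨Laguerre.series_injective α, Laguerre.dualSeries_injective hα⟩, fun _ hα1 => ?_,
    fun hz => ?_, fun hα1 hz => ⟨?_, ?_⟩, fun hα1 hz => ⟨?_, ?_⟩⟩
  · exact Laguerre.exists_equiv_of_isMultiplier hα
      (Laguerre.isMultiplier_exp_of_lt_one hα hα1 z)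
      (Laguerre.isMultiplier_exp_of_lt_one hα hα1 (-z))
  · exact Laguerre.exists_equiv_of_isMultiplier hα
      (Laguerre.isMultiplier_exp_of_re_nonpos hz.le)
      (Laguerre.isMultiplier_exp_of_re_nonpos (by simp [hz]))
  · obtain ⟨T, hT⟩ := (Laguerre.isMultiplier_exp_of_re_nonpos (d := d) (α := α) hz.le).exists_map hα
    refine ⟨T, hT, fun f g hfg => ?_, fun hsurj => ?_⟩
    · refine Laguerre.series_injective α (Laguerre.propagator_injective z ?_)
      exact (hT f).symm.trans ((congrArg Laguerre.series hfg).trans (hT g))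
    · -- the preimage of the function with coefficients `e^{z|n|}` has all coefficients `1`
      obtain ⟨g, hg⟩ := Laguerre.exists_series_eq_exp (d := d) hα1.le hz
      obtain ⟨f, rfl⟩ := hsurj g
      refine Laguerre.series_ne_one hd hα f (funext fun n => ?_)
      have := congrFun ((hT f).symm.trans hg) n
      exact mul_left_cancel₀ (Complex.exp_ne_zero _) (this.trans (mul_one _).symm)
  · obtain ⟨T, hT⟩ := (Laguerre.isMultiplier_exp_of_re_nonpos (d := d) (α := α) hz.le).exists_map hα
    have hD := Laguerre.dualSeries_precomp hα hT
    refine ⟨ContinuousLinearMap.precomp ℂ T, hD, fun F F' hF => ?_, fun hsurj => ?_⟩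
    · refine Laguerre.dualSeries_injective hα (Laguerre.propagator_injective z ?_)
      exact (hD F).symm.trans ((congrArg (Laguerre.dualSeries hα) hF).trans (hD F'))
    · -- a preimage `F` of the functional with coefficients `1` has `⟨F, e^{z|n|} l_n⟩ = 1`, although
      -- `e^{z|n|} l_n` tends to `0`
      obtain ⟨F₁, hF₁⟩ := Laguerre.exists_dualSeries_eq_one d hα
      obtain ⟨F, hF⟩ := hsurj F₁
      have h1 := (F.continuous.tendsto 0).comp
        (Laguerre.tendsto_exp_smul_laguerreG hα hα1.le hz ⟨0, hd⟩)
      have h2 : ∀ k : ℕ, F (Complex.exp (z * (k : ℂ))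
          • Laguerre.laguerreG hα (Pi.single ⟨0, hd⟩ k : Fin d → ℕ)) = 1 := by
        intro k
        have h3 := congrFun (hD F) (Pi.single ⟨0, hd⟩ k)
        rw [hF, Laguerre.deg_single] at h3
        rw [map_smul]
        exact h3.symm.trans (hF₁ _)
      rw [map_zero] at h1
      exact zero_ne_one (tendsto_nhds_unique h1
        (tendsto_const_nhds.congr fun k => (h2 k).symm))
  · rintro ⟨T, -, hT⟩
    obtain ⟨f, hf⟩ := Laguerre.exists_series_eq_exp (d := d) (z := -z) hα1.le (by simpa using hz)
    refine Laguerre.series_ne_one hd hα (T f) ?_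
    rw [hT, hf]
    have : (fun n : Fin d → ℕ => Complex.exp (-z * (Laguerre.deg n : ℂ)))
        = Laguerre.propagator (-z) fun _ => 1 := by
      funext n
      exact (mul_one _).symm
    rw [this, Laguerre.propagator_propagator_neg]
  · intro T hT hcont
    -- `e^{-z|n|} l_n` tends to `0`, but its image `l_n` does not
    have hlim := Laguerre.tendsto_exp_smul_laguerreG (d := d) hα hα1.le (z := -z)
      (by simpa using hz) ⟨0, hd⟩
    set u : ℕ → Laguerre.G d α := fun k => Complex.exp (-z * (k : ℂ))
      • Laguerre.laguerreG hα (Pi.single ⟨0, hd⟩ k : Fin d → ℕ) with hu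
    have hprop : ∀ k : ℕ, Laguerre.series (Laguerre.laguerreG hα (Pi.single ⟨0, hd⟩ k : Fin d → ℕ))
        = Laguerre.propagator z (Laguerre.series (u k)) := by
      intro k
      have := Laguerre.propagator_series_laguerreG hα (-z) (Pi.single ⟨0, hd⟩ k : Fin d → ℕ)
      rw [Laguerre.deg_single] at this
      rw [hu]
      simp only
      rw [← this, Laguerre.propagator_propagator_neg]
    have h0 : Laguerre.series (0 : Laguerre.G d α)
        = Laguerre.propagator z (Laguerre.series (0 : Laguerre.G d α)) := by
      have : Laguerre.series (0 : Laguerre.G d α) = 0 := map_zero (Laguerre.seriesLinear d α)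
      rw [this]
      funext n
      simp [Laguerre.propagator_eq]
    have hsub : Filter.Tendsto (fun k => (⟨u k, _, hprop k⟩ : {f : Laguerre.G d α //
        ∃ g : Laguerre.G d α, Laguerre.series g = Laguerre.propagator z (Laguerre.series f)}))
        Filter.atTop (nhds ⟨0, _, h0⟩) := tendsto_subtype_rng.2 hlim
    obtain ⟨F₁, hF₁⟩ := Laguerre.exists_dualSeries_eq_one d hα
    have h1 := (F₁.continuous.tendsto _).comp ((hcont.tendsto _).comp hsub)
    have hT0 : T ⟨0, _, h0⟩ = 0 := Laguerre.series_injective α ((hT _).trans h0.symm)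
    rw [hT0, map_zero] at h1
    refine zero_ne_one (tendsto_nhds_unique h1 (tendsto_const_nhds.congr fun k => ?_))
    have hTk : T ⟨u k, _, hprop k⟩ = Laguerre.laguerreG hα (Pi.single ⟨0, hd⟩ k : Fin d → ℕ) :=
      Laguerre.series_injective α ((hT _).trans (hprop k).symm)
    simp only [Function.comp_apply]
    rw [hTk, hF₁]
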